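/- Let $N\ge 2$ and let $\zeta,\tau\in\mathbb C$ with $\operatorname{Im}\zeta>0$, $\operatorname{Im}\tau>0$; let $c\in\mathbb C$ and $\tau^*=\tau-c\zeta$. Put $q=e^{i\pi\zeta}$, $p=e^{2i\pi\tau}$, $p^*=pq^{-2c}=e^{2i\pi\tau^*}$, $\omega=e^{2i\pi/N}$. Spectral parameters are written additively, $z=e^{i\pi\xi}$, so that $q^sz$ stands for $\xi+s\zeta$ and $-p^{1/2}z$ for $\xi+\tau+1$; functions of $z$ are functions of $\xi\in\mathbb C$. **R-matrix.** Let $\vartheta_{\gamma_1,\gamma_2}(\xi,\tau)=\sum_{m\in\mathbb Z}\exp(i\pi(m+\gamma_1)^2\tau+2i\pi(m+\gamma_1)(\xi+\gamma_2))$, $(x;a_1,\dots,a_k)_\infty=\prod_{n_i\ge0}(1-xa_1^{n_1}\cdots a_k^{n_k})$, $\Theta_a(x)=(x;a)_\infty(ax^{-1};a)_\infty(a;a)_\infty$, $g_{ij}=\omega^i\delta_{ij}$, $(g^{1/2})_{ij}=e^{i\pi i/N}\delta_{ij}$ (with row index $i=0,\dots,N-1$ in the exponents), $h_{ij}=\delta_{i+1,j}$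 (indices mod $N$), $I_\alpha=g^{\alpha_2}h^{\alpha_1}$ for $\alpha\in\mathbb Z_N^2$, and $$W_\alpha(\xi,\zeta,\tau)=\frac{\vartheta_{\frac12+\frac{\alpha_1}N,\frac12+\frac{\alpha_2}N}(\xi+\frac\zeta N,\tau)}{N\,\vartheta_{\frac12+\frac{\alpha_1}N,\frac12+\frac{\alpha_2}N}(\frac\zeta N,\tau)},\qquad \tau_N(z)=z^{\frac2N-2}\frac{\Theta_{q^{2N}}(qz^2)}{\Theta_{q^{2N}}(qz^{-2})},$$ $$\frac1{\kappa(x)}=\frac{(q^{2N}x^{-1},\,q^2x,\,px^{-1},\,pq^{2N-2}x;\,p,q^{2N})_\infty}{(q^{2N}x,\,q^2x^{-1},\,px,\,pq^{2N-2}x^{-1};\,p,q^{2N})_\infty},$$ where $(x_1,\dots,x_4;a,b)_\infty=\prod_j(x_j;a,b)_\infty$. Let $$\widetilde R(z)=\frac{z^{2/N-2}}{\kappa(z^2)}\,\frac{\vartheta_{\frac12,\frac12}(\zeta,\tau)}{\vartheta_{\frac12,\frac12}(\xi+\zeta,\tau)}\sum_{\alpha\in\mathbb Z_N^2}W_\alpha(\xi,\zeta,\tau)\,I_\alpha\otimes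 I_\alpha^{-1},\qquad R=(g^{1/2}\otimes g^{1/2})\,\widetilde R\,(g^{-1/2}\otimes g^{-1/2}),$$ $\widehat R(z)=\tau_N(q^{1/2}z^{-1})R(z)$, and let $\widehat R^*$ be $\widehat R$ with $p$ (that is, $\tau$) replaced by $p^*$ (that is, $\tau^*$). **Algebra.** Call $z/w$, with $z=e^{i\pi\xi}$ and $w=e^{i\pi\eta}$, *generic* if $\xi-\eta\notin\mathbb Z+\mathbb Z\zeta+\mathbb Z\tau+\mathbb Z\tau^*$. Let $\mathcal A_{q,p}(\widehat{gl}(N)_c)$ be the unital associative $\mathbb C$-algebra generated by the entries of the $N\times N$ matrices $L(z)$ and of their inverses $L(z)^{-1}$ ($\xi\in\mathbb C$), with the relations, for all generic $z/w$, $$\widehat R_{12}(z/w)\,L_1(z)\,L_2(w)=L_2(w)\,L_1(z)\,\widehat R^*_{12}(z/w),\qquad L_1=L\otimes1,\ L_2=1\otimes L .$$ Let $\mathcal A_{q,p}(\widehat{sl}(N)_c)$ be its quotient by the relations $q\text{-}\det L(z)=q^{c/2}$ for all $z$, where $q\text{-}\det L(z)=\sum_{\sigma\in\mathfrak S_N}\varepsilon(\sigma)\,L_{N,\sigma(N)}(zq^{-1})\,L_{N-1,\sigma(N-1)}(zq^{-2})\cdots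 L_{1,\sigma(1)}(zq^{-N})$. Put $L^+(z)=L(q^{c/2}z)$ and $L^-(z)=(g^{1/2}hg^{1/2})\,L(-p^{1/2}z)\,(g^{1/2}hg^{1/2})^{-1}$. **Theorem 2.** Let $c=-N$ (the critical level) and assume that $\zeta\notin\mathbb Z+\mathbb Z\tau$ and $\zeta\notin\mathbb Z+\mathbb Z\tau^*$, so that $\widehat R$ and $\widehat R^*$ are defined. Then the operators $$t(z)=\operatorname{Tr}\bigl(L^+(q^{c/2}z)\,L^-(z)^{-1}\bigr)$$ lie in the center of $\mathcal A_{q,p}(\widehat{sl}(N)_c)$, in the same sense in which the defining relations hold, i.e. identically in generic spectral parameters: $t(z)\,L_{ij}(w)=L_{ij}(w)\,t(z)$ for all $i,j$ and all generic $z/w$; and for every element $a$ of $\mathcal A_{q,p}(\widehat{sl}(N)_c)$ one has $t(z)\,a=a\,t(z)$ for all $\xi$ (with $z=e^{i\pi\xi}$) outside a countable set. -/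

import Mathlib

open scoped Kronecker

noncomputable section

namespace EllipticAlgebra

/-! ## Special functions

Multiplicative variables `z, q, p` are written through additive ones `ξ, ζ, τ`:
`z = exp (iπξ)`, `q = exp (iπζ)`, `p = exp (2iπτ)`.  Thus `q ^ s * z` is the point `ξ + s ζ`
and `-p^{1/2} z` is the point `ξ + τ + 1`. -/

/-- `em ξ = exp (iπξ)`, the multiplicative variable attached to the additive variable `ξ`. -/
def em (ξ : ℂ) : ℂ := Complex.exp (Complex.I * Real.pi * ξ)

/-- Jacobi theta function with characteristics `γ₁, γ₂`. -/
def theta (γ₁ γ₂ ξ τ : ℂ) : ℂ :=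
  ∑' m : ℤ, Complex.exp (Complex.I * Real.pi * ((m : ℂ) + γ₁) ^ 2 * τ +
    2 * Complex.I * Real.pi * ((m : ℂ) + γ₁) * (ξ + γ₂))

/-- `(x; a)_∞`. -/
def poch (x a : ℂ) : ℂ := ∏' n : ℕ, (1 - x * a ^ n)

/-- `(x; a, b)_∞`. -/
def poch₂ (x a b : ℂ) : ℂ := ∏' n : ℕ × ℕ, (1 - x * a ^ n.1 * b ^ n.2)

/-- `Θ_a(x) = (x; a)_∞ (a x⁻¹; a)_∞ (a; a)_∞`. -/
def bigTheta (a x : ℂ) : ℂ := poch x a * poch (a * x⁻¹) a * poch a a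

/-- The scalar function `τ_N(z)` at `z = exp (iπξ)`, where `q = exp (iπζ)`. -/
def tauFun (N : ℕ) (ζ ξ : ℂ) : ℂ :=
  em ((2 / (N : ℂ) - 2) * ξ) *
    (bigTheta (em ζ ^ (2 * N)) (em ζ * em ξ ^ 2) /
      bigTheta (em ζ ^ (2 * N)) (em ζ * (em ξ ^ 2)⁻¹))

/-- The normalization factor `1 / κ(x)` with `x = z²`, as a function of `q`, `p`. -/
def invKappa (N : ℕ) (q p x : ℂ) : ℂ :=
  (poch₂ (q ^ (2 * N) * x⁻¹) p (q ^ (2 * N)) * poch₂ (q ^ 2 * x) p (q ^ (2 * N)) *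
      poch₂ (p * x⁻¹) p (q ^ (2 * N)) * poch₂ (p * q ^ (2 * N - 2) * x) p (q ^ (2 * N))) /
    (poch₂ (q ^ (2 * N) * x) p (q ^ (2 * N)) * poch₂ (q ^ 2 * x⁻¹) p (q ^ (2 * N)) *
      poch₂ (p * x) p (q ^ (2 * N)) * poch₂ (p * q ^ (2 * N - 2) * x⁻¹) p (q ^ (2 * N)))

/-! ## The elliptic R-matrix of the `ℤ_N`-vertex model

Rows and columns of matrices on `ℂ^N ⊗ ℂ^N` are indexed by `Fin N × Fin N`. -/

/-- `g = diag (ω^i)`, `ω = exp (2iπ/N)`. -/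
def gMat (N : ℕ) : Matrix (Fin N) (Fin N) ℂ :=
  Matrix.diagonal fun i => em (2 * (i : ℕ) / (N : ℂ))

/-- `g^{1/2} = diag (ω^{i/2})`. -/
def gHalf (N : ℕ) : Matrix (Fin N) (Fin N) ℂ :=
  Matrix.diagonal fun i => em ((i : ℕ) / (N : ℂ))

/-- The cyclic shift `h_{ij} = δ_{i+1, j}`, indices modulo `N`. -/
def hMat (N : ℕ) : Matrix (Fin N) (Fin N) ℂ :=
  Matrix.of fun i j => if ((i : ℕ) + 1) % N = (j : ℕ) then 1 else 0

/-- `I_{(α₁, α₂)} = g^{α₂} h^{α₁}`. -/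
def iMat (N : ℕ) (α : Fin N × Fin N) : Matrix (Fin N) (Fin N) ℂ :=
  gMat N ^ (α.2 : ℕ) * hMat N ^ (α.1 : ℕ)

/-- The Boltzmann weight functions `W_{(α₁, α₂)}(ξ, ζ, τ)`. -/
def wFun (N : ℕ) (α : Fin N × Fin N) (ξ ζ τ : ℂ) : ℂ :=
  theta (1 / 2 + (α.1 : ℕ) / (N : ℂ)) (1 / 2 + (α.2 : ℕ) / (N : ℂ)) (ξ + ζ / N) τ /
    (N * theta (1 / 2 + (α.1 : ℕ) / (N : ℂ)) (1 / 2 + (α.2 : ℕ) / (N : ℂ)) (ζ / N) τ)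

/-- The `N`-elliptic R-matrix `R̃(z, q, p)`. -/
def rTilde (N : ℕ) (ζ τ ξ : ℂ) : Matrix (Fin N × Fin N) (Fin N × Fin N) ℂ :=
  (em ((2 / (N : ℂ) - 2) * ξ) * invKappa N (em ζ) (em (2 * τ)) (em ξ ^ 2) *
      (theta (1 / 2) (1 / 2) ζ τ / theta (1 / 2) (1 / 2) (ξ + ζ) τ)) •
    ∑ α : Fin N × Fin N, wFun N α ξ ζ τ • (iMat N α ⊗ₖ (iMat N α)⁻¹)

/-- The gauge-transformed R-matrix `R = (g^{1/2} ⊗ g^{1/2}) R̃ (g^{-1/2} ⊗ g^{-1/2})`. -/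
def rMat (N : ℕ) (ζ τ ξ : ℂ) : Matrix (Fin N × Fin N) (Fin N × Fin N) ℂ :=
  (gHalf N ⊗ₖ gHalf N) * rTilde N ζ τ ξ * ((gHalf N)⁻¹ ⊗ₖ (gHalf N)⁻¹)

/-- `R̂(z, q, p) = τ_N(q^{1/2} z⁻¹) R(z, q, p)`. -/
def rHat (N : ℕ) (ζ τ ξ : ℂ) : Matrix (Fin N × Fin N) (Fin N × Fin N) ℂ :=
  tauFun N ζ (ζ / 2 - ξ) • rMat N ζ τ ξ

/-- `R̂*(z, q, p) = R̂(z, q, p*)` with `p* = p q^{-2c}`, i.e. `τ* = τ - c ζ`. -/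
def rHatStar (N : ℕ) (ζ τ c ξ : ℂ) : Matrix (Fin N × Fin N) (Fin N × Fin N) ℂ :=
  rHat N ζ (τ - c * ζ) ξ

/-- The ratio `z/w` (additively: the difference `ξ`) is generic: it does not belong to the countable
group `± q^ℤ p^{ℤ/2} p*^{ℤ/2}`, i.e. `ξ ∉ ℤ + ℤ ζ + ℤ τ + ℤ τ*`.  This group contains the
singularities of `R̂`, `R̂*`, of their inverses, of their partial transposes and the inverses of
these, together with all translates by powers of `q`. Two meromorphic functions agree as soon as
they agree off this group. -/
def Generic (ζ τ c ξ : ℂ) : Prop :=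
  ∀ k l m n : ℤ, ξ ≠ k + l * ζ + m * τ + n * (τ - c * ζ)

/-! ## The elliptic algebras -/

/-- `L_1(ξ) = L(ξ) ⊗ 1`. -/
def leg₁ {N : ℕ} {A : Type*} [Ring A] (M : Matrix (Fin N) (Fin N) A) :
    Matrix (Fin N × Fin N) (Fin N × Fin N) A :=
  M ⊗ₖ (1 : Matrix (Fin N) (Fin N) A)

/-- `L_2(ξ) = 1 ⊗ L(ξ)`. -/
def leg₂ {N : ℕ} {A : Type*} [Ring A] (M : Matrix (Fin N) (Fin N) A) :
    Matrix (Fin N × Fin N) (Fin N × Fin N) A :=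
  (1 : Matrix (Fin N) (Fin N) A) ⊗ₖ M

/-- A numerical matrix, regarded as a matrix over a `ℂ`-algebra. -/
def scalarMat {n : Type*} (A : Type*) [Ring A] [Algebra ℂ A] (M : Matrix n n ℂ) : Matrix n n A :=
  M.map (algebraMap ℂ A)

/-- Generators: the entries of `L(ξ)` and of its inverse matrix, for every `ξ`. -/
inductive Gen (N : ℕ) : Type
  | L (ξ : ℂ) (i j : Fin N) : Gen N
  | Linv (ξ : ℂ) (i j : Fin N) : Gen N

/-- The matrix `L(ξ)` of free generators. -/
def freeL (N : ℕ) (ξ : ℂ) : Matrix (Fin N) (Fin N) (FreeAlgebra ℂ (Gen N)) :=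
  Matrix.of fun i j => FreeAlgebra.ι ℂ (Gen.L ξ i j)

/-- The matrix of free generators which becomes `L(ξ)⁻¹`. -/
def freeLinv (N : ℕ) (ξ : ℂ) : Matrix (Fin N) (Fin N) (FreeAlgebra ℂ (Gen N)) :=
  Matrix.of fun i j => FreeAlgebra.ι ℂ (Gen.Linv ξ i j)

/-- Defining relations: `L(ξ)` is invertible, and
`R̂₁₂(z/w) L₁(z) L₂(w) = L₂(w) L₁(z) R̂*₁₂(z/w)` identically in generic `z/w`. -/
inductive RelGL (N : ℕ) (ζ τ c : ℂ) :
    FreeAlgebra ℂ (Gen N) → FreeAlgebra ℂ (Gen N) → Prop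
  | mul_inv (ξ : ℂ) (i j : Fin N) :
      RelGL N ζ τ c ((freeL N ξ * freeLinv N ξ) i j)
        ((1 : Matrix (Fin N) (Fin N) (FreeAlgebra ℂ (Gen N))) i j)
  | inv_mul (ξ : ℂ) (i j : Fin N) :
      RelGL N ζ τ c ((freeLinv N ξ * freeL N ξ) i j)
        ((1 : Matrix (Fin N) (Fin N) (FreeAlgebra ℂ (Gen N))) i j)
  | rll (ξ η : ℂ) (h : Generic ζ τ c (ξ - η)) (a b : Fin N × Fin N) :
      RelGL N ζ τ c
        ((scalarMat (FreeAlgebra ℂ (Gen N)) (rHat N ζ τ (ξ - η)) * leg₁ (freeL N ξ) * leg₂ (freeL N η)) a b)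
        ((leg₂ (freeL N η) * leg₁ (freeL N ξ) *
          scalarMat (FreeAlgebra ℂ (Gen N)) (rHatStar N ζ τ c (ξ - η))) a b)

/-- The algebra `A_{q,p}(ĝl(N)_c)`. -/
abbrev AlgGL (N : ℕ) (ζ τ c : ℂ) : Type := RingQuot (RelGL N ζ τ c)

/-- The invertible matrix `L(ξ)` over `A_{q,p}(ĝl(N)_c)`. -/
def LGL (N : ℕ) (ζ τ c ξ : ℂ) : (Matrix (Fin N) (Fin N) (AlgGL N ζ τ c))ˣ where
  val := (RingQuot.mkAlgHom ℂ (RelGL N ζ τ c)).mapMatrix (freeL N ξ)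
  inv := (RingQuot.mkAlgHom ℂ (RelGL N ζ τ c)).mapMatrix (freeLinv N ξ)
  val_inv := by
    rw [← map_mul, ← map_one (RingQuot.mkAlgHom ℂ (RelGL N ζ τ c)).mapMatrix]
    ext i j
    exact RingQuot.mkAlgHom_rel ℂ (RelGL.mul_inv ξ i j)
  inv_val := by
    rw [← map_mul, ← map_one (RingQuot.mkAlgHom ℂ (RelGL N ζ τ c)).mapMatrix]
    ext i j
    exact RingQuot.mkAlgHom_rel ℂ (RelGL.inv_mul ξ i j)

/-- The quantum determinant
`q-det L(z) = ∑_σ ε(σ) ∏_i L_{i,σ(i)}(z q^{i-N-1})`, `i = 1, …, N`; the factors are ordered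
by decreasing `i` from left to right (here `i` is counted from `0`, so the shift is `q^{i-N}`). -/
def qDet (N : ℕ) (ζ τ c ξ : ℂ) : AlgGL N ζ τ c :=
  ∑ σ : Equiv.Perm (Fin N), (Equiv.Perm.sign σ : ℤ) •
    (List.ofFn fun k : Fin N =>
      (LGL N ζ τ c (ξ + (((k.rev : ℕ) : ℂ) - N) * ζ)).val k.rev (σ k.rev)).prod

/-- The relation `q-det L = q^{c/2}`. -/
inductive RelSL (N : ℕ) (ζ τ c : ℂ) : AlgGL N ζ τ c → AlgGL N ζ τ c → Prop
  | qDet_eq (ξ : ℂ) :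
      RelSL N ζ τ c (qDet N ζ τ c ξ) (algebraMap ℂ (AlgGL N ζ τ c) (em (c / 2 * ζ)))

/-- The elliptic algebra `A_{q,p}(ŝl(N)_c) = A_{q,p}(ĝl(N)_c) / ⟨q-det L - q^{c/2}⟩`. -/
abbrev AlgSL (N : ℕ) (ζ τ c : ℂ) : Type := RingQuot (RelSL N ζ τ c)

/-- The invertible matrix `L(ξ)` over `A_{q,p}(ŝl(N)_c)`. -/
def LMat (N : ℕ) (ζ τ c ξ : ℂ) : (Matrix (Fin N) (Fin N) (AlgSL N ζ τ c))ˣ :=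
  Units.map ((RingQuot.mkAlgHom ℂ (RelSL N ζ τ c)).mapMatrix (m := Fin N)).toMonoidHom
    (LGL N ζ τ c ξ)

/-- `L⁺(z) = L(q^{c/2} z)`. -/
def LPlus (N : ℕ) (ζ τ c ξ : ℂ) : (Matrix (Fin N) (Fin N) (AlgSL N ζ τ c))ˣ :=
  LMat N ζ τ c (ξ + c / 2 * ζ)

theorem em_ne_zero (x : ℂ) : em x ≠ 0 := Complex.exp_ne_zero _

theorem gHalf_det_isUnit (N : ℕ) : IsUnit (gHalf N).det := by
  rw [gHalf, Matrix.det_diagonal, isUnit_iff_ne_zero]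
  exact Finset.prod_ne_zero_iff.2 fun i _ => em_ne_zero _

theorem hMat_mul_transpose (N : ℕ) : hMat N * (hMat N).transpose = 1 := by
  ext i j
  have hN : 0 < N := i.pos
  rw [Matrix.mul_apply, Finset.sum_eq_single (⟨((i : ℕ) + 1) % N, Nat.mod_lt _ hN⟩ : Fin N)]
  · have key : ((j : ℕ) + 1) % N = ((i : ℕ) + 1) % N ↔ i = j := by
      constructor
      · intro h
        have h' : (j : ℕ) ≡ (i : ℕ) [MOD N] := Nat.ModEq.add_right_cancel' 1 h
        exact Fin.ext ((Nat.ModEq.eq_of_lt_of_lt h' j.isLt i.isLt).symm)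
      · rintro rfl
        rfl
    simp [hMat, Matrix.one_apply, key]
  · intro b _ hb
    have : ¬ ((i : ℕ) + 1) % N = (b : ℕ) := fun h => hb (Fin.ext h.symm)
    simp [hMat, this]
  · simp

/-- The invertible numerical matrix `g^{1/2} h g^{1/2}`. -/
def twist (N : ℕ) : (Matrix (Fin N) (Fin N) ℂ)ˣ :=
  Matrix.nonsingInvUnit (gHalf N) (gHalf_det_isUnit N) *
    ⟨hMat N, (hMat N).transpose, hMat_mul_transpose N,
      mul_eq_one_comm.1 (hMat_mul_transpose N)⟩ *
    Matrix.nonsingInvUnit (gHalf N) (gHalf_det_isUnit N)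

/-- `L⁻(z) = (g^{1/2} h g^{1/2}) L(-p^{1/2} z) (g^{1/2} h g^{1/2})⁻¹`. -/
def LMinus (N : ℕ) (ζ τ c ξ : ℂ) : (Matrix (Fin N) (Fin N) (AlgSL N ζ τ c))ˣ :=
  let H : (Matrix (Fin N) (Fin N) (AlgSL N ζ τ c))ˣ :=
    Units.map ((Algebra.ofId ℂ (AlgSL N ζ τ c)).mapMatrix (m := Fin N)).toMonoidHom (twist N)
  H * LMat N ζ τ c (ξ + τ + 1) * H⁻¹

/-- The trace operator `t(z) = Tr (L⁺(q^{c/2} z) L⁻(z)⁻¹)`. -/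
def tOp (N : ℕ) (ζ τ c ξ : ℂ) : AlgSL N ζ τ c :=
  Matrix.trace (LPlus N ζ τ c (ξ + c / 2 * ζ) * (LMinus N ζ τ c ξ)⁻¹).val

/-- An operator-valued function `T` of the spectral parameter is central, in the sense in which all
relations of the algebra hold, i.e. identically in generic spectral parameters: for each `a` in
the algebra, `T(ξ) a = a T(ξ)` for all `ξ` off a countable set. -/
def IsCentralCurrent {A : Type*} [Ring A] (T : ℂ → A) : Prop :=
  ∀ a : A, {ξ : ℂ | ¬ Commute (T ξ) a}.Countable

end EllipticAlgebra

end

/-!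
Write `x = ξ - η`, `y = x - N ζ` and `τ* = τ + N ζ`, the shifted period at the critical level. Up to
a scalar function, the R-matrix is Belavin's matrix `B(x) = ∑ w_α(x) J_α ⊗ J_α⁻¹` (`belavin`,
`rHat_eq`), whose coefficients are ratios of translates of the odd theta function. Let `B'` denote
`B` with its tensor factors exchanged. Three properties of `B` are used:

* unitarity, `B(x) B'(-x) ∝ 1` (`belavin_mul_belavinSwap`);
* quasi-periodicity: translation by `τ + 1` is conjugation of the first factor by
  `g^{1/2} h g^{1/2}`, up to a scalar (`belavin_add_tau_add_one`);
* crossing: the partial transposes of `B(x - N ζ)` and `B'(-x)` are inverse to each other, up to a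
  scalar (`belavin_crossing`).

Expanding the products over `(ℤ / N)²`, unitarity and crossing amount to identities between sums of
products of two weights. Each such sum is a theta function of degree two in `x`. For a nontrivial
character it has two known zeros, and hence vanishes because the remaining factor, of degree zero,
has a nontrivial unitary multiplier (`wRatio_unitarity_off`, `wRatio_crossing_off`). For the trivial
character it is determined by a few Taylor coefficients (`wRatio_unitarity_diag`,
`wRatio_crossing_diag`), which come from the sum of all weights at one point (`sum_wRatio`).
Everything there is deduced from the multipliers and the zeros of the theta function; its zeros come
from the triple product formula, itself obtained from the uniqueness of theta functions of degree
one.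

Now set `P = L(ξ - N ζ)`, `U = L(ξ + τ + 1)`, `H = g^{1/2} h g^{1/2}`, so that
`t(z) = Tr (P (H U H⁻¹)⁻¹)`. Quasi-periodicity and unitarity turn the exchange relation of `U` with
`L(η)` into one between `L(η)` and `(H U H⁻¹)⁻¹`, with `B'(-x)` for the period `τ` on one side and
`B'(-y)` for the period `τ*` on the other. Combined with the exchange relation of `P`, unitarity at
`y` removes the second R-matrix, and crossing removes the first one under the partial trace
(`commute_trace_of_exchange`). The result is `a t(z) L(η) = b L(η) t(z)` with explicit scalars.
That `a = b` is the identity `rScalar_identity` between the normalization factors. It is where the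
factor `κ` matters: the double infinite products telescope, and what remains is a ratio of odd
theta functions (`kappaAdd_mul_oddTheta`).

The second assertion follows from the first, since the elements that commute with `t(z)` off a
countable set form a subalgebra that contains the generators.
-/

noncomputable section

namespace EllipticAlgebra

/-! ### The exponential `em` -/

theorem em_add (x y : ℂ) : em (x + y) = em x * em y := by
  simp only [em, mul_add, Complex.exp_add]

theorem em_neg (x : ℂ) : em (-x) = (em x)⁻¹ := by
  simp only [em, mul_neg, Complex.exp_neg]

@[simp] theorem em_zero : em 0 = 1 := by simp [em]

theorem em_pow (x : ℂ) (n : ℕ) : em x ^ n = em (n * x) := by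
  rw [em, em, ← Complex.exp_nat_mul]; congr 1; ring

@[simp] theorem em_one : em 1 = -1 := by
  rw [em, mul_one, mul_comm, Complex.exp_pi_mul_I]

theorem em_eq_one_iff (x : ℂ) : em x = 1 ↔ ∃ n : ℤ, x = 2 * n := by
  rw [em, Complex.exp_eq_one_iff]
  have hpi : (Real.pi : ℂ) ≠ 0 := by exact_mod_cast Real.pi_ne_zero
  refine exists_congr fun n => ⟨fun h => ?_, fun h => ?_⟩
  · have : Complex.I * Real.pi * (x - 2 * n) = 0 := by linear_combination h
    simpa [Complex.I_ne_zero, hpi, sub_eq_zero] using this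
  · rw [h]; ring

theorem em_two_mul_int (n : ℤ) : em (2 * n) = 1 := (em_eq_one_iff _).2 ⟨n, rfl⟩

theorem norm_em (x : ℂ) : ‖em x‖ = Real.exp (-(Real.pi * x.im)) := by
  rw [em, Complex.norm_exp]
  congr 1
  simp

theorem differentiable_em : Differentiable ℂ em := by
  unfold em; fun_prop

theorem hasDerivAt_em (x : ℂ) : HasDerivAt em (Complex.I * Real.pi * em x) x := by
  have : HasDerivAt em _ x := ((hasDerivAt_id x).const_mul (Complex.I * Real.pi)).cexp
  convert this using 1
  simp [em, mul_comm]

/-! ### Entire functions with multipliers on a lattice -/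

/-- Induction along the lattice `w + ℤ + ℤ τ`. -/
theorem lattice_induction {τ : ℂ} {P : ℂ → Prop} (h1 : ∀ z, P z ↔ P (z + 1))
    (hτ : ∀ z, P z ↔ P (z + τ)) {w : ℂ} (hw : P w) (m n : ℤ) : P (w + m + n * τ) := by
  have key : ∀ (u : ℂ), (∀ z, P z ↔ P (z + u)) → ∀ (z : ℂ) (k : ℤ), P z → P (z + k * u) := by
    intro u hu z k hz
    induction k using Int.induction_on with
    | zero => simpa using hz
    | succ i ih =>
      have := (hu _).1 ih
      convert this using 1
      push_cast; ring
    | pred i ih =>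
      refine (hu _).2 ?_
      convert ih using 1
      push_cast; ring
  refine key τ hτ _ n ?_
  simpa using key 1 h1 w m hw

/-- An entire function which is multiplied by constants under two independent translations is an
exponential. -/
theorem exists_eq_const_mul_em {τ a b : ℂ} (hτ : 0 < τ.im) (ha : a ≠ 0) (hb : b ≠ 0) {g : ℂ → ℂ}
    (hg : Differentiable ℂ g) (h1 : ∀ z, g (z + 1) = a * g z) (h2 : ∀ z, g (z + τ) = b * g z) :
    ∃ C k : ℂ, ∀ z, g z = C * em (k * z) := by
  -- `k` is chosen so that `em k` and `em (k * τ)` have the absolute values of `a` and `b`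
  set v : ℝ := -Real.log ‖a‖ / Real.pi with hv
  set u : ℝ := (-Real.log ‖b‖ / Real.pi - v * τ.re) / τ.im with hu
  set k : ℂ := ⟨u, v⟩ with hk
  have hpi := Real.pi_ne_zero
  have ek1 : ‖em k‖ = ‖a‖ := by
    rw [norm_em, hk]
    simp only [hv]
    rw [mul_div_cancel₀ _ hpi, neg_neg, Real.exp_log (norm_pos_iff.2 ha)]
  have ek2 : ‖em (k * τ)‖ = ‖b‖ := by
    rw [norm_em]
    have : (k * τ).im = -Real.log ‖b‖ / Real.pi := by
      simp only [Complex.mul_im, hk, hu]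
      field_simp
      ring
    rw [this, mul_div_cancel₀ _ hpi, neg_neg, Real.exp_log (norm_pos_iff.2 hb)]
  set F : ℂ → ℂ := fun z => g z * em (-(k * z)) with hF
  have hFd : Differentiable ℂ F :=
    hg.mul (differentiable_em.comp ((differentiable_id.const_mul k).neg))
  have F1 : ∀ z, ‖F (z + 1)‖ = ‖F z‖ := by
    intro z
    have : F (z + 1) = a / em k * F z := by
      simp only [hF, h1, mul_add, mul_one, em_add, em_neg]
      field_simp
    rw [this, norm_mul, norm_div, ek1, div_self (norm_ne_zero_iff.2 ha), one_mul]
  have F2 : ∀ z, ‖F (z + τ)‖ = ‖F z‖ := by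
    intro z
    have : F (z + τ) = b / em (k * τ) * F z := by
      simp only [hF, h2, mul_add, em_add, em_neg]
      field_simp
    rw [this, norm_mul, norm_div, ek2, div_self (norm_ne_zero_iff.2 hb), one_mul]
  have hbdd : Bornology.IsBounded (Set.range F) := by
    have hK : IsCompact ((fun s : ℝ × ℝ => F (s.1 + s.2 * τ)) ''
        (Set.Icc (0 : ℝ) 1 ×ˢ Set.Icc (0 : ℝ) 1)) := by
      refine (isCompact_Icc.prod isCompact_Icc).image ?_
      exact hFd.continuous.comp (by fun_prop)
    obtain ⟨M, hM⟩ := hK.isBounded.exists_norm_le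
    refine isBounded_iff_forall_norm_le.2 ⟨M, ?_⟩
    rintro _ ⟨z, rfl⟩
    set t : ℝ := z.im / τ.im with ht
    set s : ℝ := z.re - t * τ.re with hs
    have hz : z = (Int.fract s + Int.fract t * τ : ℂ) + (⌊s⌋ : ℤ) + (⌊t⌋ : ℤ) * τ := by
      have hst : z = s + t * τ := by
        apply Complex.ext
        · simp [hs]
        · simp [ht, hτ.ne']
      conv_lhs => rw [hst, ← Int.fract_add_floor s, ← Int.fract_add_floor t]
      push_cast
      ring
    have := lattice_induction (P := fun y => ‖F y‖ = ‖F (Int.fract s + Int.fract t * τ : ℂ)‖)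
      (fun y => by rw [F1]) (fun y => by rw [F2]) rfl ⌊s⌋ ⌊t⌋
    rw [← hz] at this
    rw [this]
    refine hM _ ⟨(Int.fract s, Int.fract t), ⟨⟨?_, ?_⟩, ?_, ?_⟩, rfl⟩
    · exact Int.fract_nonneg _
    · exact (Int.fract_lt_one _).le
    · exact Int.fract_nonneg _
    · exact (Int.fract_lt_one _).le
  refine ⟨F 0, k, fun z => ?_⟩
  rw [← hFd.apply_eq_apply_of_bounded hbdd z 0]
  simp only [hF, em_neg]
  field_simp [em_ne_zero]

/-- Division of entire functions, the divisor having only simple zeros. -/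
theorem exists_differentiable_mul {f h : ℂ → ℂ} (hf : Differentiable ℂ f)
    (hh : Differentiable ℂ h) (hz : ∀ z, h z = 0 → f z = 0 ∧ deriv h z ≠ 0) :
    ∃ g : ℂ → ℂ, Differentiable ℂ g ∧ ∀ z, f z = g z * h z := by
  classical
  refine ⟨fun z => if h z = 0 then deriv f z / deriv h z else f z / h z, fun z₀ => ?_, fun z => ?_⟩
  · by_cases h0 : h z₀ = 0
    · obtain ⟨hf0, hd⟩ := hz z₀ h0
      have dh : DifferentiableAt ℂ (dslope h z₀) z₀ :=
        ((Complex.differentiableOn_dslope Filter.univ_mem).2 hh.differentiableOn).differentiableAt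
          Filter.univ_mem
      have df : DifferentiableAt ℂ (dslope f z₀) z₀ :=
        ((Complex.differentiableOn_dslope Filter.univ_mem).2 hf.differentiableOn).differentiableAt
          Filter.univ_mem
      have hne : dslope h z₀ z₀ ≠ 0 := by rwa [dslope_same]
      refine (df.div dh hne).congr_of_eventuallyEq ?_
      filter_upwards [dh.continuousAt.eventually_ne hne] with z hzne
      by_cases hzz : z = z₀
      · subst hzz
        simp [h0]
      · rw [dslope_of_ne _ hzz, slope_def_field, h0, sub_zero] at hzne
        have hz1 : h z ≠ 0 := fun h => hzne (by rw [h, zero_div])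
        have hz2 : z - z₀ ≠ 0 := sub_ne_zero.2 hzz
        simp only [hz1, if_false, Pi.div_apply, dslope_of_ne _ hzz, slope_def_field, h0, hf0,
          sub_zero]
        field_simp
    · refine ((hf z₀).div (hh z₀) h0).congr_of_eventuallyEq ?_
      filter_upwards [(hh z₀).continuousAt.eventually_ne h0] with z hzne
      simp [hzne]
  · by_cases h0 : h z = 0
    · simp [h0, (hz z h0).1]
    · simp [h0]

/-- `f` is entire with `f (z + 1) = a f(z)` and `f (z + τ) = b exp (-2πi d z) f(z)`: a theta function
of degree `d` on `ℂ / (ℤ + ℤ τ)`. -/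
structure QuasiPeriodic (τ : ℂ) (d : ℤ) (a b : ℂ) (f : ℂ → ℂ) : Prop where
  differentiable : Differentiable ℂ f
  add_one : ∀ z, f (z + 1) = a * f z
  add_tau : ∀ z, f (z + τ) = b * em (-(2 * d * z)) * f z

/-- `θ` has the multipliers of the odd Jacobi theta function, and simple zeros, exactly at the
points of the lattice. -/
structure IsOddTheta (τ : ℂ) (θ : ℂ → ℂ) : Prop
    extends QuasiPeriodic τ 1 (-1) (-em (-τ)) θ where
  zero_iff : ∀ z, θ z = 0 ↔ ∃ m n : ℤ, z = m + n * τ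
  deriv_ne : deriv θ 0 ≠ 0

namespace QuasiPeriodic

variable {τ a b a' b' : ℂ} {d d' : ℤ} {f g θ : ℂ → ℂ}

theorem eq_zero_iff_add_one (hf : QuasiPeriodic τ d a b f) (ha : a ≠ 0) (z : ℂ) :
    f z = 0 ↔ f (z + 1) = 0 := by
  rw [hf.add_one]; simp [ha]

theorem eq_zero_iff_add_tau (hf : QuasiPeriodic τ d a b f) (hb : b ≠ 0) (z : ℂ) :
    f z = 0 ↔ f (z + τ) = 0 := by
  rw [hf.add_tau]; simp [hb, em_ne_zero]

theorem eq_zero_lattice (hf : QuasiPeriodic τ d a b f) (ha : a ≠ 0) (hb : b ≠ 0) {w : ℂ}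
    (hw : f w = 0) (m n : ℤ) : f (w + m + n * τ) = 0 :=
  lattice_induction (P := fun z => f z = 0) (hf.eq_zero_iff_add_one ha)
    (hf.eq_zero_iff_add_tau hb) hw m n

theorem deriv_add_one (hf : QuasiPeriodic τ d a b f) (z : ℂ) :
    deriv f (z + 1) = a * deriv f z := by
  rw [← deriv_comp_add_const, ← deriv_const_mul _ (hf.differentiable z)]
  congr 1
  ext y
  exact hf.add_one y

theorem deriv_add_tau (hf : QuasiPeriodic τ d a b f) {z : ℂ} (hz : f z = 0) :
    deriv f (z + τ) = b * em (-(2 * d * z)) * deriv f z := by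
  have h1 : (fun y => f (y + τ)) = fun y => (b * em (-(2 * d * y))) * f y := by
    ext y
    exact hf.add_tau y
  rw [← deriv_comp_add_const, h1]
  have hd : DifferentiableAt ℂ (fun y => b * em (-(2 * d * y))) z :=
    (differentiable_em.comp (differentiable_id.const_mul (2 * (d : ℂ))).neg).const_mul b z
  rw [deriv_fun_mul hd (hf.differentiable z), hz]
  ring

theorem comp_sub (hf : QuasiPeriodic τ d a b f) (w : ℂ) :
    QuasiPeriodic τ d a (b * em (2 * d * w)) (fun z => f (z - w)) where
  differentiable := hf.differentiable.comp (differentiable_id.sub_const w)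
  add_one z := by
    rw [← hf.add_one]; congr 1; ring
  add_tau z := by
    rw [mul_assoc b, ← em_add, show z + τ - w = z - w + τ by ring, hf.add_tau]
    congr 3; ring

theorem sub (hf : QuasiPeriodic τ d a b f) (hg : QuasiPeriodic τ d a b g) :
    QuasiPeriodic τ d a b (fun z => f z - g z) where
  differentiable := hf.differentiable.sub hg.differentiable
  add_one z := by rw [hf.add_one, hg.add_one]; ring
  add_tau z := by rw [hf.add_tau, hg.add_tau]; ring

theorem const_mul (hf : QuasiPeriodic τ d a b f) (c : ℂ) :
    QuasiPeriodic τ d a b (fun z => c * f z) where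
  differentiable := hf.differentiable.const_mul c
  add_one z := by rw [hf.add_one]; ring
  add_tau z := by rw [hf.add_tau]; ring

theorem mul (hf : QuasiPeriodic τ d a b f) (hg : QuasiPeriodic τ d' a' b' g) :
    QuasiPeriodic τ (d + d') (a * a') (b * b') (fun z => f z * g z) where
  differentiable := hf.differentiable.mul hg.differentiable
  add_one z := by rw [hf.add_one, hg.add_one]; ring
  add_tau z := by
    rw [hf.add_tau, hg.add_tau]
    have : em (-(2 * ((d + d' : ℤ) : ℂ) * z)) = em (-(2 * d * z)) * em (-(2 * d' * z)) := by
      rw [← em_add]; congr 1; push_cast; ring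
    rw [this]; ring

/-- A quasi-periodic function of degree `0` which is not zero is an exponential, whose exponent is
constrained by the multipliers. -/
theorem exists_em (hf : QuasiPeriodic τ 0 a b f) (hτ : 0 < τ.im) (ha : a ≠ 0) (hb : b ≠ 0)
    {w : ℂ} (hw : f w ≠ 0) :
    ∃ C k : ℂ, (∀ z, f z = C * em (k * z)) ∧ em k = a ∧ em (k * τ) = b := by
  have h2 : ∀ z, f (z + τ) = b * f z := fun z => by simpa using hf.add_tau z
  obtain ⟨C, k, hC⟩ := exists_eq_const_mul_em hτ ha hb hf.differentiable hf.add_one h2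
  refine ⟨C, k, hC, ?_, ?_⟩
  · have := hf.add_one w
    have e : f (w + 1) = em k * f w := by
      rw [hC, hC w, mul_add, em_add, mul_one]; ring
    exact mul_right_cancel₀ hw (e.symm.trans this)
  · have := h2 w
    have e : f (w + τ) = em (k * τ) * f w := by
      rw [hC, hC w, mul_add, em_add]; ring
    exact mul_right_cancel₀ hw (e.symm.trans this)

end QuasiPeriodic

namespace IsOddTheta

variable {τ a b : ℂ} {d : ℤ} {f θ : ℂ → ℂ}

theorem apply_zero (hθ : IsOddTheta τ θ) : θ 0 = 0 := (hθ.zero_iff 0).2 ⟨0, 0, by simp⟩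

theorem deriv_ne_zero (hθ : IsOddTheta τ θ) {z : ℂ} (hz : θ z = 0) : deriv θ z ≠ 0 := by
  obtain ⟨m, n, rfl⟩ := (hθ.zero_iff z).1 hz
  have h1 : (-1 : ℂ) ≠ 0 := by simp
  have h2 : -em (-τ) ≠ 0 := by simp [em_ne_zero]
  have := lattice_induction (τ := τ) (P := fun z => θ z = 0 ∧ deriv θ z ≠ 0) (w := 0)
    (fun z => by
      rw [hθ.deriv_add_one, ← hθ.eq_zero_iff_add_one h1]; simp)
    (fun z => by
      rw [← hθ.eq_zero_iff_add_tau h2]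
      refine and_congr_right fun h => ?_
      rw [hθ.deriv_add_tau h]
      simp [em_ne_zero]) ⟨hθ.apply_zero, hθ.deriv_ne⟩ m n
  simpa using this.2

/-- A quasi-periodic function vanishing at `w` is divisible by `θ (z - w)`. -/
theorem exists_div (hθ : IsOddTheta τ θ) (hf : QuasiPeriodic τ d a b f) (ha : a ≠ 0) (hb : b ≠ 0)
    {w : ℂ} (hw : f w = 0) :
    ∃ g, QuasiPeriodic τ (d - 1) (-a) (-(b * em (τ - 2 * w))) g ∧
      ∀ z, f z = g z * θ (z - w) := by
  have hs := hθ.toQuasiPeriodic.comp_sub w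
  obtain ⟨g, hg, hfg⟩ := exists_differentiable_mul hf.differentiable hs.differentiable
    (fun z hz => by
      refine ⟨?_, ?_⟩
      · obtain ⟨m, n, h⟩ := (hθ.zero_iff _).1 hz
        have := hf.eq_zero_lattice ha hb hw m n
        rwa [show w + m + n * τ = z by linear_combination -h] at this
      · rw [deriv_comp_sub_const]
        exact hθ.deriv_ne_zero hz)
  -- the multipliers of the quotient are computed off the zeros of the divisor
  have hdense : Dense {z | θ (z - w) ≠ 0} := by
    have hθd := hs.differentiable
    intro z
    by_cases h0 : θ (z - w) = 0
    · have := ((hθd z).hasDerivAt.eventually_ne (c := 0) (by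
        rw [deriv_comp_sub_const]; exact hθ.deriv_ne_zero h0))
      exact mem_closure_iff_frequently.2 (this.frequently.filter_mono nhdsWithin_le_nhds)
    · exact subset_closure h0
  refine ⟨g, ⟨hg, ?_, ?_⟩, hfg⟩
  · have : (fun z => g (z + 1)) = fun z => -a * g z := by
      refine Continuous.ext_on hdense (hg.continuous.comp (by fun_prop))
        (hg.continuous.const_mul _) fun z hz => ?_
      have h1 := hfg (z + 1)
      rw [hf.add_one, hs.add_one, hfg z] at h1
      refine mul_right_cancel₀ (b := θ (z - w)) hz ?_
      linear_combination h1
    exact fun z => congrFun this z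
  · have : (fun z => g (z + τ)) = fun z => -(b * em (τ - 2 * w)) * em (-(2 * (d - 1 : ℤ) * z)) * g z := by
      refine Continuous.ext_on hdense (hg.continuous.comp (by fun_prop)) ?_ fun z hz => ?_
      · exact (continuous_const.mul (differentiable_em.continuous.comp (by fun_prop))).mul
          hg.continuous
      have h1 := hfg (z + τ)
      rw [hf.add_tau, hs.add_tau, hfg z] at h1
      have e1 : em (-(2 * d * z)) = em (-(2 * (d - 1 : ℤ) * z)) * em (-(2 * z)) := by
        rw [← em_add]; congr 1; push_cast; ring
      have e2 : em (-(2 * (1 : ℤ) * z)) = em (-(2 * z)) := by simp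
      have e3 : em (τ - 2 * w) * (em (-τ) * em (2 * (1 : ℤ) * w)) = 1 := by
        rw [← em_add, ← em_add, ← em_zero]; congr 1; push_cast; ring
      rw [e1, e2] at h1
      refine mul_right_cancel₀ (b := -em (-τ) * em (2 * (1 : ℤ) * w) * em (-(2 * z)) * θ (z - w))
        (by simpa [em_ne_zero] using hz) ?_
      linear_combination -h1 -  b * em (-(2 * (d - 1 : ℤ) * z)) * em (-(2 * z)) * g z * θ (z - w) * e3
    exact fun z => congrFun this z

end IsOddTheta

theorem eq_zero_of_norm_em_eq_one {τ k : ℂ} (hτ : 0 < τ.im) (h1 : ‖em k‖ = 1)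
    (h2 : ‖em (k * τ)‖ = 1) : k = 0 := by
  rw [norm_em, Real.exp_eq_one_iff, neg_eq_zero, mul_eq_zero] at h1 h2
  have i1 : k.im = 0 := h1.resolve_left Real.pi_ne_zero
  have i2 : (k * τ).im = 0 := h2.resolve_left Real.pi_ne_zero
  rw [Complex.mul_im, i1, zero_mul, add_zero, mul_eq_zero] at i2
  exact Complex.ext (i2.resolve_right hτ.ne') i1

/-- A degree `0` function with unitary multipliers, not both trivial, vanishes. -/
theorem QuasiPeriodic.eq_zero_of_norm {τ a b : ℂ} {g : ℂ → ℂ} (hg : QuasiPeriodic τ 0 a b g)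
    (hτ : 0 < τ.im) (ha : ‖a‖ = 1) (hb : ‖b‖ = 1) (hab : a ≠ 1 ∨ b ≠ 1) (z : ℂ) : g z = 0 := by
  by_contra h
  obtain ⟨C, k, -, h1, h2⟩ := hg.exists_em hτ (norm_ne_zero_iff.1 (by simp [ha]))
    (norm_ne_zero_iff.1 (by simp [hb])) h
  have hk := eq_zero_of_norm_em_eq_one hτ (h1 ▸ ha) (h2 ▸ hb)
  subst hk
  simp at h1 h2
  rcases hab with h | h
  · exact h h1.symm
  · exact h h2.symm

/-- A degree `0` function with trivial multipliers is constant. -/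
theorem QuasiPeriodic.eq_const {τ : ℂ} {g : ℂ → ℂ} (hg : QuasiPeriodic τ 0 1 1 g)
    (hτ : 0 < τ.im) (z w : ℂ) : g z = g w := by
  have h1 : ∀ z, g z - g w = 0 := by
    intro z
    by_contra h
    have hs : QuasiPeriodic τ 0 1 1 (fun z => g z - g w) :=
      ⟨hg.differentiable.sub_const _, fun z => by rw [hg.add_one]; ring,
        fun z => by rw [hg.add_tau]; simp⟩
    obtain ⟨C, k, hC, h1, h2⟩ := hs.exists_em hτ one_ne_zero one_ne_zero h
    have hk := eq_zero_of_norm_em_eq_one hτ (by rw [h1]; simp) (by rw [h2]; simp)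
    subst hk
    have e1 := hC z
    have e2 := hC w
    simp only [zero_mul, em_zero, mul_one, sub_self] at e1 e2
    exact h (e1.trans e2.symm)
  linear_combination h1 z

namespace IsOddTheta

variable {τ : ℂ} {θ f : ℂ → ℂ}

theorem half_ne_zero (hθ : IsOddTheta τ θ) (hτ : 0 < τ.im) : θ (1 / 2) ≠ 0 := by
  intro h
  obtain ⟨m, n, h⟩ := (hθ.zero_iff _).1 h
  have hn : n = 0 := by
    have := congrArg Complex.im h
    simpa [hτ.ne'] using this
  subst hn
  have h2 : (1 : ℂ) = ((2 * m : ℤ) : ℂ) := by push_cast; linear_combination 2 * h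
  have h3 : (1 : ℤ) = 2 * m := by exact_mod_cast h2
  omega

/-- Theta functions of degree one are determined, up to a constant, by their multipliers. -/
theorem eq_const_mul (hθ : IsOddTheta τ θ) (hτ : 0 < τ.im)
    (hf : QuasiPeriodic τ 1 (-1) (-em (-τ)) f) : ∃ C : ℂ, ∀ z, f z = C * θ z := by
  have h2 := hθ.half_ne_zero hτ
  refine ⟨f (1 / 2) / θ (1 / 2), fun z => ?_⟩
  have hF := hf.sub (hθ.toQuasiPeriodic.const_mul (f (1 / 2) / θ (1 / 2)))
  obtain ⟨g, hg, hfg⟩ := hθ.exists_div hF (by simp) (by simp [em_ne_zero]) (w := 1 / 2)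
    (by rw [div_mul_cancel₀ _ h2, sub_self])
  have hb : -(-em (-τ) * em (τ - 2 * (1 / 2))) = -1 := by
    rw [neg_mul, neg_neg, ← em_add, show -τ + (τ - 2 * (1 / 2)) = -1 by ring, em_neg, em_one]
    norm_num
  rw [hb] at hg
  have := hg.eq_zero_of_norm hτ (by simp) (by simp) (Or.inr (by norm_num)) z
  have h3 := hfg z
  simp only [this, zero_mul] at h3
  linear_combination h3

end IsOddTheta

/-! ### Infinite products -/

section Products

variable {x y a b p : ℂ}

theorem summable_poch (ha : ‖a‖ < 1) (x : ℂ) : Summable fun n : ℕ => ‖-(x * a ^ n)‖ := by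
  simpa using (summable_geometric_of_lt_one (norm_nonneg _) ha).mul_left ‖x‖

theorem multipliable_poch (ha : ‖a‖ < 1) (x : ℂ) : Multipliable fun n : ℕ => 1 - x * a ^ n := by
  simpa [sub_eq_add_neg] using multipliable_one_add_of_summable (summable_poch ha x)

theorem poch_eq (ha : ‖a‖ < 1) (x : ℂ) : poch x a = (1 - x) * poch (x * a) a := by
  have h : ∀ n : ℕ, 1 - x * a ^ (n + 1) = 1 - x * a * a ^ n := fun n => by ring
  rw [poch, tprod_eq_zero_mul' (by simpa only [h] using multipliable_poch ha (x * a))]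
  simp only [pow_zero, mul_one, h, poch]

theorem poch_ne_zero (ha : ‖a‖ < 1) (h : ∀ n : ℕ, x * a ^ n ≠ 1) : poch x a ≠ 0 := by
  rw [poch]
  simp only [sub_eq_add_neg]
  refine tprod_one_add_ne_zero_of_summable (fun n h0 => h n ?_) (summable_poch ha x)
  linear_combination -h0

theorem poch_eq_zero (ha : ‖a‖ < 1) {n : ℕ} (h : x * a ^ n = 1) : poch x a = 0 := by
  induction n generalizing x with
  | zero => rw [poch_eq ha, show x = 1 by simpa using h]; simp
  | succ n ih => rw [poch_eq ha, ih (by rw [← h]; ring), mul_zero]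

theorem differentiable_poch (ha : ‖a‖ < 1) : Differentiable ℂ fun x => poch x a := by
  intro x
  have hs : Summable fun n : ℕ => (‖x‖ + 1) * ‖a‖ ^ n :=
    (summable_geometric_of_lt_one (norm_nonneg _) ha).mul_left _
  have h := Summable.hasProdLocallyUniformlyOn_nat_one_add (f := fun (n : ℕ) (x : ℂ) => -(x * a ^ n))
    (K := Metric.ball 0 (‖x‖ + 1)) Metric.isOpen_ball hs
    (Filter.Eventually.of_forall fun n y hy => by
      rw [norm_neg, norm_mul, norm_pow]
      have : ‖y‖ ≤ ‖x‖ + 1 := by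
        rw [Metric.mem_ball, dist_zero_right] at hy
        exact hy.le
      gcongr) (fun n => by fun_prop)
  have hd := h.differentiableOn
    (.of_forall fun _ => by
      simpa [Finset.prod_fn] using DifferentiableOn.finsetProd (fun _ _ => by fun_prop))
    Metric.isOpen_ball
  simp only [← sub_eq_add_neg] at hd
  exact hd.differentiableAt (Metric.isOpen_ball.mem_nhds (by simp))

theorem summable_poch₂ (ha : ‖a‖ < 1) (hb : ‖b‖ < 1) (x : ℂ) :
    Summable fun n : ℕ × ℕ => ‖-(x * a ^ n.1 * b ^ n.2)‖ := by
  have h := (summable_geometric_of_lt_one (norm_nonneg _) ha).mul_of_nonneg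
    (summable_geometric_of_lt_one (norm_nonneg _) hb) (fun _ => by positivity)
    (fun _ => by positivity)
  simpa [mul_assoc] using h.mul_left ‖x‖

theorem multipliable_poch₂ (ha : ‖a‖ < 1) (hb : ‖b‖ < 1) (x : ℂ) :
    Multipliable fun n : ℕ × ℕ => 1 - x * a ^ n.1 * b ^ n.2 := by
  simpa [sub_eq_add_neg] using multipliable_one_add_of_summable (summable_poch₂ ha hb x)

theorem poch₂_ne_zero (ha : ‖a‖ < 1) (hb : ‖b‖ < 1) (h : ∀ m n : ℕ, x * a ^ m * b ^ n ≠ 1) :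
    poch₂ x a b ≠ 0 := by
  rw [poch₂]
  simp only [sub_eq_add_neg]
  refine tprod_one_add_ne_zero_of_summable (fun n h0 => h n.1 n.2 ?_) (summable_poch₂ ha hb x)
  linear_combination -h0

theorem poch₂_comm (x a b : ℂ) : poch₂ x a b = poch₂ x b a := by
  rw [poch₂, poch₂, ← (Equiv.prodComm ℕ ℕ).tprod_eq]
  exact tprod_congr fun n => by simp [mul_right_comm]

/-- `ℕ × ℕ` as the disjoint union of `ℕ × {0}` and `ℕ × (ℕ + 1)`. -/
def sumProdNatEquiv : ℕ ⊕ ℕ × ℕ ≃ ℕ × ℕ where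
  toFun := Sum.elim (fun n => (n, 0)) (fun n => (n.1, n.2 + 1))
  invFun n := match n with
    | (n, 0) => Sum.inl n
    | (n, m + 1) => Sum.inr (n, m)
  left_inv := by rintro (n | ⟨n, m⟩) <;> rfl
  right_inv := by rintro ⟨n, _ | m⟩ <;> rfl

theorem poch₂_eq_right (ha : ‖a‖ < 1) (hb : ‖b‖ < 1) (x : ℂ) :
    poch₂ x a b = poch x a * poch₂ (x * b) a b := by
  have h2 : ∀ n : ℕ × ℕ, 1 - x * a ^ n.1 * b ^ (n.2 + 1) = 1 - x * b * a ^ n.1 * b ^ n.2 :=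
    fun n => by ring
  rw [poch₂, ← sumProdNatEquiv.tprod_eq, Multipliable.tprod_sum]
  · simp only [sumProdNatEquiv, Equiv.coe_fn_mk, Sum.elim_inl, Sum.elim_inr, pow_zero, mul_one, h2,
      poch, poch₂]
  · simpa [sumProdNatEquiv, Function.comp_def] using multipliable_poch ha x
  · simpa [sumProdNatEquiv, Function.comp_def, h2] using multipliable_poch₂ ha hb (x * b)

theorem poch₂_eq_left (ha : ‖a‖ < 1) (hb : ‖b‖ < 1) (x : ℂ) :
    poch₂ x a b = poch x b * poch₂ (x * a) a b := by
  rw [poch₂_comm, poch₂_eq_right hb ha, poch₂_comm]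

end Products

/-! ### The odd Jacobi theta function -/

theorem norm_em_lt_one {τ : ℂ} (hτ : 0 < τ.im) : ‖em τ‖ < 1 := by
  rw [norm_em, Real.exp_lt_one_iff]
  have := mul_pos Real.pi_pos hτ
  linarith

theorem norm_em_two_lt_one {τ : ℂ} (hτ : 0 < τ.im) : ‖em (2 * τ)‖ < 1 :=
  norm_em_lt_one (by simpa using hτ)

/-- The product side of the Jacobi triple product identity, up to a constant. -/
def thetaProd (τ z : ℂ) : ℂ :=
  em (-z) * (poch (em (2 * z)) (em (2 * τ)) * poch (em (2 * τ) * em (-(2 * z))) (em (2 * τ)))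

theorem em_two_mul_add_int (z : ℂ) (n : ℤ) : em (2 * (z + n)) = em (2 * z) := by
  rw [mul_add, em_add, em_two_mul_int, mul_one]

/-- The zeros of the product are read off from its factors; they are the zeros of the odd theta
function once the two are known to be proportional. -/
theorem isOddTheta_thetaProd {τ : ℂ} (hτ : 0 < τ.im) : IsOddTheta τ (thetaProd τ) := by
  have hp := norm_em_two_lt_one hτ
  have dp := differentiable_poch hp
  have e1 : Differentiable ℂ fun z => em (2 * z) :=
    differentiable_em.comp (differentiable_id.const_mul _)
  have e2 : Differentiable ℂ fun z => em (-(2 * z)) :=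
    differentiable_em.comp (differentiable_id.const_mul _).neg
  have e3 : Differentiable ℂ fun z => em (-z) := differentiable_em.comp differentiable_id.neg
  refine { differentiable := ?_, add_one := ?_, add_tau := ?_, zero_iff := ?_, deriv_ne := ?_ }
  · exact e3.mul ((dp.comp e1).mul (dp.comp (e2.const_mul _)))
  · intro z
    have h1 : em (2 * (z + 1)) = em (2 * z) := by simpa using em_two_mul_add_int z 1
    have h2 : em (-(z + 1)) = -em (-z) := by
      rw [neg_add, em_add, em_neg 1, em_one]; norm_num
    rw [thetaProd, thetaProd, em_neg (2 * (z + 1)), em_neg (2 * z), h1, h2]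
    ring
  · intro z
    set y := em (2 * z) with hy
    set p := em (2 * τ) with hpd
    have hy0 : y ≠ 0 := em_ne_zero _
    have hp0 : p ≠ 0 := em_ne_zero _
    have h1 : em (2 * (z + τ)) = y * p := by rw [mul_add, em_add]
    have h2 : em (-(2 * (z + τ))) = y⁻¹ * p⁻¹ := by rw [em_neg, h1, mul_inv]
    have h3 : em (-(z + τ)) = em (-τ) * em (-z) := by rw [← em_add]; congr 1; ring
    have h4 : em (-(2 * z)) = y⁻¹ := em_neg _
    have h5 : em (-(2 * ((1 : ℤ) : ℂ) * z)) = y⁻¹ := by rw [← h4]; simp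
    rw [thetaProd, thetaProd, h1, h2, h3, h4, h5, ← hpd, ← hy, poch_eq hp y,
      show p * (y⁻¹ * p⁻¹) = y⁻¹ by field_simp, poch_eq hp y⁻¹, mul_comm p y⁻¹]
    field_simp
    ring
  · intro z
    have h0 : em (-z) ≠ 0 := em_ne_zero _
    constructor
    · intro h
      rw [thetaProd, mul_eq_zero, mul_eq_zero] at h
      rcases h with h | h | h
      · exact absurd h h0
      · have : ∃ n : ℕ, em (2 * z) * em (2 * τ) ^ n = 1 := by
          by_contra! hne
          exact poch_ne_zero hp hne h
        obtain ⟨n, hn⟩ := this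
        rw [em_pow, ← em_add, em_eq_one_iff] at hn
        obtain ⟨m, hm⟩ := hn
        exact ⟨m, -n, by push_cast; linear_combination hm / 2⟩
      · have : ∃ n : ℕ, em (2 * τ) * em (-(2 * z)) * em (2 * τ) ^ n = 1 := by
          by_contra! hne
          exact poch_ne_zero hp hne h
        obtain ⟨n, hn⟩ := this
        rw [em_pow, ← em_add, ← em_add, em_eq_one_iff] at hn
        obtain ⟨m, hm⟩ := hn
        exact ⟨-m, n + 1, by push_cast; linear_combination -hm / 2⟩
    · rintro ⟨m, n, rfl⟩
      rw [thetaProd, mul_eq_zero, mul_eq_zero]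
      right
      rcases le_or_gt n 0 with hn | hn
      · left
        obtain ⟨k, hk⟩ := Int.eq_ofNat_of_zero_le (neg_nonneg.2 hn)
        obtain rfl : n = -(k : ℤ) := by omega
        refine poch_eq_zero hp (n := k) ?_
        rw [em_pow, ← em_add, em_eq_one_iff]
        exact ⟨m, by push_cast; ring⟩
      · right
        obtain ⟨k, hk⟩ := Int.eq_ofNat_of_zero_le (show 0 ≤ n - 1 by omega)
        obtain rfl : n = (k : ℤ) + 1 := by omega
        refine poch_eq_zero hp (n := k) ?_
        rw [em_pow, ← em_add, ← em_add, em_eq_one_iff]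
        exact ⟨-m, by push_cast; ring⟩
  · have hform : thetaProd τ = fun z => (1 - em (2 * z)) * (em (-z) * (poch (em (2 * z) * em (2 * τ))
        (em (2 * τ)) * poch (em (2 * τ) * em (-(2 * z))) (em (2 * τ)))) := by
      ext z
      rw [thetaProd, poch_eq hp (em (2 * z))]
      ring
    have hR : DifferentiableAt ℂ (fun z => em (-z) * (poch (em (2 * z) * em (2 * τ))
        (em (2 * τ)) * poch (em (2 * τ) * em (-(2 * z))) (em (2 * τ)))) 0 :=
      (e3.mul ((dp.comp (e1.mul_const _)).mul (dp.comp (e2.const_mul _)))) 0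
    have h1 : HasDerivAt (fun z => 1 - em (2 * z)) (-(Complex.I * Real.pi * 2)) 0 := by
      have := ((hasDerivAt_em (2 * 0)).comp (0 : ℂ) ((hasDerivAt_id (0 : ℂ)).const_mul 2)).const_sub 1
      simpa [Function.comp_def] using this
    have hpne : poch (em (2 * τ)) (em (2 * τ)) ≠ 0 := by
      refine poch_ne_zero hp fun n hn => ?_
      have := congrArg norm hn
      rw [← pow_succ', norm_pow, norm_one] at this
      exact (pow_lt_one₀ (norm_nonneg _) hp (Nat.succ_ne_zero n)).ne this
    rw [hform, (h1.fun_mul hR.hasDerivAt).deriv]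
    simp [hpne]

theorem theta_eq_jacobiTheta₂ (γ₁ γ₂ ξ τ : ℂ) : theta γ₁ γ₂ ξ τ =
    em (γ₁ ^ 2 * τ + 2 * γ₁ * (ξ + γ₂)) * jacobiTheta₂ (ξ + γ₂ + γ₁ * τ) τ := by
  rw [theta, jacobiTheta₂, ← tsum_mul_left]
  refine tsum_congr fun m => ?_
  rw [jacobiTheta₂_term, em, ← Complex.exp_add]
  congr 1
  ring

/-- The zeroth Fourier coefficient of `jacobiTheta₂ · τ` is `1`. -/
theorem exists_jacobiTheta₂_ne_zero {τ : ℂ} (hτ : 0 < τ.im) : ∃ z, jacobiTheta₂ z τ ≠ 0 := by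
  by_contra! h0
  let f : ℤ → C(ℝ, ℂ) := fun n => ⟨fun x => jacobiTheta₂_term n x τ, by
    unfold jacobiTheta₂_term; fun_prop⟩
  have hs : Summable fun n : ℤ =>
      ‖(f n).restrict (⟨Set.uIcc 0 1, isCompact_uIcc⟩ : TopologicalSpace.Compacts ℝ)‖ := by
    have hsum : Summable fun n : ℤ => ‖jacobiTheta₂_term n 0 τ‖ :=
      ((summable_jacobiTheta₂_term_iff 0 τ).2 hτ).norm
    refine Summable.of_nonneg_of_le (fun _ => norm_nonneg _) (fun n => ?_) hsum
    refine (ContinuousMap.norm_le _ (norm_nonneg _)).2 fun x => ?_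
    show ‖jacobiTheta₂_term n (x : ℝ) τ‖ ≤ _
    rw [norm_jacobiTheta₂_term, norm_jacobiTheta₂_term]
    simp
  have key := intervalIntegral.hasSum_intervalIntegral_of_summable_norm hs
  have hz : ∀ x : ℝ, ∑' n : ℤ, f n x = 0 := fun x => h0 x
  simp only [hz, intervalIntegral.integral_zero] at key
  have hn : ∀ n : ℤ, n ≠ 0 → ∫ x in (0 : ℝ)..1, f n x = 0 := by
    intro n hn
    have e : ∀ x : ℝ, f n x = Complex.exp (Real.pi * Complex.I * n ^ 2 * τ) *
        Complex.exp ((2 * Real.pi * Complex.I * n) * x) := by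
      intro x
      show jacobiTheta₂_term n x τ = _
      rw [jacobiTheta₂_term, ← Complex.exp_add]
      congr 1; ring
    simp only [e]
    have hc : (2 * Real.pi * Complex.I * n : ℂ) ≠ 0 := by
      simp [Real.pi_ne_zero, hn]
    rw [intervalIntegral.integral_const_mul, integral_exp_mul_complex hc]
    have : Complex.exp (2 * Real.pi * Complex.I * n * (1 : ℝ)) = 1 :=
      Complex.exp_eq_one_iff.2 ⟨n, by push_cast; ring⟩
    rw [this]
    simp
  have h1 := key.unique (hasSum_single (0 : ℤ) hn)
  have : ∫ x in (0 : ℝ)..1, f 0 x = 1 := by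
    have e : ∀ x : ℝ, f 0 x = 1 := fun x => by
      show jacobiTheta₂_term 0 x τ = _
      simp [jacobiTheta₂_term]
    simp [e]
  rw [this] at h1
  exact zero_ne_one h1

/-- The Jacobi theta function with characteristics `1/2, 1/2`. -/
def oddTheta (τ z : ℂ) : ℂ := theta (1 / 2) (1 / 2) z τ

theorem quasiPeriodic_oddTheta {τ : ℂ} (hτ : 0 < τ.im) :
    QuasiPeriodic τ 1 (-1) (-em (-τ)) (oddTheta τ) := by
  have hform : oddTheta τ = fun z => em ((1 / 2) ^ 2 * τ + 2 * (1 / 2) * (z + 1 / 2)) *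
      jacobiTheta₂ (z + 1 / 2 + 1 / 2 * τ) τ := by
    ext z
    rw [oddTheta, theta_eq_jacobiTheta₂]
  refine ⟨?_, fun z => ?_, fun z => ?_⟩
  · rw [hform]
    refine Differentiable.mul (differentiable_em.comp (by fun_prop)) fun z => ?_
    exact (differentiableAt_jacobiTheta₂_fst _ hτ).comp z
      (((differentiableAt_id.add_const (1 / 2)).add_const (1 / 2 * τ)))
  · rw [hform]
    simp only
    rw [show z + 1 + 1 / 2 + 1 / 2 * τ = z + 1 / 2 + 1 / 2 * τ + 1 by ring, jacobiTheta₂_add_left,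
      show (1 / 2) ^ 2 * τ + 2 * (1 / 2) * (z + 1 + 1 / 2) =
        (1 / 2) ^ 2 * τ + 2 * (1 / 2) * (z + 1 / 2) + 1 by ring, em_add _ 1, em_one]
    ring
  · rw [hform]
    simp only
    have e : Complex.exp (-Real.pi * Complex.I * (τ + 2 * (z + 1 / 2 + 1 / 2 * τ))) =
        em (-(τ + 2 * (z + 1 / 2 + 1 / 2 * τ))) := by
      rw [em]; congr 1; ring
    rw [show z + τ + 1 / 2 + 1 / 2 * τ = z + 1 / 2 + 1 / 2 * τ + τ by ring, jacobiTheta₂_add_left',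
      e, ← mul_assoc, ← em_add, ← neg_one_mul (em (-τ)), ← mul_assoc]
    congr 1
    rw [← em_one, ← em_add, ← em_add, ← em_add, ← sub_eq_zero]
    rw [show 1 + -τ + -(2 * ((1 : ℤ) : ℂ) * z) + ((1 / 2) ^ 2 * τ + 2 * (1 / 2) * (z + 1 / 2)) =
      (1 / 2) ^ 2 * τ + 2 * (1 / 2) * (z + τ + 1 / 2) +
        -(τ + 2 * (z + 1 / 2 + 1 / 2 * τ)) + 2 * ((1 : ℤ) : ℂ) by push_cast; ring,
      em_add _ (2 * ((1 : ℤ) : ℂ)), em_two_mul_int, mul_one, sub_self]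

/-- The Jacobi triple product identity, up to the value of the constant. -/
theorem exists_oddTheta_eq_thetaProd {τ : ℂ} (hτ : 0 < τ.im) :
    ∃ C : ℂ, C ≠ 0 ∧ ∀ z, oddTheta τ z = C * thetaProd τ z := by
  obtain ⟨C, hC⟩ := (isOddTheta_thetaProd hτ).eq_const_mul hτ (quasiPeriodic_oddTheta hτ)
  refine ⟨C, ?_, hC⟩
  -- if the constant were zero, the theta series would vanish identically
  rintro rfl
  obtain ⟨w, hw⟩ := exists_jacobiTheta₂_ne_zero hτ
  have := hC (w - 1 / 2 - 1 / 2 * τ)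
  rw [oddTheta, theta_eq_jacobiTheta₂, zero_mul, mul_eq_zero,
    show w - 1 / 2 - 1 / 2 * τ + 1 / 2 + 1 / 2 * τ = w by ring] at this
  exact this.elim (em_ne_zero _) hw

theorem isOddTheta_oddTheta {τ : ℂ} (hτ : 0 < τ.im) : IsOddTheta τ (oddTheta τ) := by
  obtain ⟨C, hC, h⟩ := exists_oddTheta_eq_thetaProd hτ
  have hP := isOddTheta_thetaProd hτ
  refine { quasiPeriodic_oddTheta hτ with zero_iff := fun z => ?_, deriv_ne := ?_ }
  · rw [h, ← hP.zero_iff]; simp [hC]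
  · rw [funext h, deriv_const_mul _ (hP.differentiable 0)]
    exact mul_ne_zero hC hP.deriv_ne

/-- Oddness follows from the multipliers, as theta functions of degree one are unique. -/
theorem IsOddTheta.neg {τ : ℂ} {θ : ℂ → ℂ} (hθ : IsOddTheta τ θ) (hτ : 0 < τ.im) (z : ℂ) :
    θ (-z) = -θ z := by
  have hf : QuasiPeriodic τ 1 (-1) (-em (-τ)) (fun z => θ (-z)) := by
    refine ⟨hθ.differentiable.comp differentiable_neg, fun z => ?_, fun z => ?_⟩
    · have := hθ.add_one (-(z + 1))
      rw [show -(z + 1) + 1 = -z by ring] at this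
      rw [this]; ring
    · have := hθ.add_tau (-(z + τ))
      rw [show -(z + τ) + τ = -z by ring] at this
      rw [this]
      have e : em (-τ) * em (-(2 * (1 : ℤ) * z)) * (em (-τ) * em (-(2 * (1 : ℤ) * -(z + τ)))) = 1 := by
        rw [← em_add, ← em_add, ← em_add, ← em_zero]; congr 1; push_cast; ring
      linear_combination -θ (-(z + τ)) * e
  obtain ⟨C, hC⟩ := hθ.eq_const_mul hτ hf
  have h1 : deriv (fun z => θ (-z)) 0 = -deriv θ 0 := by
    rw [deriv_comp_neg, neg_zero]
  rw [funext hC, deriv_const_mul _ (hθ.differentiable 0)] at h1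
  have : C = -1 := mul_right_cancel₀ hθ.deriv_ne (by rw [h1]; ring)
  rw [hC, this]; ring

/-! ### Sums over `(ℤ / N)²` -/

/-- `f : ℤ × ℤ → M` is periodic of period `N` in both variables. -/
def Periodic₂ {M : Type*} (N : ℕ) (f : ℤ → ℤ → M) : Prop :=
  (∀ a b, f (a + N) b = f a b) ∧ ∀ a b, f a (b + N) = f a b

theorem sum_fin_add {M : Type*} [AddCommGroup M] {N : ℕ} {h : ℤ → M} (hh : ∀ a, h (a + N) = h a)
    (c : ℤ) : ∑ i : Fin N, h (i + c) = ∑ i : Fin N, h i := by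
  have step : ∀ h : ℤ → M, (∀ a, h (a + N) = h a) → ∑ i : Fin N, h (i + 1) = ∑ i : Fin N, h i := by
    intro h hh
    have h1 := Finset.sum_range_succ (fun i : ℕ => h i) N
    rw [Finset.sum_range_succ'] at h1
    have h2 : h N = h 0 := by simpa using hh 0
    rw [h2] at h1
    have h3 := add_right_cancel h1
    rw [Fin.sum_univ_eq_sum_range (fun i : ℕ => h (i + 1)), Fin.sum_univ_eq_sum_range
      (fun i : ℕ => h i), ← h3]
    push_cast
    rfl
  induction c using Int.induction_on with
  | zero => simp
  | succ i ih =>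
    rw [← ih, ← step (fun a => h (a + i)) fun a => by rw [add_right_comm, hh]]
    exact Finset.sum_congr rfl fun j _ => by congr 1; ring
  | pred i ih =>
    rw [← ih, ← step (fun a => h (a + (-i - 1))) fun a => by rw [add_right_comm, hh]]
    exact Finset.sum_congr rfl fun j _ => by congr 1; ring

theorem Periodic₂.sum_add {M : Type*} [AddCommGroup M] {N : ℕ} {f : ℤ → ℤ → M}
    (hf : Periodic₂ N f) (c d : ℤ) :
    ∑ β : Fin N × Fin N, f (β.1 + c) (β.2 + d) = ∑ β : Fin N × Fin N, f β.1 β.2 := by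
  rw [Fintype.sum_prod_type, Fintype.sum_prod_type]
  rw [sum_fin_add (h := fun a => ∑ y : Fin N, f a (y + d))
    fun a => Finset.sum_congr rfl fun y _ => hf.1 _ _]
  exact Finset.sum_congr rfl fun x _ => sum_fin_add (hf.2 _) d

theorem em_div_eq_one_iff {N : ℕ} (hN : N ≠ 0) (m : ℤ) :
    em (2 * m / N) = 1 ↔ (N : ℤ) ∣ m := by
  have hN' : (N : ℂ) ≠ 0 := by exact_mod_cast hN
  rw [em_eq_one_iff]
  constructor
  · rintro ⟨n, h⟩
    refine ⟨n, ?_⟩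
    field_simp at h
    exact_mod_cast h
  · rintro ⟨n, rfl⟩
    refine ⟨n, ?_⟩
    push_cast
    field_simp

theorem norm_em_div (N : ℕ) (m : ℤ) : ‖em (2 * m / N)‖ = 1 := by
  have : (2 * m / N : ℂ) = ((2 * m / N : ℝ) : ℂ) := by push_cast; rfl
  rw [norm_em, this, Complex.ofReal_im]
  simp

/-- A nontrivial character of `(ℤ / N)²` sums to zero. -/
theorem sum_character_eq_zero {N : ℕ} (hN : N ≠ 0) {c d : ℤ}
    (h : ¬ ((N : ℤ) ∣ c ∧ (N : ℤ) ∣ d)) :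
    ∑ β : Fin N × Fin N, em (2 * (((β.1 : ℤ) * d - c * (β.2 : ℤ) : ℤ) : ℂ) / N) = 0 := by
  have hN' : (N : ℂ) ≠ 0 := by exact_mod_cast hN
  set f : ℤ → ℤ → ℂ := fun a b => em (2 * ((a * d - c * b : ℤ) : ℂ) / N) with hf
  have hadd : ∀ a b k l, f (a + k) (b + l) = em (2 * ((k * d - c * l : ℤ) : ℂ) / N) * f a b := by
    intro a b k l
    simp only [hf]
    rw [← em_add]; congr 1; push_cast; ring
  have hper : Periodic₂ N f := by
    constructor
    · intro a b
      have := hadd a b N 0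
      rw [add_zero, (em_div_eq_one_iff hN _).2 ⟨d, by ring⟩, one_mul] at this
      exact this
    · intro a b
      have := hadd a b 0 N
      rw [add_zero, (em_div_eq_one_iff hN _).2 ⟨-c, by ring⟩, one_mul] at this
      exact this
  have key : ∀ k l : ℤ, ¬ (N : ℤ) ∣ k * d - c * l → ∑ β : Fin N × Fin N, f β.1 β.2 = 0 := by
    intro k l hkl
    have h1 := hper.sum_add k l
    simp only [hadd, ← Finset.mul_sum] at h1
    have h2 : (em (2 * ((k * d - c * l : ℤ) : ℂ) / N) - 1) * ∑ β : Fin N × Fin N, f β.1 β.2 = 0 := by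
      linear_combination h1
    exact (mul_eq_zero.1 h2).resolve_left
      (sub_ne_zero.2 fun h => hkl ((em_div_eq_one_iff hN _).1 h))
  by_cases hd : (N : ℤ) ∣ d
  · refine key 0 1 fun h' => h ⟨?_, hd⟩
    simpa using h'
  · exact key 1 0 (by simpa using hd)

/-! ### Operations on theta functions -/

namespace QuasiPeriodic

variable {τ a b : ℂ} {d : ℤ} {f : ℂ → ℂ}

theorem comp_neg (hf : QuasiPeriodic τ d a b f) (ha : a ≠ 0) (hb : b ≠ 0) :
    QuasiPeriodic τ d a⁻¹ (b⁻¹ * em (-(2 * d * τ))) (fun z => f (-z)) where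
  differentiable := hf.differentiable.comp differentiable_neg
  add_one z := by
    have := hf.add_one (-(z + 1))
    rw [show -(z + 1) + 1 = -z by ring] at this
    rw [this]; field_simp
  add_tau z := by
    have := hf.add_tau (-(z + τ))
    rw [show -(z + τ) + τ = -z by ring] at this
    rw [this]
    have e : em (-(2 * d * τ)) * em (-(2 * d * z)) * em (-(2 * d * -(z + τ))) = 1 := by
      rw [← em_add, ← em_add, ← em_zero]; congr 1; ring
    rw [inv_mul_eq_div, div_mul_eq_mul_div, div_mul_eq_mul_div, eq_div_iff hb]
    linear_combination -b * f (-(z + τ)) * e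

theorem finsetSum {ι : Type*} {s : Finset ι} {f : ι → ℂ → ℂ}
    (hf : ∀ i ∈ s, QuasiPeriodic τ d a b (f i)) :
    QuasiPeriodic τ d a b (fun z => ∑ i ∈ s, f i z) where
  differentiable := Differentiable.fun_sum fun i hi => (hf i hi).differentiable
  add_one z := by
    rw [Finset.mul_sum]
    exact Finset.sum_congr rfl fun i hi => (hf i hi).add_one z
  add_tau z := by
    rw [Finset.mul_sum]
    exact Finset.sum_congr rfl fun i hi => (hf i hi).add_tau z

end QuasiPeriodic

namespace IsOddTheta

variable {τ a b : ℂ} {θ f : ℂ → ℂ}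

theorem dense_ne_zero (hθ : IsOddTheta τ θ) {k : ℂ} (hk : k ≠ 0) : Dense {z | θ (k * z) ≠ 0} := by
  intro z
  by_cases h0 : θ (k * z) = 0
  · have hd : HasDerivAt (fun z => θ (k * z)) (deriv θ (k * z) * k) z := by
      simpa [Function.comp_def] using!
        (hθ.differentiable (k * z)).hasDerivAt.comp z ((hasDerivAt_id z).const_mul k)
    have := hd.eventually_ne (c := 0) (mul_ne_zero (hθ.deriv_ne_zero h0) hk)
    exact mem_closure_iff_frequently.2 (this.frequently.filter_mono nhdsWithin_le_nhds)
  · exact subset_closure h0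

/-- The denominators of the weights do not vanish: `N` times their argument is `N η`, modulo the
lattice. -/
theorem apply_ne_zero_of_nsmul (hθ : IsOddTheta τ θ) {N : ℕ} (hN : N ≠ 0) {η : ℂ}
    (hη : θ (N * η) ≠ 0) (a b : ℤ) : θ (η + (a * τ + b) / N) ≠ 0 := by
  intro h
  have hN' : (N : ℂ) ≠ 0 := by exact_mod_cast hN
  obtain ⟨m, n, h⟩ := (hθ.zero_iff _).1 h
  refine hη ((hθ.zero_iff _).2 ⟨N * m - b, N * n - a, ?_⟩)
  push_cast
  field_simp at h
  linear_combination h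

/-- A theta function of degree two with a double zero at the origin is a multiple of `θ²`. -/
theorem exists_div_sq (hθ : IsOddTheta τ θ) (hf : QuasiPeriodic τ 2 a b f) (ha : a ≠ 0)
    (hb : b ≠ 0) (h0 : f 0 = 0) (h1 : deriv f 0 = 0) :
    ∃ g, QuasiPeriodic τ 0 a (b * em (2 * τ)) g ∧ ∀ z, f z = g z * θ z ^ 2 := by
  obtain ⟨g₁, hg₁, h⟩ := hθ.exists_div hf ha hb h0
  simp only [sub_zero] at h
  have h2 : g₁ 0 = 0 := by
    rw [funext h, deriv_fun_mul (hg₁.differentiable 0) (hθ.differentiable 0), hθ.apply_zero,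
      mul_zero, zero_add] at h1
    exact (mul_eq_zero.1 h1).resolve_right hθ.deriv_ne
  obtain ⟨g, hg, h'⟩ := hθ.exists_div hg₁ (by simpa using ha) (by simp [hb, em_ne_zero]) h2
  simp only [sub_zero] at h'
  refine ⟨g, ?_, fun z => by rw [h, h']; ring⟩
  convert hg using 1
  · norm_num
  · rw [neg_neg]
  · rw [mul_zero, sub_zero, neg_mul, neg_neg, mul_assoc, ← em_add, two_mul]

end IsOddTheta

/-! ### The weight functions -/

/-- The ratio `W_{(a, b)}(x) / W_{(a, b)}(0)`, for integers `a, b` and with `η = ζ / N`. It is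
periodic of period `N` in `a` and `b`. -/
def wRatio (N : ℕ) (τ : ℂ) (θ : ℂ → ℂ) (η : ℂ) (a b : ℤ) (x : ℂ) : ℂ :=
  em (2 * a * x / N) * θ (x + η + (a * τ + b) / N) / θ (η + (a * τ + b) / N)

section Weights

variable {N : ℕ} {τ : ℂ} {θ : ℂ → ℂ} {η : ℂ}

theorem wRatio_zero (hθ : IsOddTheta τ θ) (hN : N ≠ 0) (hη : θ (N * η) ≠ 0) (a b : ℤ) :
    wRatio N τ θ η a b 0 = 1 := by
  have := hθ.apply_ne_zero_of_nsmul hN hη a b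
  rw [wRatio, mul_zero, zero_div, em_zero, one_mul, zero_add, div_self this]

theorem wRatio_periodic (hθ : IsOddTheta τ θ) (hN : N ≠ 0) (x : ℂ) :
    Periodic₂ N fun a b => wRatio N τ θ η a b x := by
  have hN' : (N : ℂ) ≠ 0 := by exact_mod_cast hN
  constructor
  · intro a b
    have e : ∀ y : ℂ, y + (((a + N : ℤ) : ℂ) * τ + b) / N = y + (a * τ + b) / N + τ := by
      intro y; push_cast; field_simp
      ring
    have e2 : em (2 * ((a + N : ℤ) : ℂ) * x / N) = em (2 * a * x / N) * em (2 * x) := by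
      rw [← em_add]; congr 1; push_cast; field_simp
    have e3 : em (-(2 * ((1 : ℤ) : ℂ) * (x + η + (a * τ + b) / N))) =
        em (-(2 * x)) * em (-(2 * ((1 : ℤ) : ℂ) * (η + (a * τ + b) / N))) := by
      rw [← em_add]; congr 1; push_cast; ring
    simp only [wRatio]
    rw [e, e, hθ.add_tau, hθ.add_tau, e2, e3, em_neg (2 * x)]
    have := em_ne_zero (2 * x)
    have := em_ne_zero (-τ)
    have := em_ne_zero (-(2 * ((1 : ℤ) : ℂ) * (η + (a * τ + b) / N)))
    generalize em (-(2 * ((1 : ℤ) : ℂ) * (η + (a * τ + b) / N))) = F at *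
    generalize θ (x + η + (a * τ + b) / N) = Y
    generalize θ (η + (a * τ + b) / N) = Z
    generalize em (2 * a * x / N) = A
    field_simp
  · intro a b
    have e : ∀ y : ℂ, y + (a * τ + ((b + N : ℤ) : ℂ)) / N = y + (a * τ + b) / N + 1 := by
      intro y; push_cast; field_simp
      ring
    simp only [wRatio]
    rw [e, e, hθ.add_one, hθ.add_one]
    field_simp

theorem wRatio_quasiPeriodic (hθ : IsOddTheta τ θ) (a b : ℤ) :
    QuasiPeriodic τ 1 (-em (2 * a / N)) (-em (-τ - 2 * η - 2 * b / N)) (wRatio N τ θ η a b) where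
  differentiable := by
    refine Differentiable.div_const (Differentiable.mul (differentiable_em.comp (by fun_prop))
      (hθ.differentiable.comp (by fun_prop))) _
  add_one x := by
    rw [wRatio, wRatio, show x + 1 + η + (a * τ + b) / N = x + η + (a * τ + b) / N + 1 by ring,
      hθ.add_one, show 2 * a * (x + 1) / N = 2 * a / N + 2 * a * x / N by ring, em_add]
    ring
  add_tau x := by
    have e : em (2 * a * (x + τ) / N) * (em (-τ) *
        em (-(2 * ((1 : ℤ) : ℂ) * (x + η + (a * τ + b) / N)))) =
        em (-τ - 2 * η - 2 * b / N) * em (-(2 * ((1 : ℤ) : ℂ) * x)) * em (2 * a * x / N) := by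
      rw [← em_add, ← em_add, ← em_add, ← em_add]; congr 1; push_cast; ring
    rw [wRatio, wRatio, show x + τ + η + (a * τ + b) / N = x + η + (a * τ + b) / N + τ by ring,
      hθ.add_tau]
    linear_combination -θ (x + η + (a * τ + b) / N) / θ (η + (a * τ + b) / N) * e

/-- The sum over `β` of `χ(β) W_{β + γ}(x - X) W_β(-x)` is a theta function of degree two
in `x`. -/
theorem wRatio_mul_quasiPeriodic (hθ : IsOddTheta τ θ) (X : ℂ) (c d : ℤ) (χ : Fin N × Fin N → ℂ) :
    QuasiPeriodic τ 2 (em (2 * c / N)) (em (2 * ((-d : ℤ) : ℂ) / N) * em (2 * X - 2 * τ)) fun x =>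
      ∑ β : Fin N × Fin N, χ β * (wRatio N τ θ η (β.1 + c) (β.2 + d) (x - X) *
        wRatio N τ θ η β.1 β.2 (-x)) := by
  refine QuasiPeriodic.finsetSum fun β _ => QuasiPeriodic.const_mul ?_ _
  have h1 := (wRatio_quasiPeriodic (N := N) (η := η) hθ (β.1 + c) (β.2 + d)).comp_sub X
  have h2 := (wRatio_quasiPeriodic (N := N) (η := η) hθ β.1 β.2).comp_neg
    (by simp [em_ne_zero]) (by simp [em_ne_zero])
  convert h1.mul h2 using 1
  · norm_num
  · rw [inv_neg, neg_mul_neg, ← em_neg, ← em_add]; congr 1; push_cast; ring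
  · rw [inv_neg, ← em_neg]
    simp only [neg_mul, mul_neg, neg_neg, ← em_add]
    congr 1; push_cast; ring

end Weights

/-! ### Sums of weights -/

section Weights

variable {N : ℕ} {τ : ℂ} {θ : ℂ → ℂ} {η : ℂ}

theorem wRatio_differentiable (hθ : IsOddTheta τ θ) (a b : ℤ) :
    Differentiable ℂ (wRatio N τ θ η a b) := (wRatio_quasiPeriodic hθ a b).differentiable

/-- The off-diagonal part of the unitarity relation: the sum is a theta function of degree two with
a nontrivial character and with a double zero at the origin. -/
theorem wRatio_unitarity_off (hθ : IsOddTheta τ θ) (hτ : 0 < τ.im) (hN : N ≠ 0)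
    (hη : θ (N * η) ≠ 0) {c d : ℤ} (h : ¬ ((N : ℤ) ∣ c ∧ (N : ℤ) ∣ d)) (x : ℂ) :
    ∑ β : Fin N × Fin N, em (2 * (((β.1 : ℤ) * d - c * (β.2 : ℤ) : ℤ) : ℂ) / N) *
      (wRatio N τ θ η (β.1 + c) (β.2 + d) x * wRatio N τ θ η β.1 β.2 (-x)) = 0 := by
  set χ : Fin N × Fin N → ℂ := fun β => em (2 * (((β.1 : ℤ) * d - c * (β.2 : ℤ) : ℤ) : ℂ) / N)
    with hχ
  set φ : ℂ → ℂ := fun x => ∑ β : Fin N × Fin N, χ β *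
    (wRatio N τ θ η (β.1 + c) (β.2 + d) x * wRatio N τ θ η β.1 β.2 (-x)) with hφ
  have hq : QuasiPeriodic τ 2 (em (2 * c / N)) (em (2 * ((-d : ℤ) : ℂ) / N) * em (-(2 * τ))) φ := by
    have := wRatio_mul_quasiPeriodic (N := N) (η := η) hθ 0 c d χ
    simpa only [sub_zero, mul_zero, zero_sub] using this
  have hw1 : ∀ a b : ℤ, wRatio N τ θ η a b 0 = 1 := wRatio_zero hθ hN hη
  have h0 : φ 0 = 0 := by
    simp only [hφ, neg_zero, hw1, mul_one]
    exact sum_character_eq_zero hN h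
  set E : ℤ → ℤ → ℂ := fun a b => deriv (wRatio N τ θ η a b) 0 with hE
  have hEp : Periodic₂ N E := by
    constructor
    · intro a b
      simp only [hE]
      congr 1; ext x
      exact (wRatio_periodic hθ hN x).1 a b
    · intro a b
      simp only [hE]
      congr 1; ext x
      exact (wRatio_periodic hθ hN x).2 a b
  have h1 : deriv φ 0 = 0 := by
    have hd : HasDerivAt φ (∑ β : Fin N × Fin N, χ β * (E (β.1 + c) (β.2 + d) - E β.1 β.2)) 0 := by
      refine HasDerivAt.fun_sum fun β _ => HasDerivAt.const_mul _ ?_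
      have d1 := (wRatio_differentiable (N := N) (η := η) hθ (β.1 + c) (β.2 + d) 0).hasDerivAt
      have d2 : HasDerivAt (fun x => wRatio N τ θ η β.1 β.2 (-x)) (-E β.1 β.2) 0 := by
        have := (wRatio_differentiable (N := N) (η := η) hθ β.1 β.2 (-0)).hasDerivAt.comp (0 : ℂ)
          (hasDerivAt_neg (0 : ℂ))
        simpa [Function.comp_def, hE] using! this
      convert d1.fun_mul d2 using 1
      rw [neg_zero, hw1, hw1]; ring
    rw [hd.deriv]
    have hp : Periodic₂ N fun a b : ℤ =>
        em (2 * ((a * d - c * b : ℤ) : ℂ) / N) * E a b := by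
      have hadd : ∀ a b k l : ℤ, (N : ℤ) ∣ k * d - c * l →
          em (2 * (((a + k) * d - c * (b + l) : ℤ) : ℂ) / N) =
          em (2 * ((a * d - c * b : ℤ) : ℂ) / N) := by
        intro a b k l hkl
        rw [← one_mul (em (2 * ((a * d - c * b : ℤ) : ℂ) / N)), ← (em_div_eq_one_iff hN _).2 hkl,
          ← em_add]
        congr 1; push_cast; ring
      constructor
      · intro a b
        have := hadd a b N 0 ⟨d, by ring⟩
        rw [add_zero] at this
        simp only [this, hEp.1]
      · intro a b
        have := hadd a b 0 N ⟨-c, by ring⟩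
        rw [add_zero] at this
        simp only [this, hEp.2]
    have hs := hp.sum_add c d
    have e : ∀ a b : ℤ, (a + c) * d - c * (b + d) = a * d - c * b := fun a b => by ring
    simp only [e] at hs
    simp only [mul_sub, Finset.sum_sub_distrib, hχ]
    exact sub_eq_zero.2 hs
  obtain ⟨g, hg, hfg⟩ := hθ.exists_div_sq hq (em_ne_zero _) (by simp [em_ne_zero]) h0 h1
  rw [mul_assoc, ← em_add, neg_add_cancel, em_zero, mul_one] at hg
  have hg0 := hg.eq_zero_of_norm hτ (norm_em_div _ _) (norm_em_div _ _) (by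
    by_contra! h'
    refine h ⟨(em_div_eq_one_iff hN _).1 h'.1, ?_⟩
    simpa using (em_div_eq_one_iff hN _).1 h'.2) x
  have := hfg x
  rw [hg0, zero_mul] at this
  exact this

/-- The values of the weights at lattice points differ by characters. -/
theorem wRatio_lattice (hθ : IsOddTheta τ θ) (hN : N ≠ 0) (hη : θ (N * η) ≠ 0) {z : ℂ}
    (hz : θ z = 0) : ∃ (m n : ℤ) (C : ℂ), z = m + n * τ ∧
      ∀ a b : ℤ, wRatio N τ θ η a b z = C * em (2 * ((a * m - n * b : ℤ) : ℂ) / N) := by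
  obtain ⟨m, n, rfl⟩ := (hθ.zero_iff z).1 hz
  have hq := wRatio_quasiPeriodic (N := N) (η := η) hθ
  have key := lattice_induction (τ := τ) (P := fun z => ∃ (m n : ℤ) (C : ℂ), z = m + n * τ ∧
      ∀ a b : ℤ, wRatio N τ θ η a b z = C * em (2 * ((a * m - n * b : ℤ) : ℂ) / N)) (w := 0)
    (fun z => ⟨?_, ?_⟩) (fun z => ⟨?_, ?_⟩) ?_ m n
  · simpa using key
  · rintro ⟨m, n, C, rfl, h⟩
    refine ⟨m + 1, n, -C, by push_cast; ring, fun a b => ?_⟩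
    rw [(hq a b).add_one, h, show (2 * ((a * (m + 1) - n * b : ℤ) : ℂ) / N) =
      2 * a / N + 2 * ((a * m - n * b : ℤ) : ℂ) / N by push_cast; ring, em_add]
    ring
  · rintro ⟨m, n, C, hz, h⟩
    refine ⟨m - 1, n, -C, by push_cast; linear_combination hz, fun a b => ?_⟩
    have h1 := h a b
    rw [(hq a b).add_one, show (2 * ((a * m - n * b : ℤ) : ℂ) / N) =
      2 * a / N + 2 * ((a * (m - 1) - n * b : ℤ) : ℂ) / N by push_cast; ring, em_add] at h1
    refine mul_left_cancel₀ (neg_ne_zero.2 (em_ne_zero (2 * a / N))) ?_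
    rw [h1]; ring
  · rintro ⟨m, n, C, rfl, h⟩
    refine ⟨m, n + 1, -C * em (-τ - 2 * η) * em (-(2 * (1 : ℤ) * (m + n * τ))),
      by push_cast; ring, fun a b => ?_⟩
    rw [(hq a b).add_tau, h, show (2 * ((a * m - (n + 1) * b : ℤ) : ℂ) / N) =
      2 * ((a * m - n * b : ℤ) : ℂ) / N + -(2 * b / N) by push_cast; ring, em_add,
      sub_eq_add_neg (-τ - 2 * η), em_add (-τ - 2 * η)]
    ring
  · rintro ⟨m, n, C, hz, h⟩
    refine ⟨m, n - 1, -C * (em (-τ - 2 * η))⁻¹ * (em (-(2 * (1 : ℤ) * z)))⁻¹,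
      by push_cast; linear_combination hz, fun a b => ?_⟩
    have h1 := h a b
    rw [(hq a b).add_tau, show (2 * ((a * m - n * b : ℤ) : ℂ) / N) =
      2 * ((a * m - (n - 1) * b : ℤ) : ℂ) / N + -(2 * b / N) by push_cast; ring, em_add,
      sub_eq_add_neg (-τ - 2 * η), em_add (-τ - 2 * η)] at h1
    have e1 := em_ne_zero (-τ - 2 * η)
    have e2 := em_ne_zero (-(2 * (1 : ℤ) * z))
    have e3 := em_ne_zero (-(2 * b / N))
    generalize em (-τ - 2 * η) = A at *
    generalize em (-(2 * (1 : ℤ) * z)) = B at *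
    generalize em (-(2 * b / N)) = D at *
    generalize em (2 * ((a * m - (n - 1) * b : ℤ) : ℂ) / N) = F at *
    field_simp
    refine mul_left_cancel₀ e3 ?_
    linear_combination -h1
  · exact ⟨0, 0, 1, by simp, fun a b => by simp [wRatio_zero hθ hN hη]⟩

/-- The sum of the weights over all characteristics, at `x = N t`. By `wRatio_lattice` it vanishes
where `θ (N t)` does, except at the zeros of `θ t`; so `∑ w_β(N t) θ(t)` is divisible by `θ (N t)`,
and the quotient is a theta function of degree one, hence a translate of `θ`. -/
theorem sum_wRatio (hθ : IsOddTheta τ θ) (hτ : 0 < τ.im) (hN : N ≠ 0) (hη : θ (N * η) ≠ 0)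
    (t : ℂ) : (∑ β : Fin N × Fin N, wRatio N τ θ η β.1 β.2 (N * t)) * θ t * θ (N * η) =
      N * θ (t + N * η) * θ (N * t) := by
  have hN' : (N : ℂ) ≠ 0 := by exact_mod_cast hN
  have hq := wRatio_quasiPeriodic (N := N) (η := η) hθ
  set K : ℂ → ℂ := fun x => ∑ β : Fin N × Fin N, wRatio N τ θ η β.1 β.2 x with hK
  have hKd : Differentiable ℂ K := Differentiable.fun_sum fun β _ => wRatio_differentiable hθ _ _
  have hNd : Differentiable ℂ fun t : ℂ => (N : ℂ) * t := differentiable_id.const_mul _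
  have hder : ∀ t, HasDerivAt (fun t => θ (N * t)) (deriv θ (N * t) * N) t := fun t => by
    simpa [Function.comp_def] using!
      (hθ.differentiable (N * t)).hasDerivAt.comp t ((hasDerivAt_id t).const_mul (N : ℂ))
  obtain ⟨G, hG, hfG⟩ := exists_differentiable_mul (f := fun t => K (N * t) * θ t)
    (h := fun t => θ (N * t)) ((hKd.comp hNd).mul hθ.differentiable) (hθ.differentiable.comp hNd)
    (fun t ht => by
      refine ⟨?_, by rw [(hder t).deriv]; exact mul_ne_zero (hθ.deriv_ne_zero ht) hN'⟩
      obtain ⟨m, n, C, hz, hC⟩ := wRatio_lattice hθ hN hη ht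
      rw [mul_eq_zero]
      by_cases hmn : (N : ℤ) ∣ n ∧ (N : ℤ) ∣ m
      · right
        obtain ⟨⟨k, rfl⟩, ⟨l, rfl⟩⟩ := hmn
        refine (hθ.zero_iff t).2 ⟨l, k, mul_left_cancel₀ hN' ?_⟩
        rw [hz]; push_cast; ring
      · left
        simp only [hK, hC, ← Finset.mul_sum]
        rw [sum_character_eq_zero hN hmn, mul_zero])
  have hdense : Dense {t | θ (N * t) ≠ 0} := hθ.dense_ne_zero hN'
  -- iterated translations
  have it1 : ∀ (f : ℂ → ℂ) (a b : ℂ), QuasiPeriodic τ 1 a b f → ∀ (k : ℕ) (x : ℂ),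
      f (x + k) = a ^ k * f x := by
    intro f a b hf k x
    induction k with
    | zero => simp
    | succ k ih => rw [Nat.cast_succ, ← add_assoc, hf.add_one, ih]; ring
  have it2 : ∀ (a b : ℤ) (k : ℕ) (x : ℂ), wRatio N τ θ η a b (x + k * τ) * θ x =
      em (-(2 * η) - 2 * b / N) ^ k * θ (x + k * τ) * wRatio N τ θ η a b x := by
    intro a b k x
    induction k with
    | zero => simp [mul_comm]
    | succ k ih =>
      rw [show x + ((k + 1 : ℕ) : ℂ) * τ = x + k * τ + τ by push_cast; ring, (hq a b).add_tau,
        hθ.add_tau, show -τ - 2 * η - 2 * b / N = -τ + (-(2 * η) - 2 * b / N) by ring, em_add]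
      linear_combination -em (-τ) * em (-(2 * η) - 2 * b / N) *
        em (-(2 * (1 : ℤ) * (x + k * τ))) * ih
  have hK1 : ∀ t, K (N * (t + 1)) * θ (N * t) = θ (N * (t + 1)) * K (N * t) := by
    intro t
    simp only [hK, mul_add, mul_one]
    have h1 : ∀ β : Fin N × Fin N, wRatio N τ θ η β.1 β.2 (N * t + N) =
        (-1) ^ N * wRatio N τ θ η β.1 β.2 (N * t) := by
      intro β
      rw [it1 _ _ _ (hq _ _), neg_pow, em_pow, mul_div_cancel₀ _ hN']
      rw [em_two_mul_int, mul_one]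
    simp only [h1, it1 _ _ _ hθ.toQuasiPeriodic, ← Finset.mul_sum]
    ring
  have hK2 : ∀ t, K (N * (t + τ)) * θ (N * t) =
      em (-(2 * N * η)) * θ (N * (t + τ)) * K (N * t) := by
    intro t
    simp only [hK, mul_add, Finset.sum_mul, Finset.mul_sum, it2]
    refine Finset.sum_congr rfl fun β _ => ?_
    congr 2
    rw [em_pow, show (N : ℂ) * (-(2 * η) - 2 * ((β.2 : ℤ) : ℂ) / N) =
      -(2 * N * η) + 2 * ((-(β.2 : ℤ) : ℤ) : ℂ) by push_cast; field_simp; ring, em_add, em_two_mul_int,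
      mul_one]
  have hne1 : ∀ t, θ (N * t) ≠ 0 → θ (N * (t + 1)) ≠ 0 := by
    intro t ht
    rw [mul_add, mul_one, it1 _ _ _ hθ.toQuasiPeriodic]
    exact mul_ne_zero (pow_ne_zero _ (by simp)) ht
  have hne2 : ∀ t, θ (N * t) ≠ 0 → θ (N * (t + τ)) ≠ 0 := by
    intro t ht h0
    obtain ⟨m, n, h⟩ := (hθ.zero_iff _).1 h0
    exact ht ((hθ.zero_iff _).2 ⟨m, n - N, by push_cast; linear_combination h⟩)
  have hGq : QuasiPeriodic τ 1 (-1) (-em (-τ) * em (-(2 * (1 : ℤ) * (N * η)))) G := by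
    refine ⟨hG, ?_, ?_⟩
    · have : (fun z => G (z + 1)) = fun z => -1 * G z := by
        refine Continuous.ext_on hdense (hG.continuous.comp (by fun_prop))
          (hG.continuous.const_mul _) fun t ht => ?_
        refine mul_right_cancel₀ (mul_ne_zero ht (hne1 t ht)) ?_
        have e1 := hfG (t + 1)
        have e2 := hfG t
        have e3 := hK1 t
        simp only [hθ.add_one] at e1 e2
        linear_combination -θ (N * t) * e1 - θ t * e3 - θ (N * (t + 1)) * e2
      exact fun z => congrFun this z
    · have : (fun z => G (z + τ)) = fun z =>
          -em (-τ) * em (-(2 * (1 : ℤ) * (N * η))) * em (-(2 * (1 : ℤ) * z)) * G z := by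
        refine Continuous.ext_on hdense (hG.continuous.comp (by fun_prop)) ?_ fun t ht => ?_
        · exact (continuous_const.mul (differentiable_em.continuous.comp (by fun_prop))).mul
            hG.continuous
        refine mul_right_cancel₀ (mul_ne_zero ht (hne2 t ht)) ?_
        have e1 := hfG (t + τ)
        have e2 := hfG t
        have e3 := hK2 t
        rw [show -(2 * N * η) = -(2 * (1 : ℤ) * (N * η)) by push_cast; ring] at e3
        simp only [hθ.add_tau] at e1 e2
        linear_combination -θ (N * t) * e1 -
          em (-τ) * em (-(2 * (1 : ℤ) * t)) * θ t * e3 - em (-τ) * em (-(2 * (1 : ℤ) * t)) *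
          em (-(2 * (1 : ℤ) * (N * η))) * θ (N * (t + τ)) * e2
      exact fun z => congrFun this z
  have hGs := hGq.comp_sub (N * η)
  have e0 : -em (-τ) * em (-(2 * (1 : ℤ) * (N * η))) * em (2 * (1 : ℤ) * (N * η)) = -em (-τ) := by
    rw [mul_assoc, ← em_add, neg_add_cancel, em_zero, mul_one]
  rw [e0] at hGs
  obtain ⟨C, hC⟩ := hθ.eq_const_mul hτ hGs
  have hC' : ∀ t, K (N * t) * θ t = C * θ (t + N * η) * θ (N * t) := by
    intro t
    have h1 := hC (t + N * η)
    rw [add_sub_cancel_right] at h1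
    rw [← h1]; exact hfG t
  -- the constant is found by comparing derivatives at the origin
  have hCv : C * θ (N * η) = N := by
    have d1 : HasDerivAt (fun t => K (N * t) * θ t) (K 0 * deriv θ 0) 0 := by
      have := ((hKd.comp hNd) 0).hasDerivAt.fun_mul (hθ.differentiable 0).hasDerivAt
      simpa [hθ.apply_zero] using! this
    have d2 : HasDerivAt (fun t => C * θ (t + N * η) * θ (N * t))
        (C * θ (N * η) * (deriv θ 0 * N)) 0 := by
      have h3 : DifferentiableAt ℂ (fun t => C * θ (t + N * η)) 0 :=
        ((hθ.differentiable.comp (differentiable_id.add_const _)).const_mul C) 0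
      have := h3.hasDerivAt.fun_mul (hder 0)
      simpa [hθ.apply_zero] using this
    rw [funext hC'] at d1
    have h := d1.unique d2
    have hK0 : K 0 = N * N := by
      simp [hK, wRatio_zero hθ hN hη]
    rw [hK0] at h
    refine mul_right_cancel₀ (mul_ne_zero hθ.deriv_ne hN') ?_
    linear_combination -h
  linear_combination θ (N * η) * hC' t + θ (t + N * η) * θ (N * t) * hCv

end Weights

/-! ### Unitarity of the weights -/

section Weights

variable {N : ℕ} {τ : ℂ} {θ : ℂ → ℂ} {η : ℂ}

theorem IsOddTheta.differentiable_deriv (hθ : IsOddTheta τ θ) : Differentiable ℂ (deriv θ) := by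
  have := hθ.differentiable.contDiff (n := 2)
  exact (contDiff_succ_iff_deriv.1 (show ContDiff ℂ (1 + 1) θ from this)).2.2.differentiable
    (by norm_num)

theorem hasDerivAt_wRatio (hθ : IsOddTheta τ θ) (a b : ℤ) (x : ℂ) :
    HasDerivAt (wRatio N τ θ η a b) (Complex.I * Real.pi * (2 * a / N) * wRatio N τ θ η a b x +
      em (2 * a * x / N) * deriv θ (x + η + (a * τ + b) / N) / θ (η + (a * τ + b) / N)) x := by
  have h1 : HasDerivAt (fun x => em (2 * a * x / N))
      (Complex.I * Real.pi * em (2 * a * x / N) * (2 * a / N)) x := by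
    have := (hasDerivAt_em (2 * a * x / N)).comp x
      (((hasDerivAt_id x).const_mul (2 * (a : ℂ))).div_const (N : ℂ))
    simpa [Function.comp_def] using! this
  have h2 : HasDerivAt (fun x => θ (x + η + (a * τ + b) / N))
      (deriv θ (x + η + (a * τ + b) / N)) x := by
    have := (hθ.differentiable (x + η + (a * τ + b) / N)).hasDerivAt.comp x
      (((hasDerivAt_id x).add_const η).add_const ((a * τ + b) / N))
    simpa [Function.comp_def] using! this
  refine ((h1.fun_mul h2).div_const (θ (η + (a * τ + b) / N))).congr_deriv ?_
  rw [wRatio]; ring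

/-- The logarithmic derivative of `η ↦ θ (N η)` as a sum over characteristics. -/
theorem sum_logDeriv (hθ : IsOddTheta τ θ) (hτ : 0 < τ.im) (hN : N ≠ 0) (hη : θ (N * η) ≠ 0) :
    ∑ β : Fin N × Fin N, (Complex.I * Real.pi * (2 * ((β.1 : ℤ) : ℂ) / N) +
      deriv θ (η + (((β.1 : ℤ) : ℂ) * τ + ((β.2 : ℤ) : ℂ)) / N) /
        θ (η + (((β.1 : ℤ) : ℂ) * τ + ((β.2 : ℤ) : ℂ)) / N)) =
      N * (deriv θ (N * η) / θ (N * η)) := by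
  have hN' : (N : ℂ) ≠ 0 := by exact_mod_cast hN
  set S := ∑ β : Fin N × Fin N, (Complex.I * Real.pi * (2 * ((β.1 : ℤ) : ℂ) / N) +
      deriv θ (η + (((β.1 : ℤ) : ℂ) * τ + ((β.2 : ℤ) : ℂ)) / N) /
        θ (η + (((β.1 : ℤ) : ℂ) * τ + ((β.2 : ℤ) : ℂ)) / N)) with hS
  set K : ℂ → ℂ := fun x => ∑ β : Fin N × Fin N, wRatio N τ θ η β.1 β.2 x with hK
  have hK0 : K 0 = N * N := by simp [hK, wRatio_zero hθ hN hη]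
  have hKd : HasDerivAt K S 0 := by
    refine HasDerivAt.fun_sum fun β _ => ?_
    have := hasDerivAt_wRatio (N := N) (η := η) hθ β.1 β.2 0
    rw [wRatio_zero hθ hN hη] at this
    simpa using this
  have hKN : HasDerivAt (fun t => K (N * t)) (S * N) 0 := by
    have h2 : HasDerivAt K S (N * (0 : ℂ)) := by rwa [mul_zero]
    simpa [Function.comp_def] using! h2.comp (0 : ℂ) ((hasDerivAt_id (0 : ℂ)).const_mul (N : ℂ))
  have hKN' : HasDerivAt (fun t => K (N * (-t))) (-(S * N)) 0 := by
    have h2 : HasDerivAt (fun t => K (N * t)) (S * N) (-0 : ℂ) := by rwa [neg_zero]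
    simpa [Function.comp_def] using! h2.comp (0 : ℂ) (hasDerivAt_neg (0 : ℂ))
  have h1 : HasDerivAt (fun t => θ (N * η + t)) (deriv θ (N * η)) 0 := by
    have h2 : HasDerivAt θ (deriv θ (N * η)) (N * η + 0) := by
      rw [add_zero]; exact (hθ.differentiable _).hasDerivAt
    simpa [Function.comp_def] using! h2.comp (0 : ℂ) ((hasDerivAt_id (0 : ℂ)).const_add (N * η))
  have h1' : HasDerivAt (fun t => θ (N * η - t)) (-deriv θ (N * η)) 0 := by
    have h2 : HasDerivAt θ (deriv θ (N * η)) (N * η - 0) := by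
      rw [sub_zero]; exact (hθ.differentiable _).hasDerivAt
    simpa [Function.comp_def] using! h2.comp (0 : ℂ) ((hasDerivAt_id (0 : ℂ)).const_sub (N * η))
  -- `K (N t) / K (-N t) = θ (N η + t) / θ (N η - t)` since `θ (N t) / θ t` is even
  have key : (fun t => K (N * t) * θ (N * η - t)) = fun t => K (N * (-t)) * θ (N * η + t) := by
    have hKc : Continuous K := (Differentiable.fun_sum fun β _ =>
      wRatio_differentiable hθ _ _).continuous
    have hθc := hθ.differentiable.continuous
    have hdense := hθ.dense_ne_zero hN'
    refine Continuous.ext_on hdense (by fun_prop) (by fun_prop) fun t ht => ?_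
    have ht' : θ t ≠ 0 := by
      intro h0
      obtain ⟨m, n, rfl⟩ := (hθ.zero_iff _).1 h0
      exact ht ((hθ.zero_iff _).2 ⟨N * m, N * n, by push_cast; ring⟩)
    have e1 := sum_wRatio hθ hτ hN hη t
    have e2 := sum_wRatio hθ hτ hN hη (-t)
    have e3 : θ (N * -t) = -θ (N * t) := by rw [mul_neg, hθ.neg hτ]
    rw [hθ.neg hτ t, e3] at e2
    refine mul_right_cancel₀ (mul_ne_zero (mul_ne_zero ht' hη) ht) ?_
    simp only [hK]
    rw [show -t + N * η = N * η - t by ring] at e2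
    rw [add_comm t] at e1
    linear_combination θ (N * η - t) * θ (N * t) * e1 + θ (N * η + t) * θ (N * t) * e2
  have hd1 := hKN.fun_mul h1'
  rw [key] at hd1
  have h := hd1.unique (hKN'.fun_mul h1)
  simp only [mul_zero, neg_zero, hK0, sub_zero, add_zero] at h
  have h3 : S * θ (N * η) = N * deriv θ (N * η) := by
    refine mul_left_cancel₀ (mul_ne_zero two_ne_zero hN') ?_
    linear_combination h
  field_simp
  linear_combination h3

/-- The second logarithmic derivative of `θ`. -/
def logDeriv₂ (θ : ℂ → ℂ) (y : ℂ) : ℂ := (deriv (deriv θ) y * θ y - deriv θ y ^ 2) / θ y ^ 2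

theorem hasDerivAt_logDeriv (hθ : IsOddTheta τ θ) {y : ℂ} (hy : θ y ≠ 0) :
    HasDerivAt (fun y => deriv θ y / θ y) (logDeriv₂ θ y) y := by
  refine ((hθ.differentiable_deriv y).hasDerivAt.fun_div
    (hθ.differentiable y).hasDerivAt hy).congr_deriv ?_
  rw [logDeriv₂]; ring

/-- The derivative of `sum_logDeriv` with respect to `η`. -/
theorem sum_logDeriv₂ (hθ : IsOddTheta τ θ) (hτ : 0 < τ.im) (hN : N ≠ 0) (hη : θ (N * η) ≠ 0) :
    ∑ β : Fin N × Fin N, logDeriv₂ θ (η + (((β.1 : ℤ) : ℂ) * τ + ((β.2 : ℤ) : ℂ)) / N) =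
      N ^ 2 * logDeriv₂ θ (N * η) := by
  have h1 : HasDerivAt (fun u => ∑ β : Fin N × Fin N,
      (Complex.I * Real.pi * (2 * ((β.1 : ℤ) : ℂ) / N) +
      deriv θ (u + (((β.1 : ℤ) : ℂ) * τ + ((β.2 : ℤ) : ℂ)) / N) /
        θ (u + (((β.1 : ℤ) : ℂ) * τ + ((β.2 : ℤ) : ℂ)) / N)))
      (∑ β : Fin N × Fin N, logDeriv₂ θ (η + (((β.1 : ℤ) : ℂ) * τ + ((β.2 : ℤ) : ℂ)) / N)) η := by
    refine HasDerivAt.fun_sum fun β _ => HasDerivAt.const_add _ ?_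
    have := (hasDerivAt_logDeriv hθ (hθ.apply_ne_zero_of_nsmul hN hη β.1 β.2)).comp η
      ((hasDerivAt_id η).add_const ((((β.1 : ℤ) : ℂ) * τ + ((β.2 : ℤ) : ℂ)) / N))
    simpa [Function.comp_def] using! this
  have h2 : HasDerivAt (fun u : ℂ => N * (deriv θ (N * u) / θ (N * u)))
      (N ^ 2 * logDeriv₂ θ (N * η)) η := by
    have := ((hasDerivAt_logDeriv hθ hη).comp η ((hasDerivAt_id η).const_mul (N : ℂ))).const_mul
      (N : ℂ)
    refine this.congr_deriv ?_
    ring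
  refine h1.unique (h2.congr_of_eventuallyEq ?_)
  have hc : ContinuousAt (fun u : ℂ => θ (N * u)) η :=
    (hθ.differentiable.continuous.comp (continuous_const.mul continuous_id)).continuousAt
  filter_upwards [hc.eventually_ne hη] with u hu
  exact sum_logDeriv hθ hτ hN hu

/-- The symmetric quotient `θ (y + x) θ (y - x) / θ(y)²`. -/
def symQuot (θ : ℂ → ℂ) (y x : ℂ) : ℂ := θ (y + x) * θ (y - x) / θ y ^ 2

theorem symQuot_quasiPeriodic (hθ : IsOddTheta τ θ) (y : ℂ) :
    QuasiPeriodic τ 2 1 (em (-(2 * τ))) (symQuot θ y) := by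
  have h1 := hθ.toQuasiPeriodic.comp_sub (-y)
  have h2 := h1.comp_neg (by simp) (by simp [em_ne_zero])
  have h3 := (h1.mul h2).const_mul (θ y ^ 2)⁻¹
  convert h3 using 1
  · norm_num
  · norm_num
  · rw [neg_mul, inv_neg, ← em_add, ← em_neg]
    simp only [neg_mul, mul_neg, neg_neg, ← em_add]
    congr 1; push_cast; ring
  · ext x
    rw [symQuot, show x - -y = y + x by ring, show -x - -y = y - x by ring]
    ring

theorem hasDerivAt_symQuot (hθ : IsOddTheta τ θ) (y x : ℂ) :
    HasDerivAt (symQuot θ y)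
      ((deriv θ (y + x) * θ (y - x) - θ (y + x) * deriv θ (y - x)) / θ y ^ 2) x := by
  have h1 : HasDerivAt (fun x => θ (y + x)) (deriv θ (y + x)) x := by
    simpa [Function.comp_def] using!
      (hθ.differentiable (y + x)).hasDerivAt.comp x ((hasDerivAt_id x).const_add y)
  have h2 : HasDerivAt (fun x => θ (y - x)) (-deriv θ (y - x)) x := by
    simpa [Function.comp_def] using!
      (hθ.differentiable (y - x)).hasDerivAt.comp x ((hasDerivAt_id x).const_sub y)
  refine ((h1.fun_mul h2).div_const (θ y ^ 2)).congr_deriv ?_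
  ring

theorem hasDerivAt_deriv_symQuot (hθ : IsOddTheta τ θ) (y : ℂ) :
    HasDerivAt (deriv (symQuot θ y)) (2 * logDeriv₂ θ y) 0 := by
  have e : deriv (symQuot θ y) = fun x =>
      (deriv θ (y + x) * θ (y - x) - θ (y + x) * deriv θ (y - x)) / θ y ^ 2 :=
    funext fun x => (hasDerivAt_symQuot hθ y x).deriv
  have hp : ∀ f : ℂ → ℂ, Differentiable ℂ f → HasDerivAt (fun x => f (y + x)) (deriv f y) 0 := by
    intro f hf
    have := (hf (y + 0)).hasDerivAt.comp (0 : ℂ) ((hasDerivAt_id (0 : ℂ)).const_add y)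
    simpa [Function.comp_def] using! this
  have hm : ∀ f : ℂ → ℂ, Differentiable ℂ f → HasDerivAt (fun x => f (y - x)) (-deriv f y) 0 := by
    intro f hf
    have := (hf (y - 0)).hasDerivAt.comp (0 : ℂ) ((hasDerivAt_id (0 : ℂ)).const_sub y)
    simpa [Function.comp_def] using! this
  rw [e]
  have d1 := hθ.differentiable
  have d2 := hθ.differentiable_deriv
  refine ((((hp _ d2).fun_mul (hm _ d1)).fun_sub
    ((hp _ d1).fun_mul (hm _ d2))).div_const (θ y ^ 2)).congr_deriv ?_
  rw [logDeriv₂, add_zero, sub_zero]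
  ring

/-- The diagonal part of the unitarity relation: both sides are even theta functions of degree two,
and they agree to third order at the origin. -/
theorem wRatio_unitarity_diag (hθ : IsOddTheta τ θ) (hτ : 0 < τ.im) (hN : N ≠ 0)
    (hη : θ (N * η) ≠ 0) (x : ℂ) :
    ∑ β : Fin N × Fin N, wRatio N τ θ η β.1 β.2 x * wRatio N τ θ η β.1 β.2 (-x) =
      N ^ 2 * (θ (N * η + x) * θ (N * η - x) / θ (N * η) ^ 2) := by
  set y : Fin N × Fin N → ℂ := fun β => η + (((β.1 : ℤ) : ℂ) * τ + ((β.2 : ℤ) : ℂ)) / N with hy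
  have hyne : ∀ β, θ (y β) ≠ 0 := fun β => hθ.apply_ne_zero_of_nsmul hN hη β.1 β.2
  have e1 : ∀ (β : Fin N × Fin N) x,
      wRatio N τ θ η β.1 β.2 x * wRatio N τ θ η β.1 β.2 (-x) = symQuot θ (y β) x := by
    intro β x
    have he : em (2 * ((β.1 : ℤ) : ℂ) * x / N) * em (2 * ((β.1 : ℤ) : ℂ) * (-x) / N) = 1 := by
      rw [← em_add, ← em_zero]; congr 1; ring
    rw [wRatio, wRatio, symQuot]
    simp only [hy]
    rw [show x + η + (((β.1 : ℤ) : ℂ) * τ + ((β.2 : ℤ) : ℂ)) / N =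
        η + (((β.1 : ℤ) : ℂ) * τ + ((β.2 : ℤ) : ℂ)) / N + x by ring,
      show -x + η + (((β.1 : ℤ) : ℂ) * τ + ((β.2 : ℤ) : ℂ)) / N =
        η + (((β.1 : ℤ) : ℂ) * τ + ((β.2 : ℤ) : ℂ)) / N - x by ring]
    rw [div_mul_div_comm, ← sq]
    congr 1
    linear_combination θ (η + (((β.1 : ℤ) : ℂ) * τ + ((β.2 : ℤ) : ℂ)) / N + x) *
      θ (η + (((β.1 : ℤ) : ℂ) * τ + ((β.2 : ℤ) : ℂ)) / N - x) * he
  simp only [e1]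
  have hsq : ∀ y, θ y ≠ 0 → symQuot θ y 0 = 1 := by
    intro y hy
    rw [symQuot, add_zero, sub_zero]
    field_simp
  set A : ℂ → ℂ := fun x => ∑ β, symQuot θ (y β) x - N ^ 2 * symQuot θ (N * η) x with hA
  have hAq : QuasiPeriodic τ 2 1 (em (-(2 * τ))) A :=
    (QuasiPeriodic.finsetSum fun β _ => symQuot_quasiPeriodic hθ (y β)).sub
      ((symQuot_quasiPeriodic hθ _).const_mul _)
  have hA0 : A 0 = 0 := by
    simp only [hA, hsq _ (hyne _), hsq _ hη]
    simp [sq]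
  have hAd : ∀ x, HasDerivAt A
      (∑ β, deriv (symQuot θ (y β)) x - N ^ 2 * deriv (symQuot θ (N * η)) x) x := fun x =>
    (HasDerivAt.fun_sum fun β _ =>
      ((symQuot_quasiPeriodic hθ (y β)).differentiable x).hasDerivAt).fun_sub
      (((symQuot_quasiPeriodic hθ (N * η)).differentiable x).hasDerivAt.const_mul _)
  have hd0 : ∀ y, deriv (symQuot θ y) 0 = 0 := by
    intro y
    rw [(hasDerivAt_symQuot hθ y 0).deriv, add_zero, sub_zero]
    ring
  have hA1 : deriv A 0 = 0 := by
    rw [(hAd 0).deriv]; simp [hd0]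
  have hA2 : HasDerivAt (deriv A) 0 0 := by
    rw [funext fun x => (hAd x).deriv]
    have := (HasDerivAt.fun_sum (u := Finset.univ) fun β (_ : β ∈ Finset.univ) =>
      hasDerivAt_deriv_symQuot hθ (y β)).fun_sub
      ((hasDerivAt_deriv_symQuot hθ (N * η)).const_mul ((N : ℂ) ^ 2))
    refine this.congr_deriv ?_
    rw [← Finset.mul_sum, sum_logDeriv₂ hθ hτ hN hη]
    ring
  obtain ⟨g, hg, hAg⟩ := hθ.exists_div_sq hAq one_ne_zero (em_ne_zero _) hA0 hA1
  rw [← em_add, neg_add_cancel, em_zero] at hg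
  have hgc : ∀ z, A z = g 0 * θ z ^ 2 := fun z => by rw [hAg, hg.eq_const hτ z 0]
  have hdA : deriv A = fun z => g 0 * (2 * θ z * deriv θ z) := by
    ext z
    have := ((hθ.differentiable z).hasDerivAt.fun_pow 2).const_mul (g 0)
    rw [funext hgc, this.deriv]
    simp
  have h2 : HasDerivAt (deriv A) (g 0 * (2 * deriv θ 0 ^ 2)) 0 := by
    rw [hdA]
    have := (((hθ.differentiable 0).hasDerivAt.const_mul 2).fun_mul
      (hθ.differentiable_deriv 0).hasDerivAt).const_mul (g 0)
    refine this.congr_deriv ?_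
    rw [hθ.apply_zero]; ring
  have hg0 : g 0 = 0 := by
    have := hA2.unique h2
    simpa [hθ.deriv_ne] using this
  have := hgc x
  rw [hg0, zero_mul] at this
  exact sub_eq_zero.1 this

end Weights

/-! ### Crossing of the weights -/

section Weights

variable {N : ℕ} {τ : ℂ} {θ : ℂ → ℂ} {η : ℂ}

theorem sum_wRatio_eq_zero (hθ : IsOddTheta τ θ) (hτ : 0 < τ.im) (hN : N ≠ 0)
    (hη : θ (N * η) ≠ 0) (c d : ℤ) :
    ∑ β : Fin N × Fin N, wRatio N τ θ η (β.1 + c) (β.2 + d) (-(N * (N * η))) = 0 := by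
  rw [(wRatio_periodic hθ hN (-(N * (N * η)))).sum_add c d]
  have h := sum_wRatio hθ hτ hN hη (-(N * η))
  rw [neg_add_cancel, hθ.apply_zero, mul_zero, zero_mul, hθ.neg hτ, mul_neg] at h
  simpa [hη] using h

/-- The crossing sum vanishes at `x = 0` and at `x = N² η`. -/
theorem exists_crossing_factor (hθ : IsOddTheta τ θ) (hτ : 0 < τ.im) (hN : N ≠ 0)
    (hη : θ (N * η) ≠ 0) (hX : θ (N * (N * η)) ≠ 0) (c d : ℤ) :
    ∃ g, QuasiPeriodic τ 0 (em (2 * c / N)) (em (2 * ((-d : ℤ) : ℂ) / N)) g ∧ ∀ x,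
      ∑ β : Fin N × Fin N, wRatio N τ θ η (β.1 + c) (β.2 + d) (x - N * (N * η)) *
        wRatio N τ θ η β.1 β.2 (-x) = g x * θ (x - N * (N * η)) * θ x := by
  set X : ℂ := N * (N * η) with hXdef
  have hq := wRatio_mul_quasiPeriodic (N := N) (η := η) hθ X c d (fun _ => 1)
  simp only [one_mul] at hq
  have h0 : ∑ β : Fin N × Fin N, wRatio N τ θ η (β.1 + c) (β.2 + d) (0 - X) *
        wRatio N τ θ η β.1 β.2 (-0) = 0 := by
    simp only [neg_zero, wRatio_zero hθ hN hη, mul_one, zero_sub]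
    exact sum_wRatio_eq_zero hθ hτ hN hη c d
  have hX0 : ∑ β : Fin N × Fin N, wRatio N τ θ η (β.1 + c) (β.2 + d) (X - X) *
        wRatio N τ θ η β.1 β.2 (-X) = 0 := by
    simp only [sub_self, wRatio_zero hθ hN hη, one_mul]
    simpa using sum_wRatio_eq_zero hθ hτ hN hη 0 0
  obtain ⟨g₁, hg₁, h1⟩ := hθ.exists_div hq (em_ne_zero _) (mul_ne_zero (em_ne_zero _) (em_ne_zero _))
    h0
  simp only [sub_zero] at h1
  have hg0 : g₁ X = 0 := by
    have := h1 X
    rw [hX0] at this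
    exact (mul_eq_zero.1 this.symm).resolve_right hX
  obtain ⟨g, hg, h2⟩ := hθ.exists_div hg₁ (by simp [em_ne_zero]) (by simp [em_ne_zero]) hg0
  refine ⟨g, ?_, fun x => by rw [h1, h2]⟩
  convert hg using 1
  · norm_num
  · rw [neg_neg]
  · simp only [neg_mul, neg_neg, ← em_add]
    congr 1; ring

theorem continuousAt_wRatio (hθ : IsOddTheta τ θ) (hN : N ≠ 0) (hη : θ (N * η) ≠ 0) (a b : ℤ)
    {f : ℂ → ℂ} (hf : Continuous f) : ContinuousAt (fun u => wRatio N τ θ u a b (f u)) η := by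
  have hc := hθ.differentiable.continuous
  have he := differentiable_em.continuous
  unfold wRatio
  exact ContinuousAt.div (by fun_prop) (by fun_prop) (hθ.apply_ne_zero_of_nsmul hN hη a b)

/-- A function of `η` vanishing wherever `θ (N² η) ≠ 0` vanishes by continuity. -/
theorem eq_zero_of_dense (hθ : IsOddTheta τ θ) (hN : N ≠ 0) (hη : θ (N * η) ≠ 0) {D : ℂ → ℂ}
    (hD : ContinuousAt D η) (h : ∀ u, θ (N * u) ≠ 0 → θ (N * (N * u)) ≠ 0 → D u = 0) :
    D η = 0 := by
  by_contra h0
  have hN' : (N : ℂ) ≠ 0 := by exact_mod_cast hN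
  have hc : ContinuousAt (fun u : ℂ => θ (N * u)) η :=
    (hθ.differentiable.continuous.comp (continuous_const.mul continuous_id)).continuousAt
  have hd := hθ.dense_ne_zero (mul_ne_zero hN' hN')
  have hf := mem_closure_iff_frequently.1 (hd η)
  obtain ⟨u, hu, hu1, hu2⟩ :=
    (hf.and_eventually ((hc.eventually_ne hη).and (hD.eventually_ne h0))).exists
  refine hu2 (h u hu1 ?_)
  rw [← mul_assoc]; exact hu

/-- The off-diagonal part of the crossing relation. -/
theorem wRatio_crossing_off (hθ : IsOddTheta τ θ) (hτ : 0 < τ.im) (hN : N ≠ 0)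
    (hη : θ (N * η) ≠ 0) {c d : ℤ} (h : ¬ ((N : ℤ) ∣ c ∧ (N : ℤ) ∣ d)) (x : ℂ) :
    ∑ β : Fin N × Fin N, wRatio N τ θ η (β.1 + c) (β.2 + d) (x - N * (N * η)) *
      wRatio N τ θ η β.1 β.2 (-x) = 0 := by
  refine eq_zero_of_dense (D := fun η => ∑ β : Fin N × Fin N, wRatio N τ θ η (β.1 + c) (β.2 + d)
    (x - N * (N * η)) * wRatio N τ θ η β.1 β.2 (-x)) hθ hN hη ?_ fun u hu hu' => ?_
  · exact tendsto_finsetSum _ fun β _ => ContinuousAt.mul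
      (continuousAt_wRatio hθ hN hη _ _ (by fun_prop))
      (continuousAt_wRatio hθ hN hη _ _ (by fun_prop))
  · obtain ⟨g, hg, hfg⟩ := exists_crossing_factor hθ hτ hN hu hu' c d
    have hg0 := hg.eq_zero_of_norm hτ (norm_em_div _ _) (norm_em_div _ _) (by
      by_contra! h'
      refine h ⟨(em_div_eq_one_iff hN _).1 h'.1, ?_⟩
      simpa using (em_div_eq_one_iff hN _).1 h'.2) x
    simp only [hfg x, hg0, zero_mul]

/-- The diagonal part of the crossing relation. Its constant is the derivative at the origin, which
is computed by differentiating `sum_wRatio` with respect to `η`. -/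
theorem wRatio_crossing_diag (hθ : IsOddTheta τ θ) (hτ : 0 < τ.im) (hN : N ≠ 0)
    (hη : θ (N * η) ≠ 0) (x : ℂ) :
    ∑ β : Fin N × Fin N, wRatio N τ θ η β.1 β.2 (x - N * (N * η)) *
      wRatio N τ θ η β.1 β.2 (-x) = -(N ^ 2 * (θ x * θ (x - N * (N * η)) / θ (N * η) ^ 2)) := by
  have hN' : (N : ℂ) ≠ 0 := by exact_mod_cast hN
  rw [← sub_eq_zero]
  refine eq_zero_of_dense (D := fun η => ∑ β : Fin N × Fin N, wRatio N τ θ η β.1 β.2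
    (x - N * (N * η)) * wRatio N τ θ η β.1 β.2 (-x) -
    -(N ^ 2 * (θ x * θ (x - N * (N * η)) / θ (N * η) ^ 2))) hθ hN hη ?_ fun η hη hη' => ?_
  · have hc := hθ.differentiable.continuous
    refine ContinuousAt.sub (tendsto_finsetSum _ fun β _ => ContinuousAt.mul
      (continuousAt_wRatio hθ hN hη _ _ (by fun_prop))
      (continuousAt_wRatio hθ hN hη _ _ (by fun_prop))) (ContinuousAt.neg (ContinuousAt.mul
        (by fun_prop) (ContinuousAt.div (by fun_prop) (by fun_prop) (pow_ne_zero 2 hη))))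
  · obtain ⟨g, hg, hfg⟩ := exists_crossing_factor hθ hτ hN hη hη' 0 0
    simp only [add_zero, neg_zero, Int.cast_zero, mul_zero, zero_div, em_zero] at hg hfg
    have hgc : ∀ z, g z = g 0 := fun z => hg.eq_const hτ z 0
    set X : ℂ := N * (N * η) with hX
    set E : Fin N × Fin N → ℂ := fun β => deriv (wRatio N τ θ η β.1 β.2) 0 with hE
    -- the derivative of the sum at the origin
    have hd1 : HasDerivAt (fun x => ∑ β : Fin N × Fin N, wRatio N τ θ η β.1 β.2 (x - X) *
        wRatio N τ θ η β.1 β.2 (-x)) (∑ β : Fin N × Fin N, (deriv (wRatio N τ θ η β.1 β.2) (-X) -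
          wRatio N τ θ η β.1 β.2 (-X) * E β)) 0 := by
      refine HasDerivAt.fun_sum fun β _ => ?_
      have d1 : HasDerivAt (fun x => wRatio N τ θ η β.1 β.2 (x - X))
          (deriv (wRatio N τ θ η β.1 β.2) (-X)) 0 := by
        have := (wRatio_differentiable (N := N) (η := η) hθ β.1 β.2 (0 - X)).hasDerivAt.comp (0 : ℂ)
          ((hasDerivAt_id (0 : ℂ)).sub_const X)
        simpa [Function.comp_def] using! this
      have d2 : HasDerivAt (fun x => wRatio N τ θ η β.1 β.2 (-x)) (-E β) 0 := by
        have := (wRatio_differentiable (N := N) (η := η) hθ β.1 β.2 (-0)).hasDerivAt.comp (0 : ℂ)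
          (hasDerivAt_neg (0 : ℂ))
        simpa [Function.comp_def, hE] using! this
      refine (d1.fun_mul d2).congr_deriv ?_
      rw [neg_zero, wRatio_zero hθ hN hη, zero_sub]; ring
    have hd2 : HasDerivAt (fun x => g x * θ (x - X) * θ x) (g 0 * θ (-X) * deriv θ 0) 0 := by
      have d1 : DifferentiableAt ℂ (fun x => g x * θ (x - X)) 0 :=
        (hg.differentiable.mul (hθ.differentiable.comp (differentiable_id.sub_const X))) 0
      refine (d1.hasDerivAt.fun_mul (hθ.differentiable 0).hasDerivAt).congr_deriv ?_
      rw [hθ.apply_zero, zero_sub, mul_zero, zero_add]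
    rw [funext hfg] at hd1
    have h12 := hd1.unique hd2
    -- the same quantity as a derivative with respect to `η`
    have hd3 : HasDerivAt (fun u => ∑ β : Fin N × Fin N, wRatio N τ θ u β.1 β.2 (-X))
        (∑ β : Fin N × Fin N, (deriv (wRatio N τ θ η β.1 β.2) (-X) -
          wRatio N τ θ η β.1 β.2 (-X) * E β)) η := by
      refine HasDerivAt.fun_sum fun β _ => ?_
      have hne := hθ.apply_ne_zero_of_nsmul hN hη β.1 β.2
      set ω : ℂ := (((β.1 : ℤ) : ℂ) * τ + ((β.2 : ℤ) : ℂ)) / N with hω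
      have d1 : HasDerivAt (fun u => θ (-X + u + ω)) (deriv θ (-X + η + ω)) η := by
        have := (hθ.differentiable (-X + η + ω)).hasDerivAt.comp η
          (((hasDerivAt_id η).const_add (-X)).add_const ω)
        simpa [Function.comp_def] using! this
      have d2 : HasDerivAt (fun u => θ (u + ω)) (deriv θ (η + ω)) η := by
        have := (hθ.differentiable (η + ω)).hasDerivAt.comp η ((hasDerivAt_id η).add_const ω)
        simpa [Function.comp_def] using! this
      refine ((d1.const_mul (em (2 * ((β.1 : ℤ) : ℂ) * (-X) / N))).fun_div d2 hne).congr_deriv ?_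
      rw [hE]
      simp only
      rw [(hasDerivAt_wRatio hθ _ _ _).deriv, (hasDerivAt_wRatio hθ _ _ _).deriv,
        wRatio_zero hθ hN hη, wRatio, ← hω]
      simp only [mul_zero, zero_div, em_zero, zero_add, one_mul]
      field_simp
      ring
    have hd4 : HasDerivAt (fun u => (∑ β : Fin N × Fin N, wRatio N τ θ u β.1 β.2 (-X)) *
        (θ (-(N * η)) * θ (N * u))) (N * (deriv θ 0 * N) * θ (-X)) η := by
      have hF : HasDerivAt (fun u : ℂ => N * θ (-(N * η) + N * u) * θ (-X))
          (N * (deriv θ 0 * N) * θ (-X)) η := by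
        have h0 : HasDerivAt θ (deriv θ 0) (-(N * η) + N * η) := by
          rw [neg_add_cancel]; exact (hθ.differentiable 0).hasDerivAt
        have := h0.comp η (((hasDerivAt_id η).const_mul (N : ℂ)).const_add (-(N * η)))
        refine ((this.const_mul (N : ℂ)).mul_const (θ (-X))).congr_deriv ?_
        simp
      refine hF.congr_of_eventuallyEq ?_
      have hc : ContinuousAt (fun u : ℂ => θ (N * u)) η :=
        (hθ.differentiable.continuous.comp (continuous_const.mul continuous_id)).continuousAt
      filter_upwards [hc.eventually_ne hη] with u hu
      have := sum_wRatio hθ hτ hN hu (-(N * η))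
      rw [mul_neg, ← hX] at this
      rw [← mul_assoc, this]
    have hd5 : DifferentiableAt ℂ (fun u => θ (-(N * η)) * θ (N * u)) η :=
      ((hθ.differentiable.comp (differentiable_id.const_mul _)).const_mul _) η
    have h34 := (hd3.fun_mul hd5.hasDerivAt).unique hd4
    have hz := sum_wRatio_eq_zero hθ hτ hN hη 0 0
    simp only [add_zero, ← hX] at hz
    rw [hz, zero_mul, add_zero, hθ.neg hτ, h12] at h34
    have hgv : g 0 * θ (N * η) ^ 2 = -N ^ 2 := by
      have hXne : θ (-X) ≠ 0 := by rw [hθ.neg hτ]; exact neg_ne_zero.2 hη'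
      refine mul_right_cancel₀ (mul_ne_zero hXne hθ.deriv_ne) ?_
      linear_combination -h34
    simp only [hfg x, hgc x]
    field_simp
    linear_combination θ x * θ (x - X) * hgv

end Weights

/-! ### The finite Heisenberg group -/

/-- Commutation of powers in a group whose commutator `z` is central. -/
theorem zpow_mul_zpow_of_central {Γ : Type*} [Group Γ] {g h z : Γ} (hz : ∀ x, Commute z x)
    (hgh : h * g = z * (g * h)) (a b : ℤ) : h ^ a * g ^ b = z ^ (a * b) * (g ^ b * h ^ a) := by
  have h1 : h * g * h⁻¹ = z * g := by rw [hgh]; group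
  have h2 : h * g ^ b * h⁻¹ = z ^ b * g ^ b := by rw [← conj_zpow, h1, (hz g).mul_zpow]
  have h3 : (g ^ b)⁻¹ * h * ((g ^ b)⁻¹)⁻¹ = z ^ b * h := by
    have hc : (g ^ b)⁻¹ * z ^ b = z ^ b * (g ^ b)⁻¹ := (((hz (g ^ b)⁻¹).zpow_left b).eq).symm
    rw [inv_inv]
    calc (g ^ b)⁻¹ * h * g ^ b = (g ^ b)⁻¹ * (h * g ^ b * h⁻¹) * h := by group
      _ = (g ^ b)⁻¹ * z ^ b * g ^ b * h := by rw [h2]; group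
      _ = z ^ b * h := by rw [hc]; group
  have h4 : (g ^ b)⁻¹ * h ^ a * ((g ^ b)⁻¹)⁻¹ = z ^ (a * b) * h ^ a := by
    rw [← conj_zpow, h3, ((hz h).zpow_left b).mul_zpow, ← zpow_mul, mul_comm b a]
  have hc : g ^ b * z ^ (a * b) = z ^ (a * b) * g ^ b := (((hz (g ^ b)).zpow_left (a * b)).eq).symm
  calc h ^ a * g ^ b = g ^ b * ((g ^ b)⁻¹ * h ^ a * ((g ^ b)⁻¹)⁻¹) := by group
    _ = z ^ (a * b) * (g ^ b * h ^ a) := by rw [h4, ← mul_assoc, hc, mul_assoc]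

/-- `g^{1/2}` as an invertible matrix. -/
def gHalfUnit (N : ℕ) : (Matrix (Fin N) (Fin N) ℂ)ˣ :=
  Matrix.nonsingInvUnit (gHalf N) (gHalf_det_isUnit N)

/-- `h` as an invertible matrix. -/
def hUnit (N : ℕ) : (Matrix (Fin N) (Fin N) ℂ)ˣ :=
  ⟨hMat N, (hMat N).transpose, hMat_mul_transpose N, mul_eq_one_comm.1 (hMat_mul_transpose N)⟩

/-- `g` as an invertible matrix. -/
def gUnit (N : ℕ) : (Matrix (Fin N) (Fin N) ℂ)ˣ := gHalfUnit N * gHalfUnit N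

/-- The scalar matrix `ω = exp (2iπ/N)`. -/
def omegaUnit (N : ℕ) : (Matrix (Fin N) (Fin N) ℂ)ˣ :=
  Units.map (algebraMap ℂ (Matrix (Fin N) (Fin N) ℂ)).toMonoidHom
    (Units.mk0 (em (2 / N)) (em_ne_zero _))

/-- The gauge-transformed basis `g^{1/2} g^b h^a g^{-1/2}` of the matrix algebra, for integers
`a, b`. -/
def jUnit (N : ℕ) (a b : ℤ) : (Matrix (Fin N) (Fin N) ℂ)ˣ :=
  gHalfUnit N * (gUnit N ^ b * hUnit N ^ a) * (gHalfUnit N)⁻¹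

theorem gUnit_val (N : ℕ) : (gUnit N : Matrix (Fin N) (Fin N) ℂ) = gMat N := by
  show gHalf N * gHalf N = gMat N
  rw [gHalf, gMat, Matrix.diagonal_mul_diagonal]
  congr 1
  ext i
  rw [← em_add]; congr 1; ring

theorem em_zpow (x : ℂ) (n : ℤ) : em x ^ n = em (n * x) := by
  rw [em, em, ← Complex.exp_int_mul]; congr 1; ring

theorem omegaUnit_zpow_val (N : ℕ) (n : ℤ) :
    ((omegaUnit N ^ n : (Matrix (Fin N) (Fin N) ℂ)ˣ) : Matrix (Fin N) (Fin N) ℂ) =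
      em (2 * n / N) • 1 := by
  rw [omegaUnit, ← map_zpow, Units.coe_map]
  simp only [RingHom.toMonoidHom_eq_coe, MonoidHom.coe_coe, Units.val_zpow_eq_zpow_val,
    Units.val_mk0, em_zpow]
  rw [Algebra.algebraMap_eq_smul_one]
  congr 2; ring

theorem omegaUnit_commute (N : ℕ) (x : (Matrix (Fin N) (Fin N) ℂ)ˣ) : Commute (omegaUnit N) x := by
  have h := omegaUnit_zpow_val N 1
  rw [zpow_one] at h
  refine Units.ext ?_
  rw [Units.val_mul, Units.val_mul, h]
  simp

theorem hUnit_mul_gUnit (N : ℕ) :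
    hUnit N * gUnit N = omegaUnit N * (gUnit N * hUnit N) := by
  have h := omegaUnit_zpow_val N 1
  rw [zpow_one] at h
  refine Units.ext ?_
  rw [Units.val_mul, Units.val_mul, Units.val_mul, h, gUnit_val]
  show hMat N * gMat N = _ • (1 : Matrix (Fin N) (Fin N) ℂ) * (gMat N * hMat N)
  rw [Matrix.smul_mul, one_mul, gMat]
  ext i j
  rw [Matrix.mul_diagonal, Matrix.smul_apply, Matrix.diagonal_mul, smul_eq_mul]
  have hN : N ≠ 0 := i.pos.ne'
  have hN' : (N : ℂ) ≠ 0 := by exact_mod_cast hN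
  by_cases hij : ((i : ℕ) + 1) % N = (j : ℕ)
  · obtain ⟨k, hk⟩ : ∃ k : ℕ, (i : ℕ) + 1 = (j : ℕ) + N * k :=
      ⟨((i : ℕ) + 1) / N, by rw [← hij, Nat.mod_add_div]⟩
    have h3 : ((i : ℕ) : ℂ) + 1 = (j : ℕ) + N * (k : ℂ) := by exact_mod_cast hk
    have h4 : em (2 * ((1 : ℤ) : ℂ) / N) * em (2 * ((i : ℕ) : ℂ) / N) = em (2 * ((j : ℕ) : ℂ) / N) := by
      rw [← em_add, show 2 * ((1 : ℤ) : ℂ) / N + 2 * ((i : ℕ) : ℂ) / N =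
        2 * ((j : ℕ) : ℂ) / N + 2 * ((k : ℤ) : ℂ) by
          push_cast
          field_simp
          linear_combination h3, em_add, em_two_mul_int, mul_one]
    rw [← h4]; ring
  · simp [hMat, hij]

theorem gUnit_pow_card (N : ℕ) : gUnit N ^ (N : ℤ) = 1 := by
  refine Units.ext ?_
  rw [zpow_natCast, Units.val_pow_eq_pow_val, gUnit_val, gMat, Matrix.diagonal_pow, Units.val_one,
    ← Matrix.diagonal_one]
  congr 1
  ext i
  have hN' : (N : ℂ) ≠ 0 := by exact_mod_cast i.pos.ne'
  rw [Pi.pow_apply, em_pow, mul_div_cancel₀ _ hN']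
  exact em_two_mul_int i

theorem hMat_pow_apply (N k : ℕ) (i j : Fin N) :
    (hMat N ^ k) i j = if ((i : ℕ) + k) % N = (j : ℕ) then 1 else 0 := by
  induction k generalizing j with
  | zero =>
    simp [Matrix.one_apply, Nat.mod_eq_of_lt i.isLt, Fin.ext_iff]
  | succ k ih =>
    have hN := i.pos
    rw [pow_succ, Matrix.mul_apply, Finset.sum_eq_single ⟨((i : ℕ) + k) % N, Nat.mod_lt _ hN⟩]
    · rw [ih]
      simp [hMat, add_assoc]
    · intro b _ hb
      rw [ih, if_neg fun h => hb (Fin.ext h.symm), zero_mul]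
    · simp

theorem hUnit_pow_card (N : ℕ) : hUnit N ^ (N : ℤ) = 1 := by
  refine Units.ext ?_
  rw [zpow_natCast, Units.val_pow_eq_pow_val]
  show hMat N ^ N = 1
  ext i j
  rw [hMat_pow_apply]
  simp [Matrix.one_apply, Nat.mod_eq_of_lt i.isLt, Fin.ext_iff]

theorem jUnit_periodic (N : ℕ) : Periodic₂ N (jUnit N) := by
  constructor
  · intro a b
    rw [jUnit, zpow_add, hUnit_pow_card, mul_one, jUnit]
  · intro a b
    rw [jUnit, zpow_add, gUnit_pow_card, mul_one, jUnit]

theorem jUnit_zero (N : ℕ) : jUnit N 0 0 = 1 := by simp [jUnit]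

theorem jUnit_add_mul_inv (N : ℕ) (a b c d : ℤ) :
    jUnit N (a + c) (b + d) * (jUnit N a b)⁻¹ = omegaUnit N ^ (-(c * b)) * jUnit N c d := by
  have hz := omegaUnit_commute N
  have h := zpow_mul_zpow_of_central hz (hUnit_mul_gUnit N) c (-b)
  rw [mul_neg] at h
  have hc : gUnit N ^ (d + b) * omegaUnit N ^ (-(c * b)) =
    omegaUnit N ^ (-(c * b)) * gUnit N ^ (d + b) := (((hz _).zpow_left _).eq).symm
  have hc2 : gHalfUnit N * omegaUnit N ^ (-(c * b)) =
    omegaUnit N ^ (-(c * b)) * gHalfUnit N := (((hz _).zpow_left _).eq).symm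
  calc jUnit N (a + c) (b + d) * (jUnit N a b)⁻¹
      = gHalfUnit N * (gUnit N ^ (d + b) * (hUnit N ^ c * gUnit N ^ (-b))) * (gHalfUnit N)⁻¹ := by
        simp only [jUnit, add_comm a c, add_comm b d]; group
    _ = gHalfUnit N * ((gUnit N ^ (d + b) * omegaUnit N ^ (-(c * b))) *
          (gUnit N ^ (-b) * hUnit N ^ c)) * (gHalfUnit N)⁻¹ := by rw [h]; group
    _ = gHalfUnit N * omegaUnit N ^ (-(c * b)) * (gUnit N ^ (d + b) *
          (gUnit N ^ (-b) * hUnit N ^ c)) * (gHalfUnit N)⁻¹ := by rw [hc]; group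
    _ = _ := by rw [hc2, jUnit]; group

theorem jUnit_add_inv_mul (N : ℕ) (a b c d : ℤ) :
    (jUnit N (a + c) (b + d))⁻¹ * jUnit N a b = omegaUnit N ^ (a * d) * (jUnit N c d)⁻¹ := by
  have hz := omegaUnit_commute N
  have h := zpow_mul_zpow_of_central hz (hUnit_mul_gUnit N) (-a) (-d)
  rw [neg_mul_neg] at h
  have hc : gHalfUnit N * hUnit N ^ (-c) * omegaUnit N ^ (a * d) =
    omegaUnit N ^ (a * d) * (gHalfUnit N * hUnit N ^ (-c)) := (((hz _).zpow_left _).eq).symm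
  calc (jUnit N (a + c) (b + d))⁻¹ * jUnit N a b
      = gHalfUnit N * hUnit N ^ (-c) * (hUnit N ^ (-a) * gUnit N ^ (-d)) * hUnit N ^ a *
          (gHalfUnit N)⁻¹ := by simp only [jUnit, add_comm a c]; group
    _ = gHalfUnit N * hUnit N ^ (-c) * omegaUnit N ^ (a * d) * gUnit N ^ (-d) *
          (gHalfUnit N)⁻¹ := by rw [h]; group
    _ = _ := by rw [hc, jUnit]; group

theorem twist_eq (N : ℕ) : twist N = gHalfUnit N * hUnit N * gHalfUnit N := rfl

/-- Conjugation by `g^{1/2} h g^{1/2}` acts on the basis by a character. -/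
theorem twist_conj_jUnit (N : ℕ) (a b : ℤ) :
    twist N * jUnit N a b * (twist N)⁻¹ = omegaUnit N ^ (b - a) * jUnit N a b := by
  have hz := omegaUnit_commute N
  have h1 := zpow_mul_zpow_of_central hz (hUnit_mul_gUnit N) 1 (1 + b)
  have h2 := zpow_mul_zpow_of_central hz (hUnit_mul_gUnit N) (1 + a) (-1)
  have hc2 : gHalfUnit N * omegaUnit N ^ (b - a) =
    omegaUnit N ^ (b - a) * gHalfUnit N := (((hz _).zpow_left _).eq).symm
  have hc : gUnit N ^ (1 + b) * omegaUnit N ^ ((1 + a) * (-1)) =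
    omegaUnit N ^ ((1 + a) * (-1)) * gUnit N ^ (1 + b) := (((hz _).zpow_left _).eq).symm
  calc twist N * jUnit N a b * (twist N)⁻¹
      = gHalfUnit N * ((hUnit N ^ (1 : ℤ) * gUnit N ^ (1 + b)) * hUnit N ^ a * gUnit N ^ (-1 : ℤ)) *
          hUnit N ^ (-1 : ℤ) * (gHalfUnit N)⁻¹ := by
        have hg : gHalfUnit N * gHalfUnit N = gUnit N := rfl
        calc twist N * jUnit N a b * (twist N)⁻¹
            = gHalfUnit N * (hUnit N * (gHalfUnit N * gHalfUnit N) * gUnit N ^ b * hUnit N ^ a *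
              (gHalfUnit N * gHalfUnit N)⁻¹) * (hUnit N)⁻¹ * (gHalfUnit N)⁻¹ := by
              rw [twist_eq, jUnit]; group
          _ = _ := by rw [hg]; group
    _ = gHalfUnit N * (omegaUnit N ^ (1 * (1 + b)) * gUnit N ^ (1 + b) *
          (hUnit N ^ (1 + a) * gUnit N ^ (-1 : ℤ))) *
          hUnit N ^ (-1 : ℤ) * (gHalfUnit N)⁻¹ := by rw [h1]; group
    _ = gHalfUnit N * (omegaUnit N ^ (1 * (1 + b)) *
          (gUnit N ^ (1 + b) * omegaUnit N ^ ((1 + a) * (-1))) *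
          (gUnit N ^ (-1 : ℤ) * hUnit N ^ (1 + a))) *
          hUnit N ^ (-1 : ℤ) * (gHalfUnit N)⁻¹ := by rw [h2]; group
    _ = gHalfUnit N * omegaUnit N ^ (b - a) * gUnit N ^ b * hUnit N ^ a * (gHalfUnit N)⁻¹ := by
        rw [hc]; group
    _ = _ := by rw [hc2, jUnit]; group

/-! ### The R-matrix without its scalar prefactor -/

/-- The sum `∑ w_α(x) J_α ⊗ J_α⁻¹`, where `w_α(x) = W_α(x) / W_α(0)`. -/
def belavin (N : ℕ) (τ : ℂ) (θ : ℂ → ℂ) (η x : ℂ) : Matrix (Fin N × Fin N) (Fin N × Fin N) ℂ :=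
  ∑ α : Fin N × Fin N, wRatio N τ θ η α.1 α.2 x •
    ((jUnit N α.1 α.2).val ⊗ₖ (jUnit N α.1 α.2)⁻¹.val)

/-- The matrix `belavin` with its two tensor factors exchanged. -/
def belavinSwap (N : ℕ) (τ : ℂ) (θ : ℂ → ℂ) (η x : ℂ) :
    Matrix (Fin N × Fin N) (Fin N × Fin N) ℂ :=
  ∑ α : Fin N × Fin N, wRatio N τ θ η α.1 α.2 x •
    ((jUnit N α.1 α.2)⁻¹.val ⊗ₖ (jUnit N α.1 α.2).val)

theorem sum_sum_shift {M : Type*} [AddCommGroup M] {N : ℕ} (F : ℤ → ℤ → ℤ → ℤ → M)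
    (hF : ∀ a b, Periodic₂ N fun c d => F c d a b) :
    ∑ α : Fin N × Fin N, ∑ β : Fin N × Fin N, F α.1 α.2 β.1 β.2 =
      ∑ γ : Fin N × Fin N, ∑ β : Fin N × Fin N, F (β.1 + γ.1) (β.2 + γ.2) β.1 β.2 := by
  rw [Finset.sum_comm]
  conv_rhs => rw [Finset.sum_comm]
  refine Finset.sum_congr rfl fun β _ => ?_
  rw [← (hF β.1 β.2).sum_add β.1 β.2]
  exact Finset.sum_congr rfl fun γ _ => by rw [add_comm, add_comm (γ.2 : ℤ)]

/-- Only the zero characteristic contributes to a sum whose coefficients vanish elsewhere. -/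
theorem sum_eq_zero_term {M : Type*} [AddCommGroup M] [Module ℂ M] {N : ℕ} (hN : N ≠ 0)
    (v : ℤ → ℤ → ℂ) (V : ℤ → ℤ → M) (hv : ∀ c d : ℤ, ¬ ((N : ℤ) ∣ c ∧ (N : ℤ) ∣ d) → v c d = 0) :
    ∑ γ : Fin N × Fin N, v γ.1 γ.2 • V γ.1 γ.2 = v 0 0 • V 0 0 := by
  have hpos := Nat.pos_of_ne_zero hN
  rw [Finset.sum_eq_single (⟨0, hpos⟩, ⟨0, hpos⟩)]
  · simp
  · rintro ⟨c, d⟩ - hne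
    rw [hv, zero_smul]
    rintro ⟨hc, hd⟩
    refine hne (Prod.ext (Fin.ext ?_) (Fin.ext ?_))
    · exact Nat.eq_zero_of_dvd_of_lt (Int.natCast_dvd_natCast.1 hc) c.isLt
    · exact Nat.eq_zero_of_dvd_of_lt (Int.natCast_dvd_natCast.1 hd) d.isLt
  · simp

section

variable {N : ℕ} {τ : ℂ} {θ : ℂ → ℂ} {η : ℂ}

theorem jUnit_add_mul_inv_val (a b c d : ℤ) :
    (jUnit N (a + c) (b + d)).val * (jUnit N a b)⁻¹.val =
      em (2 * ((-(c * b) : ℤ) : ℂ) / N) • (jUnit N c d).val := by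
  rw [← Units.val_mul, jUnit_add_mul_inv, Units.val_mul, omegaUnit_zpow_val, Matrix.smul_mul,
    one_mul]

theorem jUnit_add_inv_mul_val (a b c d : ℤ) :
    (jUnit N (a + c) (b + d))⁻¹.val * (jUnit N a b).val =
      em (2 * ((a * d : ℤ) : ℂ) / N) • (jUnit N c d)⁻¹.val := by
  rw [← Units.val_mul, jUnit_add_inv_mul, Units.val_mul, omegaUnit_zpow_val, Matrix.smul_mul,
    one_mul]

theorem jUnit_inv_mul_add_val (a b c d : ℤ) :
    (jUnit N a b)⁻¹.val * (jUnit N (a + c) (b + d)).val =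
      em (2 * ((-(a * d) : ℤ) : ℂ) / N) • (jUnit N c d).val := by
  have h : (jUnit N a b)⁻¹ * jUnit N (a + c) (b + d) = omegaUnit N ^ (-(a * d)) * jUnit N c d := by
    rw [← inv_inj, mul_inv_rev, inv_inv, jUnit_add_inv_mul, mul_inv_rev, ← zpow_neg, neg_neg]
    exact ((omegaUnit_commute N _).zpow_left _).eq
  rw [← Units.val_mul, h, Units.val_mul, omegaUnit_zpow_val, Matrix.smul_mul, one_mul]

/-- Unitarity. The product is expanded in the basis `J_γ ⊗ J_γ⁻¹`, and its coefficients are the sums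
`wRatio_unitarity_off` and `wRatio_unitarity_diag`. -/
theorem belavin_mul_belavinSwap (hθ : IsOddTheta τ θ) (hτ : 0 < τ.im) (hN : N ≠ 0)
    (hη : θ (N * η) ≠ 0) (x : ℂ) :
    belavin N τ θ η x * belavinSwap N τ θ η (-x) =
      (N ^ 2 * (θ (N * η + x) * θ (N * η - x) / θ (N * η) ^ 2)) • 1 := by
  rw [belavin, belavinSwap, Finset.sum_mul]
  simp only [Finset.mul_sum, Matrix.smul_mul, Matrix.mul_smul, ← Matrix.mul_kronecker_mul]
  rw [sum_sum_shift (fun a b c d => wRatio N τ θ η c d (-x) • wRatio N τ θ η a b x •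
    (((jUnit N a b).val * (jUnit N c d)⁻¹.val) ⊗ₖ ((jUnit N a b)⁻¹.val * (jUnit N c d).val)))]
  swap
  · intro c d
    constructor
    · intro a b
      simp only [(wRatio_periodic hθ hN x).1, (jUnit_periodic N).1]
    · intro a b
      simp only [(wRatio_periodic hθ hN x).2, (jUnit_periodic N).2]
  set v : ℤ → ℤ → ℂ := fun c d => ∑ β : Fin N × Fin N,
    em (2 * (((β.1 : ℤ) * d - c * (β.2 : ℤ) : ℤ) : ℂ) / N) *
      (wRatio N τ θ η (β.1 + c) (β.2 + d) x * wRatio N τ θ η β.1 β.2 (-x)) with hv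
  have h1 : ∀ γ : Fin N × Fin N, ∑ β : Fin N × Fin N,
      wRatio N τ θ η β.1 β.2 (-x) • wRatio N τ θ η (β.1 + γ.1) (β.2 + γ.2) x •
        (((jUnit N (β.1 + γ.1) (β.2 + γ.2)).val * (jUnit N β.1 β.2)⁻¹.val) ⊗ₖ
          ((jUnit N (β.1 + γ.1) (β.2 + γ.2))⁻¹.val * (jUnit N β.1 β.2).val)) =
      v γ.1 γ.2 • ((jUnit N γ.1 γ.2).val ⊗ₖ (jUnit N γ.1 γ.2)⁻¹.val) := by
    intro γ
    rw [hv, Finset.sum_smul]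
    refine Finset.sum_congr rfl fun β _ => ?_
    rw [jUnit_add_mul_inv_val, jUnit_add_inv_mul_val, Matrix.smul_kronecker, Matrix.kronecker_smul]
    simp only [smul_smul]
    congr 1
    rw [show 2 * (((β.1 : ℤ) * (γ.2 : ℤ) - (γ.1 : ℤ) * (β.2 : ℤ) : ℤ) : ℂ) / N =
      2 * ((-((γ.1 : ℤ) * (β.2 : ℤ)) : ℤ) : ℂ) / N + 2 * (((β.1 : ℤ) * (γ.2 : ℤ) : ℤ) : ℂ) / N by
        push_cast; ring, em_add]
    ring
  simp only [h1]
  rw [sum_eq_zero_term hN v (fun c d => (jUnit N c d).val ⊗ₖ (jUnit N c d)⁻¹.val)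
    fun c d hcd => wRatio_unitarity_off hθ hτ hN hη hcd x, jUnit_zero, inv_one, Units.val_one,
    Matrix.one_kronecker_one, ← wRatio_unitarity_diag hθ hτ hN hη x]
  simp [hv]

theorem belavinSwap_mul_belavin (hθ : IsOddTheta τ θ) (hτ : 0 < τ.im) (hN : N ≠ 0)
    (hη : θ (N * η) ≠ 0) {x : ℂ} (h1 : θ (N * η + x) ≠ 0) (h2 : θ (N * η - x) ≠ 0) :
    belavinSwap N τ θ η (-x) * belavin N τ θ η x =
      (N ^ 2 * (θ (N * η + x) * θ (N * η - x) / θ (N * η) ^ 2)) • 1 := by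
  have h := belavin_mul_belavinSwap hθ hτ hN hη x
  set u : ℂ := N ^ 2 * (θ (N * η + x) * θ (N * η - x) / θ (N * η) ^ 2) with hu
  have hu0 : u ≠ 0 := by
    have hN' : (N : ℂ) ≠ 0 := by exact_mod_cast hN
    positivity
  have h3 : belavin N τ θ η x * (u⁻¹ • belavinSwap N τ θ η (-x)) = 1 := by
    rw [Matrix.mul_smul, h, smul_smul, inv_mul_cancel₀ hu0, one_smul]
  have h4 := mul_eq_one_comm.1 h3
  rw [Matrix.smul_mul] at h4
  rw [← h4, smul_smul, mul_inv_cancel₀ hu0, one_smul]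

/-- Quasi-periodicity: translation by `τ + 1` amounts to conjugation of the first tensor factor. -/
theorem belavin_add_tau_add_one (hθ : IsOddTheta τ θ) (x : ℂ) :
    ((twist N).val ⊗ₖ (1 : Matrix (Fin N) (Fin N) ℂ)) * belavin N τ θ η (x + τ + 1) *
      ((twist N)⁻¹.val ⊗ₖ (1 : Matrix (Fin N) (Fin N) ℂ)) =
      em (-τ - 2 * η - 2 * x) • belavin N τ θ η x := by
  rw [belavin, belavin, Finset.mul_sum, Finset.sum_mul, Finset.smul_sum]
  refine Finset.sum_congr rfl fun α _ => ?_
  have h := congrArg Units.val (twist_conj_jUnit N α.1 α.2)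
  rw [Units.val_mul, Units.val_mul, Units.val_mul, omegaUnit_zpow_val, Matrix.smul_mul,
    one_mul] at h
  rw [Matrix.mul_smul, Matrix.smul_mul, ← Matrix.mul_kronecker_mul, ← Matrix.mul_kronecker_mul,
    one_mul, mul_one, h, Matrix.smul_kronecker, smul_smul, smul_smul,
    (wRatio_quasiPeriodic hθ _ _).add_one, (wRatio_quasiPeriodic hθ _ _).add_tau]
  congr 1
  have e : em (2 * ((α.1 : ℤ) : ℂ) / N) * em (-τ - 2 * η - 2 * ((α.2 : ℤ) : ℂ) / N) *
      em (-(2 * ((1 : ℤ) : ℂ) * x)) * em (2 * (((α.2 : ℤ) - (α.1 : ℤ) : ℤ) : ℂ) / N) =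
      em (-τ - 2 * η - 2 * x) := by
    rw [← em_add, ← em_add, ← em_add]; congr 1; push_cast; ring
  rw [← e]; ring

/-- Crossing, written in terms of matrix entries (the partial transposition in the first factor
becomes the pattern of the summation indices). -/
theorem belavin_crossing (hθ : IsOddTheta τ θ) (hτ : 0 < τ.im) (hN : N ≠ 0)
    (hη : θ (N * η) ≠ 0) (x : ℂ) (i k l m : Fin N) :
    ∑ p, ∑ r, belavin N τ θ η (x - N * (N * η)) (p, i) (l, r) *
      belavinSwap N τ θ η (-x) (m, r) (p, k) =
      -(N ^ 2 * (θ x * θ (x - N * (N * η)) / θ (N * η) ^ 2)) *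
        ((1 : Matrix (Fin N) (Fin N) ℂ) m l * (1 : Matrix (Fin N) (Fin N) ℂ) i k) := by
  set X : ℂ := N * (N * η) with hX
  have h0 : ∀ (α β : Fin N × Fin N),
      ∑ p, ∑ r, (wRatio N τ θ η α.1 α.2 (x - X) * ((jUnit N α.1 α.2).val p l *
        (jUnit N α.1 α.2)⁻¹.val i r)) * (wRatio N τ θ η β.1 β.2 (-x) *
        ((jUnit N β.1 β.2)⁻¹.val m p * (jUnit N β.1 β.2).val r k)) =
      wRatio N τ θ η α.1 α.2 (x - X) * wRatio N τ θ η β.1 β.2 (-x) *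
        (((jUnit N β.1 β.2)⁻¹.val * (jUnit N α.1 α.2).val) m l *
          ((jUnit N α.1 α.2)⁻¹.val * (jUnit N β.1 β.2).val) i k) := by
    intro α β
    rw [Matrix.mul_apply, Matrix.mul_apply, Finset.sum_mul_sum, Finset.mul_sum]
    refine Finset.sum_congr rfl fun p _ => ?_
    rw [Finset.mul_sum]
    exact Finset.sum_congr rfl fun r _ => by ring
  have h1 : ∑ p, ∑ r, belavin N τ θ η (x - X) (p, i) (l, r) *
      belavinSwap N τ θ η (-x) (m, r) (p, k) =
      ∑ α : Fin N × Fin N, ∑ β : Fin N × Fin N,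
        wRatio N τ θ η α.1 α.2 (x - X) * wRatio N τ θ η β.1 β.2 (-x) *
        (((jUnit N β.1 β.2)⁻¹.val * (jUnit N α.1 α.2).val) m l *
          ((jUnit N α.1 α.2)⁻¹.val * (jUnit N β.1 β.2).val) i k) := by
    simp only [← h0]
    simp only [belavin, belavinSwap, Matrix.sum_apply, Matrix.smul_apply, Matrix.kronecker_apply,
      smul_eq_mul, Finset.sum_mul_sum]
    calc _ = ∑ p, ∑ α, ∑ r, ∑ β, _ := Finset.sum_congr rfl fun p _ => Finset.sum_comm
      _ = ∑ α, ∑ p, ∑ r, ∑ β, _ := Finset.sum_comm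
      _ = _ := Finset.sum_congr rfl fun α _ => ?_
    calc _ = ∑ p, ∑ β, ∑ r, _ := Finset.sum_congr rfl fun p _ => Finset.sum_comm
      _ = _ := Finset.sum_comm
  rw [h1, sum_sum_shift (fun a b c d => wRatio N τ θ η a b (x - X) * wRatio N τ θ η c d (-x) *
    (((jUnit N c d)⁻¹.val * (jUnit N a b).val) m l *
      ((jUnit N a b)⁻¹.val * (jUnit N c d).val) i k))]
  swap
  · intro c d
    constructor
    · intro a b
      simp only [(wRatio_periodic hθ hN (x - X)).1, (jUnit_periodic N).1]
    · intro a b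
      simp only [(wRatio_periodic hθ hN (x - X)).2, (jUnit_periodic N).2]
  set v : ℤ → ℤ → ℂ := fun c d => ∑ β : Fin N × Fin N,
    wRatio N τ θ η (β.1 + c) (β.2 + d) (x - X) * wRatio N τ θ η β.1 β.2 (-x) with hv
  have h2 : ∀ γ : Fin N × Fin N, ∑ β : Fin N × Fin N,
      wRatio N τ θ η (β.1 + γ.1) (β.2 + γ.2) (x - X) * wRatio N τ θ η β.1 β.2 (-x) *
        (((jUnit N β.1 β.2)⁻¹.val * (jUnit N (β.1 + γ.1) (β.2 + γ.2)).val) m l *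
          ((jUnit N (β.1 + γ.1) (β.2 + γ.2))⁻¹.val * (jUnit N β.1 β.2).val) i k) =
      v γ.1 γ.2 • ((jUnit N γ.1 γ.2).val m l * (jUnit N γ.1 γ.2)⁻¹.val i k) := by
    intro γ
    rw [hv, Finset.sum_smul]
    refine Finset.sum_congr rfl fun β _ => ?_
    rw [jUnit_inv_mul_add_val, jUnit_add_inv_mul_val]
    simp only [Matrix.smul_apply, smul_eq_mul]
    have e : em (2 * ((-((β.1 : ℤ) * (γ.2 : ℤ)) : ℤ) : ℂ) / N) *
        em (2 * (((β.1 : ℤ) * (γ.2 : ℤ) : ℤ) : ℂ) / N) = 1 := by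
      rw [← em_add, ← em_zero]; congr 1; push_cast; ring
    linear_combination wRatio N τ θ η (β.1 + γ.1) (β.2 + γ.2) (x - X) *
      wRatio N τ θ η β.1 β.2 (-x) * (jUnit N γ.1 γ.2).val m l * (jUnit N γ.1 γ.2)⁻¹.val i k * e
  simp only [h2]
  rw [sum_eq_zero_term hN v (fun c d => (jUnit N c d).val m l * (jUnit N c d)⁻¹.val i k)
    fun c d hcd => wRatio_crossing_off hθ hτ hN hη hcd x, jUnit_zero, inv_one, Units.val_one,
    smul_eq_mul, ← wRatio_crossing_diag hθ hτ hN hη x]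
  simp [hv, hX]

end

/-! ### The normalized R-matrix -/

theorem wFun_eq {N : ℕ} (hN : N ≠ 0) (α : Fin N × Fin N) (ξ ζ τ : ℂ) :
    wFun N α ξ ζ τ = wRatio N τ (oddTheta τ) (ζ / N) α.1 α.2 ξ / N := by
  have hN' : (N : ℂ) ≠ 0 := by exact_mod_cast hN
  have key : ∀ x : ℂ, theta (1 / 2 + (α.1 : ℕ) / (N : ℂ)) (1 / 2 + (α.2 : ℕ) / (N : ℂ)) x τ =
      em (((α.1 : ℕ) / N : ℂ) ^ 2 * τ + (α.1 : ℕ) / N + 2 * ((α.1 : ℕ) / N) * ((α.2 : ℕ) / N)) *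
      (em (2 * (α.1 : ℕ) * x / N) * oddTheta τ (x + ((α.1 : ℕ) * τ + (α.2 : ℕ)) / N)) := by
    intro x
    rw [oddTheta, theta_eq_jacobiTheta₂, theta_eq_jacobiTheta₂, ← mul_assoc, ← mul_assoc, ← em_add,
      ← em_add]
    congr 2
    · ring
    · ring
  have hz := em_ne_zero (((α.1 : ℕ) / N : ℂ) ^ 2 * τ + (α.1 : ℕ) / N +
    2 * ((α.1 : ℕ) / N) * ((α.2 : ℕ) / N))
  have e : em (2 * ((α.1 : ℕ) : ℂ) * (ξ + ζ / N) / N) =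
      em (2 * ((α.1 : ℕ) : ℂ) * ξ / N) * em (2 * ((α.1 : ℕ) : ℂ) * (ζ / N) / N) := by
    rw [← em_add]; congr 1; ring
  have hz2 := em_ne_zero (2 * ((α.1 : ℕ) : ℂ) * (ζ / N) / N)
  rw [wFun, key, key, wRatio, e]
  push_cast
  rw [mul_left_comm (N : ℂ), mul_div_mul_left _ _ hz, mul_left_comm (N : ℂ),
    mul_comm (em (2 * ((α.1 : ℕ) : ℂ) * ξ / N)), mul_assoc, mul_div_mul_left _ _ hz2,
    div_div, mul_comm (N : ℂ)]

/-- The scalar function multiplying `belavin` in `rHat`. -/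
def rScalar (N : ℕ) (ζ τ ξ : ℂ) : ℂ :=
  tauFun N ζ (ζ / 2 - ξ) * (em ((2 / (N : ℂ) - 2) * ξ) *
    invKappa N (em ζ) (em (2 * τ)) (em ξ ^ 2) * (oddTheta τ ζ / oddTheta τ (ξ + ζ))) / N

theorem iMat_eq (N : ℕ) (α : Fin N × Fin N) :
    iMat N α = (gUnit N ^ (α.2 : ℤ) * hUnit N ^ (α.1 : ℤ)).val := by
  rw [iMat, Units.val_mul, zpow_natCast, zpow_natCast, Units.val_pow_eq_pow_val,
    Units.val_pow_eq_pow_val, gUnit_val]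
  rfl

theorem rHat_eq {N : ℕ} (hN : N ≠ 0) (ζ τ ξ : ℂ) :
    rHat N ζ τ ξ = rScalar N ζ τ ξ • belavin N τ (oddTheta τ) (ζ / N) ξ := by
  have hG : gHalf N = (gHalfUnit N).val := rfl
  have hG' : (gHalf N)⁻¹ = (gHalfUnit N)⁻¹.val := rfl
  have hI : ∀ α, (iMat N α)⁻¹ = (gUnit N ^ (α.2 : ℤ) * hUnit N ^ (α.1 : ℤ))⁻¹.val := fun α => by
    rw [iMat_eq, Matrix.coe_units_inv]
  rw [rHat, rMat, rTilde, belavin, Matrix.mul_smul, Matrix.smul_mul, smul_smul, Finset.mul_sum,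
    Finset.sum_mul, Finset.smul_sum, Finset.smul_sum]
  refine Finset.sum_congr rfl fun α _ => ?_
  rw [Matrix.mul_smul, Matrix.smul_mul, ← Matrix.mul_kronecker_mul, ← Matrix.mul_kronecker_mul, hG',
    hG, hI, iMat_eq, ← Units.val_mul, ← Units.val_mul, ← Units.val_mul, ← Units.val_mul, smul_smul,
    smul_smul, wFun_eq hN, rScalar]
  congr 1
  · simp only [oddTheta]; ring
  · rw [jUnit]
    congr 2
    group

/-! ### The scalar factors -/

/-- `(e^{2πiu}; e^{2πiτ})_∞`. -/
def pochAdd (τ u : ℂ) : ℂ := poch (em (2 * u)) (em (2 * τ))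

/-- `(e^{2πiu}; e^{2πiτ}, e^{2πiσ})_∞`. -/
def pochAdd₂ (τ σ u : ℂ) : ℂ := poch₂ (em (2 * u)) (em (2 * τ)) (em (2 * σ))

section

variable {τ σ ζ x : ℂ} {N : ℕ}

theorem pochAdd_eq (hτ : 0 < τ.im) {u v : ℂ} (h : v = u + τ) :
    pochAdd τ u = (1 - em (2 * u)) * pochAdd τ v := by
  rw [pochAdd, poch_eq (norm_em_two_lt_one hτ), ← em_add, h, pochAdd, mul_add]

theorem pochAdd₂_eq_left (hτ : 0 < τ.im) (hσ : 0 < σ.im) {u v : ℂ} (h : v = u + τ) :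
    pochAdd₂ τ σ u = pochAdd σ u * pochAdd₂ τ σ v := by
  rw [pochAdd₂, poch₂_eq_left (norm_em_two_lt_one hτ) (norm_em_two_lt_one hσ), ← em_add, h,
    pochAdd₂, pochAdd, mul_add]

theorem pochAdd₂_eq_right (hτ : 0 < τ.im) (hσ : 0 < σ.im) {u v : ℂ} (h : v = u + σ) :
    pochAdd₂ τ σ u = pochAdd τ u * pochAdd₂ τ σ v := by
  rw [pochAdd₂, poch₂_eq_right (norm_em_two_lt_one hτ) (norm_em_two_lt_one hσ), ← em_add, h,
    pochAdd₂, pochAdd, mul_add]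

theorem em_two_mul_eq_one {u : ℂ} (h : em (2 * u) = 1) : ∃ k : ℤ, u = k := by
  obtain ⟨k, hk⟩ := (em_eq_one_iff _).1 h
  exact ⟨k, mul_left_cancel₀ two_ne_zero hk⟩

theorem pochAdd_ne_zero (hτ : 0 < τ.im) {u : ℂ} (h : ∀ (k : ℤ) (n : ℕ), u + n * τ ≠ k) :
    pochAdd τ u ≠ 0 := by
  refine poch_ne_zero (norm_em_two_lt_one hτ) fun n hn => ?_
  rw [em_pow, ← em_add, show 2 * u + n * (2 * τ) = 2 * (u + n * τ) by ring] at hn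
  obtain ⟨k, hk⟩ := em_two_mul_eq_one hn
  exact h k n hk

theorem pochAdd₂_ne_zero (hτ : 0 < τ.im) (hσ : 0 < σ.im) {u : ℂ}
    (h : ∀ (k : ℤ) (m n : ℕ), u + m * τ + n * σ ≠ k) : pochAdd₂ τ σ u ≠ 0 := by
  refine poch₂_ne_zero (norm_em_two_lt_one hτ) (norm_em_two_lt_one hσ) fun m n hn => ?_
  rw [em_pow, em_pow, ← em_add, ← em_add,
    show 2 * u + m * (2 * τ) + n * (2 * σ) = 2 * (u + m * τ + n * σ) by ring] at hn
  obtain ⟨k, hk⟩ := em_two_mul_eq_one hn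
  exact h k m n hk

/-- `invKappa` in additive notation, with `σ = N ζ`. -/
def kappaAdd (τ σ ζ ξ : ℂ) : ℂ :=
  (pochAdd₂ τ σ (σ - ξ) * pochAdd₂ τ σ (ζ + ξ) * pochAdd₂ τ σ (τ - ξ) *
    pochAdd₂ τ σ (τ + σ - ζ + ξ)) /
  (pochAdd₂ τ σ (σ + ξ) * pochAdd₂ τ σ (ζ - ξ) * pochAdd₂ τ σ (τ + ξ) *
    pochAdd₂ τ σ (τ + σ - ζ - ξ))

theorem invKappa_eq (hN : N ≠ 0) (ξ : ℂ) :
    invKappa N (em ζ) (em (2 * τ)) (em ξ ^ 2) = kappaAdd τ (N * ζ) ζ ξ := by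
  obtain ⟨n, rfl⟩ := Nat.exists_eq_succ_of_ne_zero hN
  have e1 : em ζ ^ (2 * (n + 1)) = em (2 * ((n + 1 : ℕ) * ζ)) := by
    rw [em_pow]; congr 1; push_cast; ring
  have e2 : em ζ ^ (2 * (n + 1) - 2) = em (2 * ((n + 1 : ℕ) * ζ) - 2 * ζ) := by
    rw [show 2 * (n + 1) - 2 = 2 * n by omega, em_pow]; congr 1; push_cast; ring
  have e3 : em ξ ^ 2 = em (2 * ξ) := by rw [em_pow]; norm_num
  have e4 : em ζ ^ 2 = em (2 * ζ) := by rw [em_pow]; norm_num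
  rw [invKappa, e1, e2, e3, e4, kappaAdd]
  simp only [pochAdd₂, ← em_neg, ← em_add]
  congr 1
  · congr 1
    · congr 1
      · congr 1
        · congr 2; ring
        · congr 2; ring
      · congr 2; ring
    · congr 2; ring
  · congr 1
    · congr 1
      · congr 1
        · congr 2; ring
        · congr 2; ring
      · congr 2; ring
    · congr 2; ring

/-- Genericity with respect to the lattice `ℤ + ℤ ζ + ℤ τ`. -/
def OffLattice (ζ τ x : ℂ) : Prop := ∀ k l m : ℤ, x ≠ k + l * ζ + m * τ

theorem OffLattice.mul_add_ne (hx : OffLattice ζ τ x) {u : ℂ} (l m : ℤ)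
    (h : u = x + l * ζ + m * τ ∨ u = -x + l * ζ + m * τ) (k : ℤ) (l' m' : ℤ) :
    u + l' * ζ + m' * τ ≠ k := by
  intro h'
  rcases h with rfl | rfl
  · exact hx k (-l - l') (-m - m') (by push_cast; linear_combination h')
  · exact hx (-k) (l + l') (m + m') (by push_cast; linear_combination -h')

theorem OffLattice.pochAdd₂_ne_zero (hx : OffLattice ζ τ x) (hτ : 0 < τ.im)
    (hζ : 0 < ζ.im) (hN : N ≠ 0) {u : ℂ} (l m : ℤ)
    (h : u = x + l * ζ + m * τ ∨ u = -x + l * ζ + m * τ) : pochAdd₂ τ (N * ζ) u ≠ 0 := by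
  have hσ : 0 < ((N : ℂ) * ζ).im := by
    have : (0 : ℝ) < N := by exact_mod_cast Nat.pos_of_ne_zero hN
    simpa using mul_pos this hζ
  refine EllipticAlgebra.pochAdd₂_ne_zero hτ hσ fun k m' n' h' => ?_
  refine hx.mul_add_ne l m h k (n' * N) m' ?_
  push_cast
  linear_combination h'

theorem OffLattice.pochAdd_ne_zero (hx : OffLattice ζ τ x) (hτ : 0 < τ.im) {u : ℂ} (l m : ℤ)
    (h : u = x + l * ζ + m * τ ∨ u = -x + l * ζ + m * τ) : pochAdd τ u ≠ 0 := by
  refine EllipticAlgebra.pochAdd_ne_zero hτ fun k n h' => ?_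
  refine hx.mul_add_ne l m h k 0 n ?_
  push_cast
  linear_combination h'

theorem OffLattice.pochAdd_ne_zero' (hx : OffLattice ζ τ x) (hζ : 0 < ζ.im) (hN : N ≠ 0) {u : ℂ}
    (l m : ℤ) (h : u = x + l * ζ + m * τ ∨ u = -x + l * ζ + m * τ) : pochAdd (N * ζ) u ≠ 0 := by
  have hσ : 0 < ((N : ℂ) * ζ).im := by
    have : (0 : ℝ) < N := by exact_mod_cast Nat.pos_of_ne_zero hN
    simpa using mul_pos this hζ
  refine EllipticAlgebra.pochAdd_ne_zero hσ fun k n h' => ?_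
  refine hx.mul_add_ne l m h k (n * N) 0 ?_
  push_cast
  linear_combination h'

theorem OffLattice.add (hx : OffLattice ζ τ x) (k l m : ℤ) :
    OffLattice ζ τ (x + k + l * ζ + m * τ) := by
  intro k' l' m' h
  exact hx (k' - k) (l' - l) (m' - m) (by push_cast; linear_combination h)

theorem OffLattice.of_star (hx : OffLattice ζ τ x) : OffLattice ζ (τ + N * ζ) x := by
  intro k l m h
  exact hx k (l + m * N) m (by push_cast; linear_combination h)

theorem OffLattice.kappaAdd_ne_zero (hx : OffLattice ζ τ x) (hτ : 0 < τ.im) (hζ : 0 < ζ.im)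
    (hN : N ≠ 0) : kappaAdd τ (N * ζ) ζ x ≠ 0 := by
  have h := @OffLattice.pochAdd₂_ne_zero τ ζ x N hx hτ hζ hN
  rw [kappaAdd]
  refine div_ne_zero (mul_ne_zero (mul_ne_zero (mul_ne_zero ?_ ?_) ?_) ?_)
    (mul_ne_zero (mul_ne_zero (mul_ne_zero ?_ ?_) ?_) ?_)
  · exact h N 0 (Or.inr (by push_cast; ring))
  · exact h 1 0 (Or.inl (by push_cast; ring))
  · exact h 0 1 (Or.inr (by push_cast; ring))
  · exact h (N - 1) 1 (Or.inl (by push_cast; ring))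
  · exact h N 0 (Or.inl (by push_cast; ring))
  · exact h 1 0 (Or.inr (by push_cast; ring))
  · exact h 0 1 (Or.inl (by push_cast; ring))
  · exact h (N - 1) 1 (Or.inr (by push_cast; ring))

/-- The part of the scalar identity that involves the shifted elliptic nome `p* = p q^{2N}`. The
arguments of the double products on the two sides differ by `τ + σ`, so that their ratios are simple
products of base `σ`. -/
theorem kappaAdd_star (hx : OffLattice ζ τ x) (hτ : 0 < τ.im) (hζ : 0 < ζ.im) (hN : N ≠ 0) {σ : ℂ}
    (hσ : σ = N * ζ) :
    kappaAdd (τ + σ) σ ζ (x + τ) * (pochAdd σ (ζ + x - σ) * pochAdd σ (τ + σ - ζ + x) *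
      pochAdd σ (ζ - x - τ) * pochAdd σ (2 * σ - ζ - x)) =
    kappaAdd (τ + σ) σ ζ (x - σ) * (pochAdd σ (σ - x - τ) * pochAdd σ (σ - x) * pochAdd σ x *
      pochAdd σ (x + τ)) := by
  have hσi : 0 < σ.im := by
    have : (0 : ℝ) < N := by exact_mod_cast Nat.pos_of_ne_zero hN
    rw [hσ]; simpa using mul_pos this hζ
  have hτi : 0 < (τ + σ).im := by simpa using add_pos hτ hσi
  have H := @pochAdd₂_eq_left (τ + σ) σ hτi hσi
  have h1 := H (u := x) (v := σ + (x + τ)) (by ring)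
  have h2 := H (u := x + τ) (v := τ + σ + (x + τ)) (by ring)
  have h3 := H (u := σ - x - τ) (v := 2 * σ - x) (by ring)
  have h4 := H (u := σ - x) (v := τ + 2 * σ - x) (by ring)
  have h5 := H (u := ζ + x - σ) (v := ζ + (x + τ)) (by ring)
  have h6 := H (u := τ + σ - ζ + x) (v := τ + σ + σ - ζ + (x + τ)) (by ring)
  have h7 := H (u := ζ - x - τ) (v := ζ - (x - σ)) (by ring)
  have h8 := H (u := 2 * σ - ζ - x) (v := τ + σ + σ - ζ - (x - σ)) (by ring)
  have n := @OffLattice.pochAdd₂_ne_zero (τ + σ) ζ x N (hσ ▸ hx.of_star) hτi hζ hN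
  rw [← hσ] at n
  have n1 : pochAdd₂ (τ + σ) σ (σ + (x + τ)) ≠ 0 := n 0 1 (Or.inl (by push_cast; ring))
  have n2 : pochAdd₂ (τ + σ) σ (τ + σ + (x + τ)) ≠ 0 :=
    n (-N) 2 (Or.inl (by rw [hσ]; push_cast; ring))
  have n3 : pochAdd₂ (τ + σ) σ x ≠ 0 := n 0 0 (Or.inl (by push_cast; ring))
  have n4 : pochAdd₂ (τ + σ) σ (x + τ) ≠ 0 := n (-N) 1 (Or.inl (by rw [hσ]; push_cast; ring))
  have n5 : pochAdd₂ (τ + σ) σ (ζ - x - τ) ≠ 0 :=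
    n (N + 1) (-1) (Or.inr (by rw [hσ]; push_cast; ring))
  have n6 : pochAdd₂ (τ + σ) σ (2 * σ - ζ - x) ≠ 0 :=
    n (2 * N - 1) 0 (Or.inr (by rw [hσ]; push_cast; ring))
  have n7 : pochAdd₂ (τ + σ) σ (ζ - (x - σ)) ≠ 0 :=
    n (N + 1) 0 (Or.inr (by rw [hσ]; push_cast; ring))
  have n8 : pochAdd₂ (τ + σ) σ (τ + σ + σ - ζ - (x - σ)) ≠ 0 :=
    n (2 * N - 1) 1 (Or.inr (by rw [hσ]; push_cast; ring))
  rw [kappaAdd, kappaAdd, show σ - (x + τ) = σ - x - τ by ring,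
    show τ + σ - (x + τ) = σ - x by ring, show ζ - (x + τ) = ζ - x - τ by ring,
    show τ + σ + σ - ζ - (x + τ) = 2 * σ - ζ - x by ring,
    show σ - (x - σ) = 2 * σ - x by ring, show ζ + (x - σ) = ζ + x - σ by ring,
    show τ + σ - (x - σ) = τ + 2 * σ - x by ring,
    show τ + σ + σ - ζ + (x - σ) = τ + σ - ζ + x by ring, show σ + (x - σ) = x by ring,
    show τ + σ + (x - σ) = x + τ by ring]
  rw [div_mul_eq_mul_div, div_mul_eq_mul_div, div_eq_div_iff
    (mul_ne_zero (mul_ne_zero (mul_ne_zero n1 n5) n2) n6)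
    (mul_ne_zero (mul_ne_zero (mul_ne_zero n3 n7) n4) n8)]
  rw [h1, h2, h3, h4, h5, h6, h7, h8]
  ring

/-- The part of the scalar identity that involves the elliptic nome `p`. The arguments of the double
products on the two sides differ by `τ + σ`, or by `2 τ` or `2 σ`, so that their ratios are products
of two simple products, each of base `τ` or `σ`. -/
theorem kappaAdd_shift (hx : OffLattice ζ τ x) (hτ : 0 < τ.im) (hζ : 0 < ζ.im) (hN : N ≠ 0) {σ : ℂ}
    (hσ : σ = N * ζ) :
    kappaAdd τ σ ζ (x - σ) * (pochAdd σ (σ - x - τ) * pochAdd σ (σ - x) * pochAdd σ x *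
      pochAdd σ (x + τ)) * (pochAdd τ (x + τ - σ) * pochAdd τ (x + τ) * pochAdd τ (-x) *
      pochAdd τ (σ - x)) =
    kappaAdd τ σ ζ (x + τ) * (pochAdd σ (ζ + x - σ) * pochAdd σ (τ + σ - ζ + x) *
      pochAdd σ (ζ - x - τ) * pochAdd σ (2 * σ - ζ - x)) * (pochAdd τ (ζ + τ + x - σ) *
      pochAdd τ (τ + x - ζ) * pochAdd τ (ζ - x) * pochAdd τ (σ - ζ - x)) := by
  have hσi : 0 < σ.im := by
    have : (0 : ℝ) < N := by exact_mod_cast Nat.pos_of_ne_zero hN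
    rw [hσ]; simpa using mul_pos this hζ
  have H := @pochAdd₂_eq_left τ σ hτ hσi
  have H' := @pochAdd₂_eq_right τ σ hτ hσi
  have h1 := (H' (u := x + τ - σ) (v := x + τ) (by ring)).trans
    (congrArg _ (H' (v := σ + (x + τ)) (by ring)))
  have h2 := (H (u := x) (v := x + τ) (by ring)).trans (congrArg _ (H (v := τ + (x + τ)) (by ring)))
  have h3 := (H' (u := -x) (v := σ - x) (by ring)).trans
    (congrArg _ (H' (v := 2 * σ - x) (by ring)))
  have h4 := (H (u := σ - x - τ) (v := σ - x) (by ring)).trans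
    (congrArg _ (H (v := τ + σ - x) (by ring)))
  have h5 := (H (u := ζ + x - σ) (v := ζ + τ + x - σ) (by ring)).trans
    (congrArg _ (H' (v := ζ + (x + τ)) (by ring)))
  have h6 := (H' (u := τ + x - ζ) (v := τ + σ - ζ + x) (by ring)).trans
    (congrArg _ (H (v := τ + σ - ζ + (x + τ)) (by ring)))
  have h7 := (H (u := ζ - x - τ) (v := ζ - x) (by ring)).trans
    (congrArg _ (H' (v := ζ - (x - σ)) (by ring)))
  have h8 := (H' (u := σ - ζ - x) (v := 2 * σ - ζ - x) (by ring)).trans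
    (congrArg _ (H (v := τ + σ - ζ - (x - σ)) (by ring)))
  have n := @OffLattice.pochAdd₂_ne_zero τ ζ x N hx hτ hζ hN
  rw [← hσ] at n
  have n1 : pochAdd₂ τ σ x ≠ 0 := n 0 0 (Or.inl (by push_cast; ring))
  have n2 : pochAdd₂ τ σ (ζ - (x - σ)) ≠ 0 := n (N + 1) 0 (Or.inr (by rw [hσ]; push_cast; ring))
  have n3 : pochAdd₂ τ σ (x + τ - σ) ≠ 0 := n (-N) 1 (Or.inl (by rw [hσ]; push_cast; ring))
  have n4 : pochAdd₂ τ σ (τ + σ - ζ - (x - σ)) ≠ 0 :=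
    n (2 * N - 1) 1 (Or.inr (by rw [hσ]; push_cast; ring))
  have n5 : pochAdd₂ τ σ (σ + (x + τ)) ≠ 0 := n N 1 (Or.inl (by rw [hσ]; push_cast; ring))
  have n6 : pochAdd₂ τ σ (ζ - x - τ) ≠ 0 := n 1 (-1) (Or.inr (by push_cast; ring))
  have n7 : pochAdd₂ τ σ (τ + (x + τ)) ≠ 0 := n 0 2 (Or.inl (by push_cast; ring))
  have n8 : pochAdd₂ τ σ (σ - ζ - x) ≠ 0 := n (N - 1) 0 (Or.inr (by rw [hσ]; push_cast; ring))
  rw [kappaAdd, kappaAdd, show σ - (x - σ) = 2 * σ - x by ring,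
    show ζ + (x - σ) = ζ + x - σ by ring, show τ - (x - σ) = τ + σ - x by ring,
    show τ + σ - ζ + (x - σ) = τ + x - ζ by ring, show σ + (x - σ) = x by ring,
    show τ + (x - σ) = x + τ - σ by ring, show σ - (x + τ) = σ - x - τ by ring,
    show τ - (x + τ) = -x by ring, show ζ - (x + τ) = ζ - x - τ by ring,
    show τ + σ - ζ - (x + τ) = σ - ζ - x by ring]
  rw [div_mul_eq_mul_div, div_mul_eq_mul_div, div_mul_eq_mul_div, div_mul_eq_mul_div, div_eq_div_iff
    (mul_ne_zero (mul_ne_zero (mul_ne_zero n1 n2) n3) n4)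
    (mul_ne_zero (mul_ne_zero (mul_ne_zero n5 n6) n7) n8)]
  rw [h1, h2, h3, h4, h5, h6, h7, h8]
  ring

end

/-! ### The scalar identity -/

section

variable {τ σ ζ x : ℂ} {N : ℕ}

/-- The factor `1 - e^{2πiz}` of the product is moved from its first half to its second half. -/
theorem thetaProd_eq_neg (hτ : 0 < τ.im) (z : ℂ) :
    thetaProd τ z = -em z * (pochAdd τ (z + τ) * pochAdd τ (-z)) := by
  have h1 := pochAdd_eq hτ (u := z) (v := z + τ) rfl
  have h2 := pochAdd_eq hτ (u := -z) (v := τ - z) (by ring)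
  have e : em (2 * τ) * em (-(2 * z)) = em (2 * (τ - z)) := by rw [← em_add]; congr 1; ring
  have h3 : em (-z) * em (2 * z) = em z := by rw [← em_add]; congr 1; ring
  have h4 : em z * em (2 * -z) = em (-z) := by rw [← em_add]; congr 1; ring
  rw [thetaProd, e]
  change em (-z) * (pochAdd τ z * pochAdd τ (τ - z)) = _
  rw [h1, h2]
  linear_combination (pochAdd τ (z + τ) * pochAdd τ (τ - z)) * (-h3 - h4)

theorem oddTheta_mul_oddTheta_eq (hτ : 0 < τ.im) (x σ ζ : ℂ) :
    oddTheta τ x * oddTheta τ (x - σ) * (pochAdd τ (ζ + τ + x - σ) * pochAdd τ (τ + x - ζ) *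
      pochAdd τ (ζ - x) * pochAdd τ (σ - ζ - x)) =
    oddTheta τ (x - ζ) * oddTheta τ (x - σ + ζ) * (pochAdd τ (x + τ - σ) * pochAdd τ (x + τ) *
      pochAdd τ (-x) * pochAdd τ (σ - x)) := by
  obtain ⟨C, -, hC⟩ := exists_oddTheta_eq_thetaProd hτ
  have e : em x * em (x - σ) = em (x - ζ) * em (x - σ + ζ) := by
    rw [← em_add, ← em_add]; congr 1; ring
  simp only [hC, thetaProd_eq_neg hτ]
  rw [show x - σ + τ = x + τ - σ by ring, show -(x - σ) = σ - x by ring,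
    show x - ζ + τ = τ + x - ζ by ring, show -(x - ζ) = ζ - x by ring,
    show x - σ + ζ + τ = ζ + τ + x - σ by ring, show -(x - σ + ζ) = σ - ζ - x by ring]
  linear_combination (C ^ 2 * (pochAdd τ (x + τ) * pochAdd τ (-x) * (pochAdd τ (x + τ - σ) *
    pochAdd τ (σ - x)) * (pochAdd τ (τ + x - ζ) * pochAdd τ (ζ - x) *
    (pochAdd τ (ζ + τ + x - σ) * pochAdd τ (σ - ζ - x))))) * e

/-- The identity between the normalization factors at the critical level: the ratio of the factors
for the nomes `p` and `p* = p q^{2N}` is a ratio of odd theta functions. -/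
theorem kappaAdd_mul_oddTheta (hx : OffLattice ζ τ x) (hτ : 0 < τ.im) (hζ : 0 < ζ.im) (hN : N ≠ 0)
    {σ : ℂ} (hσ : σ = N * ζ) :
    kappaAdd (τ + σ) σ ζ (x + τ) * kappaAdd τ σ ζ (x - σ) *
      (oddTheta τ x * oddTheta τ (x - σ)) =
    kappaAdd τ σ ζ (x + τ) * kappaAdd (τ + σ) σ ζ (x - σ) *
      (oddTheta τ (x - ζ) * oddTheta τ (x - σ + ζ)) := by
  have H1 := kappaAdd_star hx hτ hζ hN hσ
  have H2 := kappaAdd_shift hx hτ hζ hN hσ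
  have H3 := oddTheta_mul_oddTheta_eq hτ x σ ζ
  have nA := @OffLattice.pochAdd_ne_zero' τ ζ x N hx hζ hN
  rw [← hσ] at nA
  have nP := @OffLattice.pochAdd_ne_zero τ ζ x hx hτ
  have a : pochAdd σ (ζ + x - σ) * pochAdd σ (τ + σ - ζ + x) *
      pochAdd σ (ζ - x - τ) * pochAdd σ (2 * σ - ζ - x) ≠ 0 := by
    refine mul_ne_zero (mul_ne_zero (mul_ne_zero ?_ ?_) ?_) ?_
    · exact nA (1 - N) 0 (Or.inl (by rw [hσ]; push_cast; ring))
    · exact nA (N - 1) 1 (Or.inl (by rw [hσ]; push_cast; ring))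
    · exact nA 1 (-1) (Or.inr (by push_cast; ring))
    · exact nA (2 * N - 1) 0 (Or.inr (by rw [hσ]; push_cast; ring))
  have b : pochAdd σ (σ - x - τ) * pochAdd σ (σ - x) * pochAdd σ x * pochAdd σ (x + τ) ≠ 0 := by
    refine mul_ne_zero (mul_ne_zero (mul_ne_zero ?_ ?_) ?_) ?_
    · exact nA N (-1) (Or.inr (by rw [hσ]; push_cast; ring))
    · exact nA N 0 (Or.inr (by rw [hσ]; push_cast; ring))
    · exact nA 0 0 (Or.inl (by push_cast; ring))
    · exact nA 0 1 (Or.inl (by push_cast; ring))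
  have d : pochAdd τ (ζ + τ + x - σ) * pochAdd τ (τ + x - ζ) *
      pochAdd τ (ζ - x) * pochAdd τ (σ - ζ - x) ≠ 0 := by
    refine mul_ne_zero (mul_ne_zero (mul_ne_zero ?_ ?_) ?_) ?_
    · exact nP (1 - N) 1 (Or.inl (by rw [hσ]; push_cast; ring))
    · exact nP (-1) 1 (Or.inl (by push_cast; ring))
    · exact nP 1 0 (Or.inr (by push_cast; ring))
    · exact nP (N - 1) 0 (Or.inr (by rw [hσ]; push_cast; ring))
  generalize pochAdd σ (ζ + x - σ) * pochAdd σ (τ + σ - ζ + x) *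
      pochAdd σ (ζ - x - τ) * pochAdd σ (2 * σ - ζ - x) = a' at *
  generalize pochAdd σ (σ - x - τ) * pochAdd σ (σ - x) * pochAdd σ x * pochAdd σ (x + τ) = b' at *
  generalize pochAdd τ (ζ + τ + x - σ) * pochAdd τ (τ + x - ζ) *
      pochAdd τ (ζ - x) * pochAdd τ (σ - ζ - x) = d' at *
  generalize pochAdd τ (x + τ - σ) * pochAdd τ (x + τ) * pochAdd τ (-x) * pochAdd τ (σ - x) = e'
    at *
  refine mul_right_cancel₀ (mul_ne_zero (mul_ne_zero a b) d) ?_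
  generalize oddTheta τ x * oddTheta τ (x - σ) = T at *
  generalize oddTheta τ (x - ζ) * oddTheta τ (x - σ + ζ) = S at *
  generalize kappaAdd τ σ ζ (x - σ) = k1 at *
  generalize kappaAdd τ σ ζ (x + τ) = k2 at *
  generalize kappaAdd (τ + σ) σ ζ (x - σ) = k3 at *
  generalize kappaAdd (τ + σ) σ ζ (x + τ) = k4 at *
  linear_combination (k1 * T * b' * d') * H1 + k1 * k3 * b' * b' * H3 + S * k3 * b' * H2

end

section

variable {τ σ ζ x : ℂ} {N : ℕ}

theorem bigTheta_em (σ u : ℂ) : bigTheta (em (2 * σ)) (em (2 * u)) =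
    pochAdd σ u * pochAdd σ (σ - u) * pochAdd σ σ := by
  rw [bigTheta, ← em_neg, ← em_add, show 2 * σ + -(2 * u) = 2 * (σ - u) by ring]
  rfl

/-- The part of `rScalar` that does not depend on the elliptic nome. -/
def rPrefactor (N : ℕ) (ζ ξ : ℂ) : ℂ :=
  tauFun N ζ (ζ / 2 - ξ) * em ((2 / (N : ℂ) - 2) * ξ) / N

theorem rScalar_eq (hN : N ≠ 0) (ζ τ ξ : ℂ) : rScalar N ζ τ ξ =
    rPrefactor N ζ ξ * (kappaAdd τ (N * ζ) ζ ξ * (oddTheta τ ζ / oddTheta τ (ξ + ζ))) := by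
  rw [rScalar, rPrefactor, invKappa_eq hN]
  ring

theorem kappaAdd_add_one (hN : N ≠ 0) (τ ζ ξ : ℂ) :
    kappaAdd τ (N * ζ) ζ (ξ + 1) = kappaAdd τ (N * ζ) ζ ξ := by
  rw [← invKappa_eq hN, ← invKappa_eq hN, em_pow, em_pow]
  congr 1
  have := em_two_mul_add_int ξ 1
  simpa using this

theorem OffLattice.rPrefactor_ne_zero (hx : OffLattice ζ τ x) (hζ : 0 < ζ.im) (hN : N ≠ 0) :
    rPrefactor N ζ x ≠ 0 := by
  have hN' : (N : ℂ) ≠ 0 := by exact_mod_cast hN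
  have hσi : 0 < ((N : ℂ) * ζ).im := by
    have : (0 : ℝ) < N := by exact_mod_cast Nat.pos_of_ne_zero hN
    simpa using mul_pos this hζ
  have nA := @OffLattice.pochAdd_ne_zero' τ ζ x N hx hζ hN
  have n0 : pochAdd ((N : ℂ) * ζ) (N * ζ) ≠ 0 := by
    refine EllipticAlgebra.pochAdd_ne_zero hσi fun k n h => ?_
    have h' := congrArg Complex.im h
    rw [show (N : ℂ) * ζ + n * (N * ζ) = ((n + 1 : ℕ) : ℂ) * (N * ζ) by push_cast; ring,
      Complex.mul_im, Complex.natCast_re, Complex.natCast_im, zero_mul, add_zero,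
      Complex.intCast_im] at h'
    have : (0 : ℝ) < (n + 1 : ℕ) := by positivity
    exact (mul_pos this hσi).ne' h'
  have e1 : em ζ ^ (2 * N) = em (2 * (N * ζ)) := by rw [em_pow]; congr 1; push_cast; ring
  have e2 : em ζ * em (ζ / 2 - x) ^ 2 = em (2 * (ζ - x)) := by
    rw [em_pow, ← em_add]; congr 1; push_cast; ring
  have e3 : em ζ * (em (ζ / 2 - x) ^ 2)⁻¹ = em (2 * x) := by
    rw [em_pow, ← em_neg, ← em_add]; congr 1; push_cast; ring
  rw [rPrefactor, tauFun, e1, e2, e3, bigTheta_em, bigTheta_em]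
  refine div_ne_zero (mul_ne_zero (mul_ne_zero (em_ne_zero _) (div_ne_zero ?_ ?_))
    (em_ne_zero _)) hN'
  · refine mul_ne_zero (mul_ne_zero ?_ ?_) n0
    · exact nA 1 0 (Or.inr (by push_cast; ring))
    · exact nA (N - 1) 0 (Or.inl (by push_cast; ring))
  · refine mul_ne_zero (mul_ne_zero ?_ ?_) n0
    · exact nA 0 0 (Or.inl (by push_cast; ring))
    · exact nA N 0 (Or.inr (by push_cast; ring))

theorem OffLattice.oddTheta_ne_zero (hx : OffLattice ζ τ x) (hτ : 0 < τ.im) {u : ℂ} (l m : ℤ)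
    (h : u = x + l * ζ + m * τ ∨ u = -x + l * ζ + m * τ) : oddTheta τ u ≠ 0 := by
  intro h0
  obtain ⟨m', n', h'⟩ := ((isOddTheta_oddTheta hτ).zero_iff u).1 h0
  refine hx.mul_add_ne l m h m' 0 (-n') ?_
  push_cast
  linear_combination h'

theorem oddTheta_ne_zero_of (hτ : 0 < τ.im) (h : ∀ m n : ℤ, ζ ≠ m + n * τ) :
    oddTheta τ ζ ≠ 0 := by
  intro h0
  obtain ⟨m, n, h'⟩ := ((isOddTheta_oddTheta hτ).zero_iff ζ).1 h0
  exact h m n h'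

theorem OffLattice.rScalar_ne_zero (hx : OffLattice ζ τ x) (hτ : 0 < τ.im) (hζ : 0 < ζ.im)
    (hN : N ≠ 0) (h0 : oddTheta τ ζ ≠ 0) : rScalar N ζ τ x ≠ 0 := by
  rw [rScalar_eq hN]
  refine mul_ne_zero (hx.rPrefactor_ne_zero hζ hN) (mul_ne_zero (hx.kappaAdd_ne_zero hτ hζ hN)
    (div_ne_zero h0 (hx.oddTheta_ne_zero hτ 1 0 (Or.inl (by push_cast; ring)))))

theorem oddTheta_add_tau_add_one (hτ : 0 < τ.im) (z : ℂ) :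
    oddTheta τ (z + τ + 1) = em (-τ - 2 * z) * oddTheta τ z := by
  have h := isOddTheta_oddTheta hτ
  have e : em (-τ - 2 * z) = em (-τ) * em (-(2 * (1 : ℤ) * z)) := by
    rw [← em_add]; congr 1; push_cast; ring
  rw [h.add_one, h.add_tau, e]
  push_cast
  ring

/-- The identity between the normalization factors of the R-matrices at the critical level: it
balances the scalars in the unitarity and crossing relations for the nomes `p` and `p*`. -/
theorem rScalar_identity (hx : OffLattice ζ τ x) (hτ : 0 < τ.im) (hζ : 0 < ζ.im) (hN : N ≠ 0) :
    rScalar N ζ (τ + N * ζ) (x + τ + 1) * em (-(τ + N * ζ) - 2 * (ζ / N) - 2 * (x - N * ζ)) *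
      (rScalar N ζ τ (x - N * ζ) *
        -(N ^ 2 * (oddTheta τ x * oddTheta τ (x - N * ζ) / oddTheta τ ζ ^ 2))) =
    rScalar N ζ τ (x + τ + 1) * em (-τ - 2 * (ζ / N) - 2 * x) *
      (N ^ 2 * (oddTheta τ (ζ + x) * oddTheta τ (ζ - x) / oddTheta τ ζ ^ 2)) *
        rScalar N ζ (τ + N * ζ) (x - N * ζ) := by
  have hσi : 0 < ((N : ℂ) * ζ).im := by
    have : (0 : ℝ) < N := by exact_mod_cast Nat.pos_of_ne_zero hN
    simpa using mul_pos this hζ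
  have hτi : 0 < (τ + N * ζ).im := by simpa using add_pos hτ hσi
  have H := kappaAdd_mul_oddTheta hx hτ hζ hN rfl
  have hneg := (isOddTheta_oddTheta hτ).neg hτ (x - ζ)
  rw [show -(x - ζ) = ζ - x by ring] at hneg
  have s1 : oddTheta (τ + N * ζ) (x + τ + 1 + ζ) =
      em (-(τ + N * ζ) - 2 * (x - N * ζ + ζ)) * oddTheta (τ + N * ζ) (x - N * ζ + ζ) := by
    rw [← oddTheta_add_tau_add_one hτi]; congr 1; ring
  have s2 : oddTheta τ (x + τ + 1 + ζ) = em (-τ - 2 * (x + ζ)) * oddTheta τ (x + ζ) := by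
    rw [← oddTheta_add_tau_add_one hτ]; congr 1; ring
  have e1 : em (-(τ + N * ζ) - 2 * (ζ / N) - 2 * (x - N * ζ)) =
      em (2 * ζ - 2 * (ζ / N)) * em (-(τ + N * ζ) - 2 * (x - N * ζ + ζ)) := by
    rw [← em_add]; congr 1; ring
  have e2 : em (-τ - 2 * (ζ / N) - 2 * x) = em (2 * ζ - 2 * (ζ / N)) * em (-τ - 2 * (x + ζ)) := by
    rw [← em_add]; congr 1; ring
  have n1 : oddTheta τ (x + ζ) ≠ 0 := hx.oddTheta_ne_zero hτ 1 0 (Or.inl (by push_cast; ring))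
  have n2 : oddTheta τ (x - N * ζ + ζ) ≠ 0 :=
    hx.oddTheta_ne_zero hτ (1 - N) 0 (Or.inl (by push_cast; ring))
  have n3 : oddTheta (τ + N * ζ) (x - N * ζ + ζ) ≠ 0 :=
    hx.of_star.oddTheta_ne_zero hτi (1 - N) 0 (Or.inl (by push_cast; ring))
  simp only [rScalar_eq hN, kappaAdd_add_one hN]
  rw [s1, s2, e1, e2, hneg, add_comm ζ x]
  have m1 := em_ne_zero (-(τ + N * ζ) - 2 * (x - N * ζ + ζ))
  have m2 := em_ne_zero (-τ - 2 * (x + ζ))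
  generalize em (-(τ + N * ζ) - 2 * (x - N * ζ + ζ)) = a1 at *
  generalize em (-τ - 2 * (x + ζ)) = a2 at *
  generalize em (2 * ζ - 2 * (ζ / N)) = a3 at *
  generalize kappaAdd τ (N * ζ) ζ (x - N * ζ) = k1 at *
  generalize kappaAdd τ (N * ζ) ζ (x + τ) = k2 at *
  generalize kappaAdd (τ + N * ζ) (N * ζ) ζ (x - N * ζ) = k3 at *
  generalize kappaAdd (τ + N * ζ) (N * ζ) ζ (x + τ) = k4 at *
  generalize oddTheta τ (x + ζ) = t1 at *
  generalize oddTheta τ (x - N * ζ + ζ) = t2 at *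
  generalize oddTheta (τ + N * ζ) (x - N * ζ + ζ) = t3 at *
  generalize oddTheta τ (x - N * ζ) = t4 at *
  generalize oddTheta τ (x - ζ) = t5 at *
  generalize oddTheta τ x = t6 at *
  generalize rPrefactor N ζ (x + τ + 1) = f1
  generalize rPrefactor N ζ (x - N * ζ) = f2
  generalize (N : ℂ) ^ 2 = M
  by_cases h1 : oddTheta τ ζ = 0
  · simp [h1]
  generalize oddTheta τ ζ = w1 at *
  generalize oddTheta (τ + N * ζ) ζ = w2 at *
  field_simp
  linear_combination (-(f1 * w2 * a3 * f2 * M)) * H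

end

/-! ### Central elements from exchange relations -/

section

variable {N : ℕ} {A : Type*} [Ring A]

theorem leg₁_apply (X : Matrix (Fin N) (Fin N) A) (a b : Fin N × Fin N) :
    leg₁ X a b = if a.2 = b.2 then X a.1 b.1 else 0 := by
  simp [leg₁, Matrix.kroneckerMap_apply, Matrix.one_apply]

theorem leg₂_apply (X : Matrix (Fin N) (Fin N) A) (a b : Fin N × Fin N) :
    leg₂ X a b = if a.1 = b.1 then X a.2 b.2 else 0 := by
  simp [leg₂, Matrix.kroneckerMap_apply, Matrix.one_apply]

theorem leg₁_mul (X Y : Matrix (Fin N) (Fin N) A) : leg₁ (X * Y) = leg₁ X * leg₁ Y := by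
  ext ⟨a, b⟩ ⟨c, d⟩
  simp only [leg₁_apply, Matrix.mul_apply, Fintype.sum_prod_type]
  by_cases h : b = d <;> simp [h]

theorem leg₁_one : leg₁ (1 : Matrix (Fin N) (Fin N) A) = 1 := by
  ext ⟨a, b⟩ ⟨c, d⟩
  simp only [leg₁_apply, Matrix.one_apply, Prod.mk.injEq]
  by_cases h : b = d <;> simp [h]

theorem leg₂_mul_leg₁_apply (X Y : Matrix (Fin N) (Fin N) A) (a b : Fin N × Fin N) :
    (leg₂ X * leg₁ Y) a b = X a.2 b.2 * Y a.1 b.1 := by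
  simp [leg₁_apply, leg₂_apply, Matrix.mul_apply, Fintype.sum_prod_type]

theorem leg₁_mul_leg₂_apply (X Y : Matrix (Fin N) (Fin N) A) (a b : Fin N × Fin N) :
    (leg₁ X * leg₂ Y) a b = X a.1 b.1 * Y a.2 b.2 := by
  simp [leg₁_apply, leg₂_apply, Matrix.mul_apply, Fintype.sum_prod_type]

variable [Algebra ℂ A]

theorem scalarMat_mul {n : Type*} [Fintype n] (X Y : Matrix n n ℂ) :
    scalarMat A (X * Y) = scalarMat A X * scalarMat A Y :=
  Matrix.map_mul

theorem scalarMat_smul_one {n : Type*} [DecidableEq n] (r : ℂ) :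
    scalarMat A (r • (1 : Matrix n n ℂ)) = r • (1 : Matrix n n A) := by
  ext i j
  by_cases h : i = j <;> simp [scalarMat, h, Algebra.algebraMap_eq_smul_one]

theorem scalarMat_kronecker_one (X : Matrix (Fin N) (Fin N) ℂ) :
    scalarMat A (X ⊗ₖ (1 : Matrix (Fin N) (Fin N) ℂ)) = leg₁ (scalarMat A X) := by
  ext ⟨a, b⟩ ⟨c, d⟩
  by_cases h : b = d <;> simp [scalarMat, leg₁_apply, h]

theorem commute_leg₁_scalarMat_leg₂ (X : Matrix (Fin N) (Fin N) ℂ)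
    (Y : Matrix (Fin N) (Fin N) A) : Commute (leg₁ (scalarMat A X)) (leg₂ Y) := by
  ext a b
  rw [leg₁_mul_leg₂_apply, leg₂_mul_leg₁_apply]
  exact Algebra.commutes _ _

/-- The partial trace, over the first tensor factor, of the exchange relation between a matrix
`Q` and a matrix `L`. -/
theorem trace_mul_of_exchange {R C : Matrix (Fin N × Fin N) (Fin N × Fin N) ℂ}
    {Q L : Matrix (Fin N) (Fin N) A} {ν μ s : ℂ}
    (hRC : ∀ i k l m : Fin N, ∑ p, ∑ r, R (p, i) (l, r) * C (m, r) (p, k) =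
      ν * ((1 : Matrix (Fin N) (Fin N) ℂ) m l * (1 : Matrix (Fin N) (Fin N) ℂ) i k))
    (h : s • (scalarMat A R * leg₁ Q * scalarMat A C * leg₂ L) = μ • (leg₂ L * leg₁ Q))
    (i j : Fin N) : (s * ν) • (Q.trace * L i j) = μ • (L i j * Q.trace) := by
  have key : ∀ k : Fin N, ∑ p, (scalarMat A R * leg₁ Q * scalarMat A C) (p, i) (p, k) =
      ν • ((1 : Matrix (Fin N) (Fin N) A) i k * Q.trace) := by
    intro k
    have e : ∀ p, (scalarMat A R * leg₁ Q * scalarMat A C) (p, i) (p, k) =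
        ∑ m, ∑ l, ∑ r, (R (p, i) (l, r) * C (m, r) (p, k)) • Q l m := by
      intro p
      simp only [Matrix.mul_apply, Fintype.sum_prod_type, leg₁_apply, scalarMat, Matrix.map_apply,
        mul_ite, mul_zero, Finset.sum_ite_eq', Finset.mem_univ, if_true, Finset.sum_mul]
      refine Finset.sum_congr rfl fun m _ => ?_
      rw [Finset.sum_comm]
      refine Finset.sum_congr rfl fun l _ => Finset.sum_congr rfl fun r _ => ?_
      rw [← Algebra.smul_def, smul_mul_assoc, ← Algebra.commutes, ← Algebra.smul_def, smul_smul]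
    simp only [e]
    rw [Finset.sum_comm]
    have e2 : ∀ m, ∑ p, ∑ l, ∑ r, (R (p, i) (l, r) * C (m, r) (p, k)) • Q l m =
        ν • ((1 : Matrix (Fin N) (Fin N) A) i k * Q m m) := by
      intro m
      rw [Finset.sum_comm]
      simp only [← Finset.sum_smul, hRC]
      rw [Finset.sum_eq_single m]
      · by_cases hik : i = k <;> simp [Matrix.one_apply, hik]
      · intro l _ hl
        simp [Matrix.one_apply, hl.symm]
      · simp
    rw [Finset.sum_congr rfl fun m _ => e2 m, ← Finset.smul_sum, ← Finset.mul_sum]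
    rfl
  have h2 := Finset.sum_congr (rfl : (Finset.univ : Finset (Fin N)) = _)
    fun p _ => congrFun (congrFun h (p, i)) (p, j)
  simp only [Matrix.smul_apply, ← Finset.smul_sum, leg₂_mul_leg₁_apply, ← Finset.mul_sum] at h2
  have h3 : ∑ p, (scalarMat A R * leg₁ Q * scalarMat A C * leg₂ L) (p, i) (p, j) =
      ∑ k, (∑ p, (scalarMat A R * leg₁ Q * scalarMat A C) (p, i) (p, k)) * L k j := by
    simp only [Finset.sum_mul]
    rw [Finset.sum_comm]
    refine Finset.sum_congr rfl fun p _ => ?_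
    rw [Matrix.mul_apply, Fintype.sum_prod_type, Finset.sum_comm]
    refine Finset.sum_congr rfl fun k _ => ?_
    simp [leg₂_apply]
  rw [h3] at h2
  simp only [key] at h2
  rw [Finset.sum_eq_single i (fun k _ hk => by simp [hk.symm]) (by simp)] at h2
  rw [Matrix.one_apply_eq, one_mul, smul_mul_assoc, smul_smul] at h2
  exact h2

/-- If the exchange relations of `P` and `U` with `L` are linked by unitarity and crossing relations
for the numerical R-matrices, and the scalars in these relations balance, then the trace of
`P (H U H⁻¹)⁻¹` commutes with the entries of `L`. -/
theorem commute_trace_of_exchange {P U : (Matrix (Fin N) (Fin N) A)ˣ} {L : Matrix (Fin N) (Fin N) A}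
    {H : (Matrix (Fin N) (Fin N) ℂ)ˣ} {H' : (Matrix (Fin N) (Fin N) A)ˣ}
    (hH : H'.val = scalarMat A H.val) (hH' : H'⁻¹.val = scalarMat A H⁻¹.val)
    {RP RP' RU RU' C C' : Matrix (Fin N × Fin N) (Fin N × Fin N) ℂ} {a a' μ ν : ℂ}
    (hP : scalarMat A RP * leg₁ P.val * leg₂ L = leg₂ L * leg₁ P.val * scalarMat A RP')
    (hU : scalarMat A RU * leg₁ U.val * leg₂ L = leg₂ L * leg₁ U.val * scalarMat A RU')
    (hC : C * ((H.val ⊗ₖ 1) * RU * (H⁻¹.val ⊗ₖ 1)) = a • (1 : Matrix _ _ ℂ))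
    (hC' : ((H.val ⊗ₖ 1) * RU' * (H⁻¹.val ⊗ₖ 1)) * C' = a' • (1 : Matrix _ _ ℂ))
    (hPC : RP' * C' = μ • (1 : Matrix _ _ ℂ))
    (hcross : ∀ i k l m : Fin N, ∑ p, ∑ r, RP (p, i) (l, r) * C (m, r) (p, k) =
      ν * ((1 : Matrix (Fin N) (Fin N) ℂ) m l * (1 : Matrix (Fin N) (Fin N) ℂ) i k))
    (hbal : a' * ν = a * μ) (h0 : a' * ν ≠ 0) (i j : Fin N) :
    Commute (Matrix.trace (P * (H' * U * H'⁻¹)⁻¹).val) (L i j) := by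
  set V := H' * U * H'⁻¹ with hV
  have hhi : leg₁ H'.val * leg₁ H'⁻¹.val = 1 := by rw [← leg₁_mul, Units.mul_inv, leg₁_one]
  have hih : leg₁ H'⁻¹.val * leg₁ H'.val = 1 := by rw [← leg₁_mul, Units.inv_mul, leg₁_one]
  have hVM : leg₁ V.val * leg₁ V⁻¹.val = 1 := by rw [← leg₁_mul, Units.mul_inv, leg₁_one]
  have hMV : leg₁ V⁻¹.val * leg₁ V.val = 1 := by rw [← leg₁_mul, Units.inv_mul, leg₁_one]
  have hVe : leg₁ V.val = leg₁ H'.val * leg₁ U.val * leg₁ H'⁻¹.val := by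
    rw [← leg₁_mul, ← leg₁_mul, hV, Units.val_mul, Units.val_mul]
  have c1 : leg₁ H'.val * leg₂ L = leg₂ L * leg₁ H'.val := by
    rw [hH]; exact commute_leg₁_scalarMat_leg₂ _ _
  have c2 : leg₁ H'⁻¹.val * leg₂ L = leg₂ L * leg₁ H'⁻¹.val := by
    rw [hH']; exact commute_leg₁_scalarMat_leg₂ _ _
  have hC1 := congrArg (scalarMat A) hC
  have hC2 := congrArg (scalarMat A) hC'
  have hC3 := congrArg (scalarMat A) hPC
  simp only [scalarMat_mul, scalarMat_smul_one, scalarMat_kronecker_one, ← hH, ← hH'] at hC1 hC2 hC3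
  rw [Units.val_mul]
  have hQ : leg₁ (P.val * V⁻¹.val) = leg₁ P.val * leg₁ V⁻¹.val := leg₁_mul _ _
  generalize hq : P.val * V⁻¹.val = Q at hQ ⊢
  -- the partial trace is taken once the R-matrices on the right are removed
  suffices hex : a' • (scalarMat A RP * leg₁ Q * scalarMat A C * leg₂ L) =
      (a * μ) • (leg₂ L * leg₁ Q) by
    have := trace_mul_of_exchange hcross hex i j
    rw [hbal] at this h0
    exact smul_right_injective A h0 this
  rw [hQ]
  generalize leg₁ H'.val = h at *
  generalize leg₁ H'⁻¹.val = hi at *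
  generalize leg₁ V.val = v at *
  generalize leg₁ V⁻¹.val = w at *
  generalize leg₁ U.val = u at *
  generalize leg₁ P.val = p at *
  generalize leg₂ L = l at *
  generalize scalarMat A RP = rp at *
  generalize scalarMat A RP' = rp' at *
  generalize scalarMat A RU = ru at *
  generalize scalarMat A RU' = ru' at *
  generalize scalarMat A C = c at *
  generalize scalarMat A C' = c' at *
  -- from here on `h`, `hi`, `v`, `w`, `u`, `p` are first legs and `l` is a second leg
  have e1 : a • (v * l * c') = a' • (c * l * v) := by
    calc a • (v * l * c') = (c * (h * ru * hi)) * (v * l * c') := by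
          rw [hC1, smul_mul_assoc, one_mul]
      _ = c * h * ru * (hi * h) * u * (hi * l) * c' := by rw [hVe]; simp only [mul_assoc]
      _ = c * h * (ru * u * l) * hi * c' := by rw [hih, c2]; simp only [mul_assoc, mul_one]
      _ = c * (h * l) * u * ru' * hi * c' := by rw [hU]; simp only [mul_assoc]
      _ = c * l * h * u * (hi * h) * ru' * hi * c' := by
          rw [c1, hih]; simp only [mul_assoc, one_mul]
      _ = c * l * v * (h * ru' * hi * c') := by rw [hVe]; simp only [mul_assoc]
      _ = a' • (c * l * v) := by rw [hC2, mul_smul_comm, mul_one]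
  have e2 : a • (l * c' * w) = a' • (w * c * l) := by
    have := congrArg (fun z => w * z * w) e1
    simp only [mul_smul_comm, smul_mul_assoc] at this
    calc a • (l * c' * w) = a • (w * (v * l * c') * w) := by
          rw [show w * (v * l * c') * w = (w * v) * l * c' * w by simp only [mul_assoc], hMV, one_mul]
      _ = a' • (w * (c * l * v) * w) := this
      _ = a' • (w * c * l * (v * w)) := by simp only [mul_assoc]
      _ = a' • (w * c * l) := by rw [hVM, mul_one]
  calc a' • (rp * (p * w) * c * l) = rp * p * (a' • (w * c * l)) := by
        rw [mul_smul_comm]; simp only [mul_assoc]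
    _ = a • ((rp * p * l) * c' * w) := by rw [← e2, mul_smul_comm]; simp only [mul_assoc]
    _ = a • (l * p * (rp' * c') * w) := by rw [hP]; simp only [mul_assoc]
    _ = (a * μ) • (l * (p * w)) := by
        rw [hC3, mul_smul_comm, smul_mul_assoc, mul_one, smul_smul, mul_assoc]

end

/-! ### The trace operators -/

section

variable {N : ℕ} {ζ τ c : ℂ}

theorem Generic.offLattice {x : ℂ} (h : Generic ζ τ c x) : OffLattice ζ τ x := by
  intro k l m hx
  exact h k l m 0 (by push_cast; linear_combination hx)

/-- At integral level, the shifted period `τ - c ζ` does not enlarge the lattice. -/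
theorem OffLattice.generic {x : ℂ} (h : OffLattice ζ τ x) : Generic ζ τ (-(N : ℂ)) x := by
  intro k l m n hx
  exact h k (l + n * N) (m + n) (by push_cast; linear_combination hx)

/-- The canonical map from the free algebra. -/
def freeToSL (N : ℕ) (ζ τ c : ℂ) : FreeAlgebra ℂ (Gen N) →ₐ[ℂ] AlgSL N ζ τ c :=
  (RingQuot.mkAlgHom ℂ (RelSL N ζ τ c)).comp (RingQuot.mkAlgHom ℂ (RelGL N ζ τ c))

theorem freeToSL_surjective (N : ℕ) (ζ τ c : ℂ) : Function.Surjective (freeToSL N ζ τ c) :=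
  (RingQuot.mkAlgHom_surjective ℂ _).comp (RingQuot.mkAlgHom_surjective ℂ _)

theorem freeToSL_L (η : ℂ) (i j : Fin N) :
    freeToSL N ζ τ c (FreeAlgebra.ι ℂ (Gen.L η i j)) = (LMat N ζ τ c η).val i j :=
  rfl

theorem freeToSL_Linv (η : ℂ) (i j : Fin N) :
    freeToSL N ζ τ c (FreeAlgebra.ι ℂ (Gen.Linv η i j)) = (LMat N ζ τ c η)⁻¹.val i j :=
  rfl

theorem map_leg₁ {A B : Type*} [Ring A] [Ring B] [Algebra ℂ A] [Algebra ℂ B] (f : A →ₐ[ℂ] B)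
    (X : Matrix (Fin N) (Fin N) A) : (leg₁ X).map f = leg₁ (X.map f) := by
  ext a b
  simp only [Matrix.map_apply, leg₁_apply]
  split_ifs <;> simp

theorem map_leg₂ {A B : Type*} [Ring A] [Ring B] [Algebra ℂ A] [Algebra ℂ B] (f : A →ₐ[ℂ] B)
    (X : Matrix (Fin N) (Fin N) A) : (leg₂ X).map f = leg₂ (X.map f) := by
  ext a b
  simp only [Matrix.map_apply, leg₂_apply]
  split_ifs <;> simp

/-- The exchange relation in the quotient by the quantum determinant. -/
theorem exchange_LMat {ξ η : ℂ} (h : Generic ζ τ c (ξ - η)) :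
    scalarMat (AlgSL N ζ τ c) (rHat N ζ τ (ξ - η)) * leg₁ (LMat N ζ τ c ξ).val *
        leg₂ (LMat N ζ τ c η).val =
      leg₂ (LMat N ζ τ c η).val * leg₁ (LMat N ζ τ c ξ).val *
        scalarMat (AlgSL N ζ τ c) (rHatStar N ζ τ c (ξ - η)) := by
  have hL : ∀ ξ, (LMat N ζ τ c ξ).val = (freeL N ξ).map (freeToSL N ζ τ c) := fun ξ => rfl
  have hs : ∀ X : Matrix (Fin N × Fin N) (Fin N × Fin N) ℂ, scalarMat (AlgSL N ζ τ c) X =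
      (scalarMat (FreeAlgebra ℂ (Gen N)) X).map (freeToSL N ζ τ c) :=
    fun X => by ext a b; exact ((freeToSL N ζ τ c).commutes _).symm
  rw [hL, hL, hs (rHat N ζ τ (ξ - η)), hs (rHatStar N ζ τ c (ξ - η)), ← map_leg₁, ← map_leg₂, ← Matrix.map_mul, ← Matrix.map_mul, ← Matrix.map_mul, ← Matrix.map_mul]
  ext a b
  exact congrArg (RingQuot.mkAlgHom ℂ (RelSL N ζ τ c))
    (RingQuot.mkAlgHom_rel ℂ (RelGL.rll ξ η h a b))

/-- At the critical level, the trace operators commute with the generators in generic spectral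
parameters. -/
theorem commute_tOp_LMat (hN : N ≠ 0) (hζ : 0 < ζ.im) (hτ : 0 < τ.im)
    (hR : ∀ m n : ℤ, ζ ≠ m + n * τ) (hR' : ∀ m n : ℤ, ζ ≠ m + n * (τ + N * ζ)) {ξ η : ℂ}
    (h : OffLattice ζ τ (ξ - η)) (i j : Fin N) :
    Commute (tOp N ζ τ (-(N : ℂ)) ξ) ((LMat N ζ τ (-(N : ℂ)) η).val i j) := by
  have hN' : (N : ℂ) ≠ 0 := by exact_mod_cast hN
  have hηζ : (N : ℂ) * (ζ / N) = ζ := mul_div_cancel₀ _ hN'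
  have hσi : 0 < ((N : ℂ) * ζ).im := by
    have : (0 : ℝ) < N := by exact_mod_cast Nat.pos_of_ne_zero hN
    simpa using mul_pos this hζ
  have hτi : 0 < (τ + N * ζ).im := by simpa using add_pos hτ hσi
  have hθ := isOddTheta_oddTheta hτ
  have hθ' := isOddTheta_oddTheta hτi
  have z0 := oddTheta_ne_zero_of hτ hR
  have z0' := oddTheta_ne_zero_of hτi hR'
  set x := ξ - η with hx
  have hy : OffLattice ζ τ (x - N * ζ) := by
    convert h.add 0 (-N) 0 using 1; push_cast; ring
  have hu : OffLattice ζ τ (x + τ + 1) := by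
    convert h.add 1 0 1 using 1; push_cast; ring
  have hst : τ - -(N : ℂ) * ζ = τ + N * ζ := by ring
  have E1 := exchange_LMat (N := N) (c := -(N : ℂ)) (ξ := ξ - N * ζ) (η := η)
    (by rw [show ξ - N * ζ - η = x - N * ζ by ring]; exact hy.generic)
  have E2 := exchange_LMat (N := N) (c := -(N : ℂ)) (ξ := ξ + τ + 1) (η := η)
    (by rw [show ξ + τ + 1 - η = x + τ + 1 by ring]; exact hu.generic)
  rw [show ξ - N * ζ - η = x - N * ζ by ring, rHatStar, hst, rHat_eq hN, rHat_eq hN] at E1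
  rw [show ξ + τ + 1 - η = x + τ + 1 by ring, rHatStar, hst, rHat_eq hN, rHat_eq hN] at E2
  have t := belavin_add_tau_add_one (N := N) (η := ζ / N) hθ x
  have t' := belavin_add_tau_add_one (N := N) (η := ζ / N) hθ' (x - N * ζ)
  rw [show x - N * ζ + (τ + N * ζ) + 1 = x + τ + 1 by ring] at t'
  have p1 : oddTheta τ (ζ + x) ≠ 0 := h.oddTheta_ne_zero hτ 1 0 (Or.inl (by push_cast; ring))
  have p2 : oddTheta τ (ζ - x) ≠ 0 := h.oddTheta_ne_zero hτ 1 0 (Or.inr (by push_cast; ring))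
  have p3 : oddTheta τ x ≠ 0 := h.oddTheta_ne_zero hτ 0 0 (Or.inl (by push_cast; ring))
  have p4 : oddTheta τ (x - N * ζ) ≠ 0 :=
    h.oddTheta_ne_zero hτ (-N) 0 (Or.inl (by push_cast; ring))
  have p5 : oddTheta (τ + N * ζ) (ζ + (x - N * ζ)) ≠ 0 :=
    hy.of_star.oddTheta_ne_zero hτi 1 0 (Or.inl (by push_cast; ring))
  have p6 : oddTheta (τ + N * ζ) (ζ - (x - N * ζ)) ≠ 0 :=
    hy.of_star.oddTheta_ne_zero hτi 1 0 (Or.inr (by push_cast; ring))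
  have U1 := belavinSwap_mul_belavin (η := ζ / N) (x := x) hθ hτ hN (by rwa [hηζ]) (by rwa [hηζ])
    (by rwa [hηζ])
  have U2 := belavin_mul_belavinSwap (η := ζ / N) hθ' hτi hN (by rwa [hηζ]) (x - N * ζ)
  have X := belavin_crossing (η := ζ / N) hθ hτ hN (by rwa [hηζ]) x
  rw [hηζ] at U1 U2 X
  have hbal := rScalar_identity h hτ hζ hN
  have T : tOp N ζ τ (-(N : ℂ)) ξ = Matrix.trace (LMat N ζ τ (-(N : ℂ)) (ξ - N * ζ) *
      (Units.map ((Algebra.ofId ℂ (AlgSL N ζ τ (-(N : ℂ)))).mapMatrix (m := Fin N)).toMonoidHom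
        (twist N) * LMat N ζ τ (-(N : ℂ)) (ξ + τ + 1) *
      (Units.map ((Algebra.ofId ℂ (AlgSL N ζ τ (-(N : ℂ)))).mapMatrix (m := Fin N)).toMonoidHom
        (twist N))⁻¹)⁻¹).val := by
    rw [tOp, LPlus, LMinus, show ξ + -(N : ℂ) / 2 * ζ + -(N : ℂ) / 2 * ζ = ξ - N * ζ by ring]
  rw [T]
  refine commute_trace_of_exchange (H := twist N) rfl rfl E1 E2
    (C := belavinSwap N τ (oddTheta τ) (ζ / N) (-x))
    (C' := belavinSwap N (τ + N * ζ) (oddTheta (τ + N * ζ)) (ζ / N) (-(x - N * ζ)))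
    (a := rScalar N ζ τ (x + τ + 1) * em (-τ - 2 * (ζ / N) - 2 * x) *
      (N ^ 2 * (oddTheta τ (ζ + x) * oddTheta τ (ζ - x) / oddTheta τ ζ ^ 2)))
    (a' := rScalar N ζ (τ + N * ζ) (x + τ + 1) *
      em (-(τ + N * ζ) - 2 * (ζ / N) - 2 * (x - N * ζ)) *
      (N ^ 2 * (oddTheta (τ + N * ζ) (ζ + (x - N * ζ)) * oddTheta (τ + N * ζ) (ζ - (x - N * ζ)) /
        oddTheta (τ + N * ζ) ζ ^ 2)))
    (μ := rScalar N ζ (τ + N * ζ) (x - N * ζ) *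
      (N ^ 2 * (oddTheta (τ + N * ζ) (ζ + (x - N * ζ)) * oddTheta (τ + N * ζ) (ζ - (x - N * ζ)) /
        oddTheta (τ + N * ζ) ζ ^ 2)))
    (ν := rScalar N ζ τ (x - N * ζ) *
      -(N ^ 2 * (oddTheta τ x * oddTheta τ (x - N * ζ) / oddTheta τ ζ ^ 2)))
    ?_ ?_ ?_ ?_ ?_ ?_ i j
  · rw [Matrix.mul_smul, Matrix.smul_mul, t, smul_smul, Matrix.mul_smul, U1, smul_smul]
  · rw [Matrix.mul_smul, Matrix.smul_mul, t', smul_smul, Matrix.smul_mul, U2, smul_smul]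
  · rw [Matrix.smul_mul, U2, smul_smul]
  · intro i k l m
    simp only [Matrix.smul_apply, smul_eq_mul, mul_assoc, ← Finset.mul_sum]
    rw [X]
  · linear_combination (N ^ 2 * (oddTheta (τ + N * ζ) (ζ + (x - N * ζ)) *
      oddTheta (τ + N * ζ) (ζ - (x - N * ζ)) / oddTheta (τ + N * ζ) ζ ^ 2)) * hbal
  · refine mul_ne_zero (mul_ne_zero (mul_ne_zero (hu.of_star.rScalar_ne_zero hτi hζ hN z0')
      (em_ne_zero _)) ?_) (mul_ne_zero (hy.rScalar_ne_zero hτ hζ hN z0) (neg_ne_zero.2 ?_))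
    · exact mul_ne_zero (pow_ne_zero _ hN') (div_ne_zero (mul_ne_zero p5 p6) (pow_ne_zero _ z0'))
    · exact mul_ne_zero (pow_ne_zero _ hN') (div_ne_zero (mul_ne_zero p3 p4) (pow_ne_zero _ z0))

theorem countable_not_generic (ζ τ c η : ℂ) : {ξ : ℂ | ¬ Generic ζ τ c (ξ - η)}.Countable := by
  refine (Set.countable_range fun p : ℤ × ℤ × ℤ × ℤ =>
    η + (p.1 + p.2.1 * ζ + p.2.2.1 * τ + p.2.2.2 * (τ - c * ζ))).mono fun ξ hξ => ?_
  simp only [Generic, not_forall, not_not, Set.mem_ofPred_eq] at hξ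
  obtain ⟨k, l, m, n, h⟩ := hξ
  exact ⟨(k, l, m, n), by simp only [← h]; ring⟩

/-- An element commuting with the entries of a matrix commutes with those of its inverse. -/
theorem commute_units_inv_apply {A : Type*} [Ring A] {t : A} {M : (Matrix (Fin N) (Fin N) A)ˣ}
    (h : ∀ i j, Commute t (M.val i j)) (i j : Fin N) : Commute t (M⁻¹.val i j) := by
  have h1 : Commute (Matrix.diagonal fun _ : Fin N => t) M.val := by
    ext a b
    rw [Matrix.diagonal_mul, Matrix.mul_diagonal]
    exact h a b
  have h2 := congrFun (congrFun h1.units_inv_right.eq i) j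
  rwa [Matrix.diagonal_mul, Matrix.mul_diagonal] at h2

/-- Central currents can be recognized on the generators. -/
theorem isCentralCurrent_of_generators {T : ℂ → AlgSL N ζ τ c}
    (h : ∀ ξ η : ℂ, Generic ζ τ c (ξ - η) → ∀ i j, Commute (T ξ) ((LMat N ζ τ c η).val i j)) :
    IsCentralCurrent T := by
  intro a
  obtain ⟨b, rfl⟩ := freeToSL_surjective N ζ τ c a
  induction b using FreeAlgebra.induction with
  | grade0 r =>
    refine Set.countable_empty.mono fun ξ hξ => hξ ?_
    rw [AlgHom.commutes]
    exact Algebra.commute_algebraMap_right _ _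
  | grade1 x =>
    cases x with
    | L η i j =>
      refine (countable_not_generic ζ τ c η).mono fun ξ hξ => ?_
      rw [Set.mem_ofPred_eq, freeToSL_L] at hξ
      refine fun hg => hξ ?_
      exact h ξ η hg i j
    | Linv η i j =>
      refine (countable_not_generic ζ τ c η).mono fun ξ hξ => ?_
      rw [Set.mem_ofPred_eq, freeToSL_Linv] at hξ
      refine fun hg => hξ ?_
      have h' := commute_units_inv_apply (t := T ξ) (M := LMat N ζ τ c η) (h ξ η hg) i j
      exact h'
  | mul a b ha hb =>
    refine (ha.union hb).mono fun ξ hξ => ?_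
    by_contra hn
    simp only [Set.mem_union, Set.mem_ofPred_eq, not_or, not_not] at hn
    exact hξ (by rw [map_mul]; exact hn.1.mul_right hn.2)
  | add a b ha hb =>
    refine (ha.union hb).mono fun ξ hξ => ?_
    by_contra hn
    simp only [Set.mem_union, Set.mem_ofPred_eq, not_or, not_not] at hn
    exact hξ (by rw [map_add]; exact hn.1.add_right hn.2)

end

end EllipticAlgebra

end

theorem theorem2 (N : ℕ) (hN : 2 ≤ N) (ζ τ c : ℂ)
    (hζ : 0 < ζ.im) (hτ : 0 < τ.im)
    (hc : c = -(N : ℂ))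
    (hR : ∀ m n : ℤ, ζ ≠ m + n * τ)
    (hRstar : ∀ m n : ℤ, ζ ≠ m + n * (τ - c * ζ)) :
    (∀ ξ η : ℂ, EllipticAlgebra.Generic ζ τ c (ξ - η) →
      ∀ i j : Fin N,
        Commute (EllipticAlgebra.tOp N ζ τ c ξ)
          ((EllipticAlgebra.LMat N ζ τ c η).val i j)) ∧
    EllipticAlgebra.IsCentralCurrent (EllipticAlgebra.tOp N ζ τ c) := by
  subst hc
  have hN0 : N ≠ 0 := by omega
  have key : ∀ ξ η : ℂ, EllipticAlgebra.Generic ζ τ (-(N : ℂ)) (ξ - η) → ∀ i j : Fin N,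
      Commute (EllipticAlgebra.tOp N ζ τ (-(N : ℂ)) ξ)
        ((EllipticAlgebra.LMat N ζ τ (-(N : ℂ)) η).val i j) := fun ξ η h i j =>
    EllipticAlgebra.commute_tOp_LMat hN0 hζ hτ hR
      (fun m n => by simpa only [neg_mul, sub_neg_eq_add] using hRstar m n) h.offLattice i j
  exact ⟨key, EllipticAlgebra.isCentralCurrent_of_generators key⟩
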